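/- Let $N\ge 0$ be an integer and let $\mathbf g=(g_1,g_2,\dots)$ be formal variables, $g_k$ having degree $k$. Let $$Z_N(\mathbf g)=\int_{U(N)}\mathrm dU\,\exp\Bigl(\sum_{k\ge1}\tfrac1k\,g_k\,\mathrm{Tr}\,U^k\,\mathrm{Tr}\,U^{-k}\Bigr)\in\mathbb C[[g_1,g_2,\dots]],$$ where $\mathrm dU$ is the Haar measure of total volume $1$ and the integral is taken coefficientwise in $\mathbf g$, and let $Z_\infty(\mathbf g)=\prod_{k\ge1}\frac1{1-g_k}$. Let $\mathbf t^\pm=(t_1^\pm,t_2^\pm,\dots)$ be two further families of formal variables and put $\widetilde Z_\infty=\exp\bigl(\sum_{k\ge1}\tfrac1k t_k^+t_k^-\bigr)$. The Hubbard–Stratonovich average $\langle\cdot\rangle_{\mathbf g}:\mathbb C[[\mathbf t^+,\mathbf t^-]]\to\mathbb C[[\mathbf g]]$ is the linear map, extended to infinite sums of monomials, with $$\Bigl\langle\prod_k (t_k^+)^{a_k}(t_k^-)^{b_k}\Bigr\rangle_{\mathbf g}=\prod_k\delta_{a_k,b_k}\,a_k!\,(k g_k)^{a_k}.$$ For $r,s\in\mathbb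 Z+\frac12$ let $\widetilde K(r,s)\in\mathbb C[[\mathbf t^+,\mathbf t^-]]$ be the coefficients in the expansion, in the region $|w|<|z|$, $$\sum_{r,s\in\mathbb Z+\frac12}\widetilde K(r,s)\,z^r w^{-s}=\frac{J(z)}{J(w)}\,\frac{\sqrt{zw}}{z-w},\qquad J(z)=\exp\Bigl(\sum_{k\ge1}\tfrac1k t_k^+z^k-\sum_{k\ge1}\tfrac1k t_k^-z^{-k}\Bigr).$$ For half-integers $r_1,\dots,r_m$ put $$K^{(m)}_{\mathbf g}(r_1,\dots,r_m)=\frac1{Z_\infty(\mathbf g)}\Bigl\langle\widetilde Z_\infty\,\det\bigl(\widetilde K(r_i,r_j)\bigr)_{i,j=1}^m\Bigr\rangle_{\mathbf g}.$$ Then $$\frac{Z_N(\mathbf g)}{Z_\infty(\mathbf g)}=\sum_{m=0}^\infty G_N^{(m)}(\mathbf g),\qquad G_N^{(0)}=1,\qquad G_N^{(m)}(\mathbf g)=(-1)^m\sum_{\substack{N<r_1<\dots<r_m\\ r_i\in\mathbb Z+\frac12}}K^{(m)}_{\mathbf g}(r_1,\dots,r_m)\quad(m\ge1).$$ Both the sum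 over $m$ and, for each $m\ge1$, the sum over $r_1<\dots<r_m$ converge in the power-series sense: the coefficient of any given monomial in $\mathbf g$ is nonzero in only finitely many terms. Moreover, every monomial occurring in $G_N^{(m)}(\mathbf g)$ has degree at least $mN+\frac{m(m+1)}2$. -/

import Mathlib

open MvPowerSeries MeasureTheory

noncomputable section

namespace GiantGraviton

/-! ### Formal sums and exponentials of power series in arbitrarily many variables -/

section Formal

variable {σ ι A : Type*} [CommRing A]

/-- A family of power series is locally finite if every monomial occurs in only finitely many
members. -/
def LocallyFinite (f : ι → MvPowerSeries σ A) : Prop :=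
  ∀ d : σ →₀ ℕ, {i | coeff d (f i) ≠ 0}.Finite

/-- The sum of a (locally finite) family of power series, taken monomial by monomial. -/
def formalSum (f : ι → MvPowerSeries σ A) : MvPowerSeries σ A :=
  fun d => ∑ᶠ i, coeff d (f i)

/-- `exp f = ∑ fʲ / j!` for a power series `f` without constant term. -/
def formalExp [Algebra ℂ A] (f : MvPowerSeries σ A) : MvPowerSeries σ A :=
  (PowerSeries.exp ℂ).subst f

end Formal

/-! ### The unitary matrix integral -/

/-- The group `U(N)`. -/
abbrev U (N : ℕ) : Type := Matrix.unitaryGroup (Fin N) ℂ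

instance instCompactSpaceU (N : ℕ) : CompactSpace (U N) := by
  refine isCompact_iff_compactSpace.mp ?_
  have hK : IsCompact (Set.univ.pi fun _ : Fin N => Set.univ.pi fun _ : Fin N =>
      Metric.closedBall (0 : ℂ) 1) :=
    isCompact_univ_pi fun _ => isCompact_univ_pi fun _ => isCompact_closedBall _ _
  refine IsCompact.of_isClosed_subset hK ?_ ?_
  · have h : (Matrix.unitaryGroup (Fin N) ℂ : Set (Matrix (Fin N) (Fin N) ℂ)) =
        {M | M * star M = 1} := by
      ext M
      exact Matrix.mem_unitaryGroup_iff
    change IsClosed (Matrix.unitaryGroup (Fin N) ℂ : Set (Matrix (Fin N) (Fin N) ℂ))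
    rw [h]
    exact isClosed_eq (by fun_prop) continuous_const
  · intro M hM i _ j _
    rw [mem_closedBall_zero_iff]
    exact entry_norm_bound_of_unitary hM i j

instance instMeasurableSpaceU (N : ℕ) : MeasurableSpace (U N) := borel _

instance instBorelSpaceU (N : ℕ) : BorelSpace (U N) := ⟨rfl⟩

/-- The invariant measure on `U(N)` of total volume `1`. -/
def haarU (N : ℕ) : Measure (U N) := Measure.haarMeasure ⊤

instance instIsProbabilityMeasureHaarU (N : ℕ) : IsProbabilityMeasure (haarU N) :=
  ⟨by simpa [haarU] using Measure.haarMeasure_self (G := U N) (K₀ := ⊤)⟩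

/-- `Tr Uᵏ` for an integer `k`. -/
def tr {N : ℕ} (u : U N) (k : ℤ) : ℂ :=
  Matrix.trace ((u ^ k : U N) : Matrix (Fin N) (Fin N) ℂ)

/-- The integrand `exp (∑ₖ (1/k) gₖ Tr Uᵏ Tr U⁻ᵏ)`, a power series in `g₁, g₂, …`. -/
def integrand {N : ℕ} (u : U N) : MvPowerSeries ℕ+ ℂ :=
  formalExp (formalSum fun k : ℕ+ =>
    C (1 / (k : ℂ) * (tr u (k : ℤ) * tr u (-(k : ℤ)))) * X k)

/-- `Z_N(g)`: the integral of the integrand over `U(N)`, coefficient by coefficient in `g`. -/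
def Z (N : ℕ) : MvPowerSeries ℕ+ ℂ :=
  fun n => ∫ u : U N, coeff n (integrand u) ∂(haarU N)

open scoped MvPowerSeries.WithPiTopology in
/-- `Z_∞(g) = ∏ₖ 1 / (1 - gₖ)`, an infinite product of power series. -/
def Zinf : MvPowerSeries ℕ+ ℂ := ∏' k : ℕ+, (1 - X k)⁻¹

open scoped MvPowerSeries.WithPiTopology in
/-- The product defining `Z_∞` converges; every monomial has coefficient `1` in the limit. -/
theorem hasProd_Zinf :
    HasProd (fun k : ℕ+ => (1 - X k : MvPowerSeries ℕ+ ℂ)⁻¹) Zinf ∧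
      ∀ n : ℕ+ →₀ ℕ, coeff n Zinf = 1 := by
  classical
  let S : MvPowerSeries ℕ+ ℂ := fun _ => 1
  have hS (n : ℕ+ →₀ ℕ) : coeff n S = 1 := rfl
  clear_value S
  suffices h : HasProd (fun k : ℕ+ => (1 - X k : MvPowerSeries ℕ+ ℂ)⁻¹) S by
    have hZ : Zinf = S := h.tprod_eq
    rw [hZ]
    exact ⟨h, hS⟩
  have inv_one_sub (k : ℕ+) : (1 - X k : MvPowerSeries ℕ+ ℂ) * (1 - X k)⁻¹ = 1 :=
    MvPowerSeries.mul_inv_cancel _ (by simp)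
  -- the finite product over `s` is the sum of the monomials in the variables from `s`
  let P : Finset ℕ+ → MvPowerSeries ℕ+ ℂ := fun s n => if n.support ⊆ s then 1 else 0
  have hP (s : Finset ℕ+) (n : ℕ+ →₀ ℕ) :
      coeff n (P s) = if n.support ⊆ s then 1 else 0 := rfl
  clear_value P
  have key (s : Finset ℕ+) : (∏ k ∈ s, (1 - X k : MvPowerSeries ℕ+ ℂ)⁻¹) = P s := by
    induction s using Finset.induction_on with
    | empty =>
      ext n
      rw [Finset.prod_empty, coeff_one, hP]
      simp [Finset.subset_empty]
    | insert k s hk ih =>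
      rw [Finset.prod_insert hk, ih]
      have h : (1 - X k : MvPowerSeries ℕ+ ℂ) * P (insert k s) = P s := by
        ext n
        rw [sub_mul, one_mul, map_sub, X, coeff_monomial_mul, hP, hP, hP]
        have hle : Finsupp.single k 1 ≤ n ↔ k ∈ n.support := by
          rw [Finsupp.single_le_iff, Finsupp.mem_support_iff]; omega
        have hins : (n - Finsupp.single k 1).support ⊆ insert k s ↔ n.support ⊆ insert k s := by
          constructor
          · intro h i hi
            by_cases hik : i = k
            · simp [hik]
            · apply h
              rw [Finsupp.mem_support_iff] at hi ⊢
              simpa [Finsupp.single_apply, Ne.symm hik] using hi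
          · intro h i hi
            apply h
            rw [Finsupp.mem_support_iff] at hi ⊢
            intro h0
            simp [h0] at hi
        simp only [hle, hins, one_mul]
        by_cases hkn : k ∈ n.support
        · have : ¬ n.support ⊆ s := fun h => hk (h hkn)
          simp [hkn, this]
        · simp [hkn, Finset.subset_insert_iff_of_notMem hkn]
      rw [← h, ← mul_assoc, mul_comm (_⁻¹), inv_one_sub, one_mul]
  unfold HasProd
  rw [SummationFilter.unconditional_filter,
    MvPowerSeries.WithPiTopology.tendsto_iff_coeff_tendsto]
  intro d
  refine tendsto_const_nhds.congr' ?_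
  filter_upwards [Filter.eventually_ge_atTop d.support] with s hs
  rw [key, hP, if_pos hs, hS]

/-! ### The auxiliary model and the Hubbard–Stratonovich average -/

/-- The index set of the variables `t⁺₁, t⁺₂, …` (left) and `t⁻₁, t⁻₂, …` (right). -/
abbrev TVar : Type := ℕ+ ⊕ ℕ+

/-- The variable `t⁺ₖ`. -/
def tp {A : Type*} [CommRing A] (k : ℕ+) : MvPowerSeries TVar A := X (Sum.inl k)

/-- The variable `t⁻ₖ`. -/
def tm {A : Type*} [CommRing A] (k : ℕ+) : MvPowerSeries TVar A := X (Sum.inr k)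

/-- `Z̃_∞(t⁺, t⁻) = exp (∑ₖ (1/k) t⁺ₖ t⁻ₖ)`. -/
def ZTildeInf : MvPowerSeries TVar ℂ :=
  formalExp (formalSum fun k : ℕ+ => C (1 / (k : ℂ)) * (tp k * tm k))

/-- The Hubbard–Stratonovich average `⟨f⟩_g`: the linear map, extended to all power series, with
`∏ₖ (t⁺ₖ)^aₖ (t⁻ₖ)^bₖ ↦ ∏ₖ δ_{aₖ,bₖ} aₖ! (k gₖ)^aₖ`. So the coefficient of `g^n` in `⟨f⟩_g` is
`∏ₖ nₖ! k^nₖ` times the coefficient of `∏ₖ (t⁺ₖ)^nₖ (t⁻ₖ)^nₖ` in `f`. -/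
def hsAverage (f : MvPowerSeries TVar ℂ) : MvPowerSeries ℕ+ ℂ :=
  fun n => (n.prod fun k e => (e.factorial : ℂ) * (k : ℂ) ^ e) * coeff (Finsupp.sumElim n n) f

/-! ### The fermionic two-point functions -/

/-- `J(x; t⁺, t⁻) = exp (∑ₖ (1/k) t⁺ₖ xᵏ - ∑ₖ (1/k) t⁻ₖ x⁻ᵏ)` for an invertible `x`, a power
series in `t⁺, t⁻`. -/
def J {A : Type*} [CommRing A] [Algebra ℂ A] (x : Aˣ) : MvPowerSeries TVar A :=
  formalExp
    ((formalSum fun k : ℕ+ => C ((1 / (k : ℂ)) • ((x ^ (k : ℤ) : Aˣ) : A)) * tp k) -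
      formalSum fun k : ℕ+ => C ((1 / (k : ℂ)) • ((x ^ (-(k : ℤ)) : Aˣ) : A)) * tm k)

/-- The ring `ℂ[z, z⁻¹]((w))`, in which functions of `z, w` are expanded in the region
`|w| < |z|`. -/
abbrev ZW : Type := LaurentSeries (LaurentPolynomial ℂ)

/-- The invertible element `z` of `ℂ[z, z⁻¹]((w))`. -/
def zUnit : ZWˣ where
  val := HahnSeries.C (LaurentPolynomial.T 1)
  inv := HahnSeries.C (LaurentPolynomial.T (-1))
  val_inv := by rw [← map_mul, ← LaurentPolynomial.T_add]; simp
  inv_val := by rw [← map_mul, ← LaurentPolynomial.T_add]; simp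

/-- The invertible element `w` of `ℂ[z, z⁻¹]((w))`. -/
def wUnit : ZWˣ where
  val := HahnSeries.single 1 1
  inv := HahnSeries.single (-1) 1
  val_inv := by rw [HahnSeries.single_mul_single]; simp
  inv_val := by rw [HahnSeries.single_mul_single]; simp

/-- The expansion `∑_{j ≥ 0} z^(-j-1) w^j` of `1 / (z - w)` in the region `|w| < |z|`. -/
def invZsubW : ZW :=
  HahnSeries.ofPowerSeries ℤ (LaurentPolynomial ℂ)
    (PowerSeries.mk fun j => LaurentPolynomial.T (-(j : ℤ) - 1))

/-- `invZsubW` is the inverse of `z - w`. -/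
theorem sub_mul_invZsubW : ((zUnit : ZW) - wUnit) * invZsubW = 1 := by
  have hz : (zUnit : ZW) = HahnSeries.ofPowerSeries ℤ (LaurentPolynomial ℂ)
      (PowerSeries.C (LaurentPolynomial.T 1)) := by
    rw [HahnSeries.ofPowerSeries_C]; rfl
  have hw : (wUnit : ZW) = HahnSeries.ofPowerSeries ℤ (LaurentPolynomial ℂ) PowerSeries.X := by
    rw [HahnSeries.ofPowerSeries_X]; rfl
  rw [hz, hw, invZsubW, ← map_sub, ← map_mul, ← map_one (HahnSeries.ofPowerSeries ℤ _)]
  congr 1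
  ext1 n
  rw [sub_mul, map_sub, PowerSeries.coeff_C_mul]
  cases n with
  | zero =>
    rw [PowerSeries.coeff_zero_X_mul, sub_zero, PowerSeries.coeff_mk,
      ← LaurentPolynomial.T_add, PowerSeries.coeff_zero_one, ← LaurentPolynomial.T_zero]
    congr 1
  | succ n =>
    rw [PowerSeries.coeff_succ_X_mul]
    simp only [PowerSeries.coeff_mk, ← LaurentPolynomial.T_add, PowerSeries.coeff_one]
    rw [if_neg (Nat.succ_ne_zero n), sub_eq_zero]
    congr 1
    push_cast
    ring

/-- `κ̃(z, w; t⁺, t⁻) / √(zw) = J(z) / J(w) · 1 / (z - w)`, expanded in the region `|w| < |z|`. -/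
def kappa : MvPowerSeries TVar ZW :=
  J zUnit * Ring.inverse (J wUnit) * C invZsubW

/-- The half-integers `ℤ + 1/2`. -/
abbrev HalfInt : Type := {r : ℚ // ∃ a : ℤ, r = a + 1 / 2}

/-- The two-point function `K̃(r, s; t⁺, t⁻)`, the coefficient of `z^r w^(-s)` in
`κ̃(z, w; t⁺, t⁻)`, that is, of `z^(r - 1/2) w^(-s - 1/2)` in `κ̃(z, w; t⁺, t⁻) / √(zw)`;
for half-integers, `r - 1/2 = ⌊r⌋` and `-s - 1/2 = ⌊-s⌋`. -/
def KTilde (r s : HalfInt) : MvPowerSeries TVar ℂ :=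
  fun d => ((coeff d kappa).coeff ⌊-(s : ℚ)⌋).coeff ⌊(r : ℚ)⌋

/-! ### The terms of the expansion -/

/-- `K^{(m)}_g(r₁, …, r_m) = ⟨Z̃_∞ det (K̃(rᵢ, rⱼ))⟩_g / Z_∞(g)`. -/
def K {m : ℕ} (r : Fin m → HalfInt) : MvPowerSeries ℕ+ ℂ :=
  hsAverage (ZTildeInf * (Matrix.of fun i j => KTilde (r i) (r j)).det) * Zinf⁻¹

/-- The tuples `N < r₁ < … < r_m` of half-integers. -/
abbrev Levels (N m : ℕ) : Type :=
  {r : Fin m → HalfInt // StrictMono r ∧ ∀ i, (N : ℚ) < (r i : ℚ)}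

/-- `G^{(m)}_N(g)`: `1` for `m = 0`, and `(-1)^m ∑_{N < r₁ < … < r_m} K^{(m)}_g(r₁, …, r_m)` for
`m ≥ 1`. -/
def G (N m : ℕ) : MvPowerSeries ℕ+ ℂ :=
  if m = 0 then 1 else (-1) ^ m * formalSum fun r : Levels N m => K r.1

end GiantGraviton

end

noncomputable section

namespace GiantGraviton

/-! ### Formal exponentials and their logarithmic derivatives. -/

section Exponential

variable {σ ι A : Type*} [CommRing A]

/-! Let `D_N` be the Toeplitz determinant with symbol `exp (-∑ₖ (1/k)(t⁺ₖ zᵏ + t⁻ₖ z⁻ᵏ))`. The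
argument has three ingredients.

(1) `Z_N` is the Hubbard–Stratonovich average of `D_N` (`hsAverage_toeplitzDet`). By the Heine–Szegő
identity (`coeff_toeplitzDet`) the coefficients of `D_N` are Weyl integrals over the torus, and
these equal Haar integrals (`haarFun_eq_weylFun`). For this last equality, both functionals kill the
divergence of every field `Uᵏ F(U)` (`haarFun_loopOp`, `weylFun_loopOp`), hence the image of the
Laplacian. The Laplacian preserves finite-dimensional spaces of polynomials in traces. By Fitting's
lemma such a space is the sum of the image and the kernel of a high power, and by positivity an
element of the kernel is a constant function on `U(N)`.

(2) Borodin–Okounkov: `D_N = Z̃_∞ det (1 - K̃)` on the levels above `N`. Factoring the symbol shows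
that the Toeplitz operator, multiplied by unitriangular ones, inverts `1 - K̃` on nonnegative modes
(`toeplitzOp_twistProj`). Jacobi's identity for complementary minors then gives the finite form
`D_{N+n} det (1 - K̃)_{N ≤ a < N+n} ≡ D_N` modulo `t⁺`-degree greater than `N + n`
(`toeplitzDet_sub_mem`). The congruence `D_M ≡ Z̃_∞` modulo `t⁺`-degree greater than `M` is the
strong Szegő theorem (`toeplitzDet_sub_ZTildeInf_mem`): coefficients of `D_M` stabilize in `M`, so
the part of the loop equation proportional to `M` must vanish separately, and it yields the
differential equations satisfied by `Z̃_∞`.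

(3) `det (1 - K̃)` is expanded in principal minors and averaged. The average only sees monomials
whose `t⁺`-degree is the degree in `g`, so at a fixed monomial a finite window of levels suffices.
Row `a` of `K̃` has `t⁺`-degree at least `a + 1` (`kern_mem_plusIdeal`); summing over distinct
levels `a ≥ N` gives the degree bound and all finiteness statements. -/

theorem coeff_formalSum (f : ι → MvPowerSeries σ A) (d : σ →₀ ℕ) :
    coeff d (formalSum f) = ∑ᶠ i, coeff d (f i) := rfl

theorem pderiv_formalSum {f : ι → MvPowerSeries σ A} (hf : LocallyFinite f) (v : σ) :
    pderiv A v (formalSum f) = formalSum fun i => pderiv A v (f i) := by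
  ext d
  simp only [coeff_pderiv, coeff_formalSum]
  exact finsum_mul' _ _ (hf _)

theorem formalSum_eq_single {f : ι → MvPowerSeries σ A} (i : ι) (h : ∀ j, j ≠ i → f j = 0) :
    formalSum f = f i := by
  ext d
  rw [coeff_formalSum, finsum_eq_single _ i]
  intro j hj
  simp [h j hj]

theorem locallyFinite_of_injective {f : ι → MvPowerSeries σ A} {e : ι → σ}
    (he : Function.Injective e) (h : ∀ i d, coeff d (f i) ≠ 0 → d (e i) ≠ 0) :
    LocallyFinite f := fun d =>
  (d.support.finite_toSet.preimage he.injOn).subset fun i hi => by simpa using h i d hi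

theorem coeff_mul_X_ne_zero {f : MvPowerSeries σ A} {v : σ} {d : σ →₀ ℕ}
    (h : coeff d (f * X v) ≠ 0) : d v ≠ 0 := by
  classical
  intro h0
  apply h
  rw [X, coeff_mul_monomial, if_neg]
  rw [Finsupp.single_le_iff]
  omega

theorem coeff_mul_congr {f g h : MvPowerSeries σ A} {d : σ →₀ ℕ}
    (hgh : ∀ e ≤ d, coeff e g = coeff e h) : coeff d (f * g) = coeff d (f * h) := by
  classical
  rw [coeff_mul, coeff_mul]
  refine Finset.sum_congr rfl fun p hp => ?_
  rw [hgh]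
  rw [Finset.HasAntidiagonal.mem_antidiagonal] at hp
  exact hp ▸ le_add_self

theorem constantCoeff_formalSum_mul_X (c : ι → MvPowerSeries σ A) (e : ι → σ) :
    constantCoeff (formalSum fun i => c i * X (e i)) = 0 := by
  rw [← coeff_zero_eq_constantCoeff_apply, coeff_formalSum, finsum_eq_zero_of_forall_eq_zero]
  intro i
  simp

theorem pderiv_formalSum_C_mul_X {e : ι → σ} (he : Function.Injective e) (c : ι → A) (i : ι) :
    pderiv A (e i) (formalSum fun j => C (c j) * X (e j)) = C (c i) := by
  classical
  rw [pderiv_formalSum (locallyFinite_of_injective he fun _ _ h => coeff_mul_X_ne_zero h),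
    formalSum_eq_single i]
  · simp [Derivation.leibniz]
  · intro j hj
    simp [Derivation.leibniz, pderiv_X_of_ne (he.ne hj)]

theorem pderiv_formalSum_C_mul_X_of_notMem {e : ι → σ} (he : Function.Injective e) (c : ι → A)
    (v : σ) (hv : ∀ i, e i ≠ v) :
    pderiv A v (formalSum fun j => C (c j) * X (e j)) = 0 := by
  classical
  rw [pderiv_formalSum (locallyFinite_of_injective he fun _ _ h => coeff_mul_X_ne_zero h)]
  ext d
  rw [coeff_formalSum, finsum_eq_zero_of_forall_eq_zero, map_zero]
  intro j
  simp [Derivation.leibniz, pderiv_X_of_ne (hv j)]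

variable [Algebra ℂ A]

theorem coeff_formalExp {f : MvPowerSeries σ A} (hf : constantCoeff f = 0) (d : σ →₀ ℕ) (n : ℕ)
    (hn : d.degree < n) :
    coeff d (formalExp f) = coeff d (∑ j ∈ Finset.range n, ((j.factorial : ℂ)⁻¹) • f ^ j) := by
  rw [formalExp, PowerSeries.coeff_subst (PowerSeries.HasSubst.of_constantCoeff_zero hf),
    finsum_eq_finsetSum_of_support_subset (s := Finset.range n), map_sum]
  · refine Finset.sum_congr rfl fun j _ => ?_
    simp [PowerSeries.coeff_exp, Algebra.smul_def, MvPowerSeries.algebraMap_apply]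
  · intro j hj
    by_contra hjn
    apply hj
    have : coeff d (f ^ j) = 0 :=
      coeff_eq_zero_of_constantCoeff_nilpotent (m := 1) (by simp [hf]) (by
        simp at hjn; omega)
    simp [this]

theorem constantCoeff_formalExp {f : MvPowerSeries σ A} (hf : constantCoeff f = 0) :
    constantCoeff (formalExp f) = 1 := by
  rw [← coeff_zero_eq_constantCoeff_apply, coeff_formalExp hf 0 1 (by simp)]
  simp

/-- Up to a fixed degree the exponential agrees with a partial sum, where the Leibniz rule applies.
Differentiation lowers the degree by one, so the left side is truncated one term later. -/
theorem pderiv_formalExp {f : MvPowerSeries σ A} (hf : constantCoeff f = 0) (v : σ) :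
    pderiv A v (formalExp f) = pderiv A v f * formalExp f := by
  classical
  ext d
  have hdeg (e : σ →₀ ℕ) (he : e ≤ d) : e.degree < d.degree + 1 :=
    Nat.lt_succ_of_le (Finsupp.degree_mono he)
  rw [coeff_mul_congr fun e he => coeff_formalExp hf e _ (hdeg e he), coeff_pderiv,
    coeff_formalExp hf _ (d.degree + 1 + 1) (by simp), ← coeff_pderiv]
  congr 1
  rw [Finset.sum_range_succ']
  simp only [Nat.factorial_zero, Nat.cast_one, inv_one, pow_zero, one_smul, map_add, map_sum,
    Derivation.map_one_eq_zero, add_zero, Finset.mul_sum]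
  refine Finset.sum_congr rfl fun j _ => ?_
  have h1 (c : ℂ) (g : MvPowerSeries σ A) : pderiv A v (c • g) = c • pderiv A v g := by
    rw [← algebraMap_smul A c g, Derivation.map_smul, algebraMap_smul]
  rw [h1, pderiv_pow, Nat.add_sub_cancel, mul_smul_comm]
  have h2 : (((j + 1 : ℕ) : MvPowerSeries σ A) * f ^ j * pderiv A v f) =
      ((j + 1 : ℕ) : ℂ) • (pderiv A v f * f ^ j) := by
    rw [Algebra.smul_def, map_natCast]; ring
  rw [h2, smul_smul]
  congr 1
  rw [Nat.factorial_succ]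
  push_cast
  have : (j : ℂ) + 1 ≠ 0 := Nat.cast_add_one_ne_zero j
  field_simp

/-- The exponential `∑ ∏ᵥ (cᵥ Xᵥ)^dᵥ / dᵥ!` of the linear form `∑ᵥ cᵥ Xᵥ`. -/
def linExp (c : σ → A) : MvPowerSeries σ A :=
  fun d => d.prod fun v e => ((e.factorial : ℂ)⁻¹) • c v ^ e

theorem coeff_linExp (c : σ → A) (d : σ →₀ ℕ) :
    coeff d (linExp c) = d.prod fun v e => ((e.factorial : ℂ)⁻¹) • c v ^ e := rfl

theorem constantCoeff_linExp (c : σ → A) : constantCoeff (linExp c) = 1 := by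
  rw [← coeff_zero_eq_constantCoeff_apply, coeff_linExp, Finsupp.prod_zero_index]

theorem pderiv_linExp (c : σ → A) (v : σ) :
    pderiv A v (linExp c) = C (c v) * linExp c := by
  classical
  ext d
  rw [coeff_pderiv, coeff_C_mul, coeff_linExp, coeff_linExp,
    ← Finsupp.mul_prod_erase' (d + Finsupp.single v 1) v _ (by simp),
    ← Finsupp.mul_prod_erase' d v _ (by simp)]
  have h : (d + Finsupp.single v 1).erase v = d.erase v := by
    rw [Finsupp.erase_add, Finsupp.erase_single, add_zero]
  rw [h]
  simp only [Finsupp.add_apply, Finsupp.single_eq_same]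
  have h2 : ((d v + 1 : ℕ) : A) * (((d v + 1).factorial : ℂ)⁻¹ • c v ^ (d v + 1)) =
      c v * (((d v).factorial : ℂ)⁻¹ • c v ^ d v) := by
    rw [← map_natCast (algebraMap ℂ A), ← Algebra.smul_def, smul_smul, mul_smul_comm, pow_succ']
    congr 1
    rw [Nat.factorial_succ]
    push_cast
    have : (d v : ℂ) + 1 ≠ 0 := Nat.cast_add_one_ne_zero _
    field_simp
  push_cast at h2
  linear_combination ((d.erase v).prod fun v e => ((e.factorial : ℂ)⁻¹) • c v ^ e) * h2

theorem isAddTorsionFree_of_algebra (A : Type*) [CommRing A] [Algebra ℂ A] :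
    IsAddTorsionFree A := by
  refine ⟨fun n hn a b hab => ?_⟩
  have h : (n : ℂ) • a = (n : ℂ) • b := by
    simpa [Algebra.smul_def, nsmul_eq_mul] using hab
  have hn' : (n : ℂ) ≠ 0 := Nat.cast_ne_zero.2 hn
  simpa [smul_smul, hn'] using congrArg ((n : ℂ)⁻¹ • ·) h

/-- A power series is determined by its constant term and its logarithmic derivatives. -/
theorem eq_of_pderiv_eq_mul {F G : MvPowerSeries σ A} (h : σ → MvPowerSeries σ A)
    (hF : ∀ v, pderiv A v F = h v * F) (hG : ∀ v, pderiv A v G = h v * G)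
    (h0 : constantCoeff F = constantCoeff G) : F = G := by
  classical
  have := isAddTorsionFree_of_algebra A
  suffices H : ∀ n : ℕ, ∀ d : σ →₀ ℕ, d.degree ≤ n → coeff d F = coeff d G by
    ext d; exact H _ d le_rfl
  intro n
  induction n with
  | zero =>
    intro d hd
    have : d = 0 := (Finsupp.degree_eq_zero_iff d).1 (Nat.le_zero.1 hd)
    subst this
    simpa using h0
  | succ n ih =>
    intro d hd
    by_cases hd0 : d = 0
    · subst hd0; simpa using h0
    obtain ⟨v, hv⟩ := Finsupp.ne_iff.1 hd0
    have hle : Finsupp.single v 1 ≤ d := by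
      rw [Finsupp.single_le_iff]; exact Nat.one_le_iff_ne_zero.2 hv
    obtain ⟨e, rfl⟩ := exists_add_of_le hle
    rw [add_comm (Finsupp.single v 1) e] at *
    have he : e.degree ≤ n := by simpa using hd
    -- The coefficient at `e + single v 1`, times `e v + 1`, is a coefficient of `h v * F` at `e`,
    -- which involves `F` only in degrees at most `n`.
    have key : coeff e (pderiv A v F) = coeff e (pderiv A v G) := by
      rw [hF, hG]
      exact coeff_mul_congr fun b hb => ih b ((Finsupp.degree_mono hb).trans he)
    rw [coeff_pderiv, coeff_pderiv] at key
    have key' : (e v + 1) • coeff (e + Finsupp.single v 1) F =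
        (e v + 1) • coeff (e + Finsupp.single v 1) G := by
      simpa [nsmul_eq_mul, mul_comm] using key
    exact IsAddTorsionFree.nsmul_right_injective (by omega) key'

theorem linExp_add (c c' : σ → A) : linExp (c + c') = linExp c * linExp c' := by
  refine eq_of_pderiv_eq_mul (fun v => C (c v + c' v)) (fun v => pderiv_linExp _ v)
    (fun v => ?_) ?_
  · rw [Derivation.leibniz, pderiv_linExp, pderiv_linExp]
    simp only [smul_eq_mul, map_add]
    ring
  · simp [constantCoeff_linExp]

theorem linExp_zero : linExp (0 : σ → A) = 1 := by
  refine eq_of_pderiv_eq_mul (fun v => 0) (fun v => ?_) (fun v => ?_) ?_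
  · simp [pderiv_linExp]
  · simp
  · simp [constantCoeff_linExp]

theorem formalExp_eq_linExp {f : MvPowerSeries σ A} {c : σ → A} (h0 : constantCoeff f = 0)
    (h : ∀ v, pderiv A v f = C (c v)) : formalExp f = linExp c :=
  eq_of_pderiv_eq_mul (fun v => C (c v)) (fun v => by rw [pderiv_formalExp h0, h])
    (fun v => pderiv_linExp c v) (by rw [constantCoeff_formalExp h0, constantCoeff_linExp])

theorem ringInverse_linExp (c : σ → A) : Ring.inverse (linExp c) = linExp (-c) := by
  have h : linExp c * linExp (-c) = 1 := by rw [← linExp_add, add_neg_cancel, linExp_zero]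
  have h' : linExp (-c) * linExp c = 1 := by rw [mul_comm, h]
  exact Ring.inverse_unit (⟨linExp c, linExp (-c), h, h'⟩ : (MvPowerSeries σ A)ˣ)

end Exponential

/-! ### Closed forms of the integrand, of `J` and of `Z̃_∞`. -/

section Models

theorem integrand_eq {N : ℕ} (u : U N) :
    integrand u = linExp fun k : ℕ+ => 1 / (k : ℂ) * (tr u (k : ℤ) * tr u (-(k : ℤ))) :=
  formalExp_eq_linExp (constantCoeff_formalSum_mul_X _ _) fun v =>
    pderiv_formalSum_C_mul_X (e := fun k : ℕ+ => k) Function.injective_id _ v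

/-- The coefficients of the linear form in the exponent of `J`. -/
def jCoeff {A : Type*} [CommRing A] [Algebra ℂ A] (x : Aˣ) : TVar → A :=
  Sum.elim (fun k => (1 / (k : ℂ)) • ((x ^ (k : ℤ) : Aˣ) : A))
    (fun k => -((1 / (k : ℂ)) • ((x ^ (-(k : ℤ)) : Aˣ) : A)))

theorem J_eq {A : Type*} [CommRing A] [Algebra ℂ A] (x : Aˣ) : J x = linExp (jCoeff x) := by
  refine formalExp_eq_linExp ?_ fun v => ?_
  · rw [map_sub]
    unfold tp tm
    rw [constantCoeff_formalSum_mul_X, constantCoeff_formalSum_mul_X, sub_zero]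
  · rw [map_sub]
    unfold tp tm
    cases v with
    | inl k =>
      rw [pderiv_formalSum_C_mul_X Sum.inl_injective,
        pderiv_formalSum_C_mul_X_of_notMem Sum.inr_injective _ _ (by simp), sub_zero]
      rfl
    | inr k =>
      rw [pderiv_formalSum_C_mul_X Sum.inr_injective,
        pderiv_formalSum_C_mul_X_of_notMem Sum.inl_injective _ _ (by simp), zero_sub, ← map_neg]
      rfl

/-- The coefficient of `Z̃_∞` at `∏ (t⁺ₖ)^(aₖ) (t⁻ₖ)^(bₖ)`. -/
theorem coeff_ZTildeInf (d : TVar →₀ ℕ) :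
    coeff d ZTildeInf = open Classical in if ∀ k, d (Sum.inl k) = d (Sum.inr k) then
      (d.comapDomain Sum.inl Sum.inl_injective.injOn).prod
        fun k e => ((e.factorial : ℂ)⁻¹) • (1 / (k : ℂ)) ^ e else 0 := by
  classical
  let F : MvPowerSeries TVar ℂ := fun d => if ∀ k, d (Sum.inl k) = d (Sum.inr k) then
      coeff (d.comapDomain Sum.inl Sum.inl_injective.injOn)
        (linExp fun k : ℕ+ => 1 / (k : ℂ)) else 0
  have hF (d : TVar →₀ ℕ) : coeff d F = if ∀ k, d (Sum.inl k) = d (Sum.inr k) then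
      coeff (d.comapDomain Sum.inl Sum.inl_injective.injOn)
        (linExp fun k : ℕ+ => 1 / (k : ℂ)) else 0 := rfl
  clear_value F
  have hlin (e : ℕ+ →₀ ℕ) (k : ℕ+) :
      coeff (e + Finsupp.single k 1) (linExp fun k : ℕ+ => 1 / (k : ℂ)) * (e k + 1) =
        1 / (k : ℂ) * coeff e (linExp fun k : ℕ+ => 1 / (k : ℂ)) := by
    rw [← coeff_pderiv, pderiv_linExp, coeff_C_mul]
  suffices h : ZTildeInf = F by rw [h, hF]; rfl
  have hLF : LocallyFinite fun k : ℕ+ =>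
      (C (1 / (k : ℂ)) * (tp k * tm k) : MvPowerSeries TVar ℂ) := by
    refine locallyFinite_of_injective Sum.inr_injective fun k d h => ?_
    rw [← mul_assoc] at h
    exact coeff_mul_X_ne_zero h
  refine eq_of_pderiv_eq_mul
    (Sum.elim (fun k => C (1 / (k : ℂ)) * tm k) (fun k => C (1 / (k : ℂ)) * tp k)) ?_ ?_ ?_
  · have h0 : constantCoeff (formalSum fun k : ℕ+ =>
        (C (1 / (k : ℂ)) * (tp k * tm k) : MvPowerSeries TVar ℂ)) = 0 := by
      simp only [← mul_assoc]
      exact constantCoeff_formalSum_mul_X _ _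
    intro v
    rw [ZTildeInf, pderiv_formalExp h0, pderiv_formalSum hLF]
    congr 1
    cases v with
    | inl k =>
      rw [formalSum_eq_single k]
      · simp [Derivation.leibniz, tp, tm, pderiv_X_of_ne]
      · intro j hj
        have : (Sum.inl j : TVar) ≠ Sum.inl k := by simpa using hj
        simp [Derivation.leibniz, tp, tm, pderiv_X_of_ne, this]
    | inr k =>
      rw [formalSum_eq_single k]
      · simp [Derivation.leibniz, tp, tm, pderiv_X_of_ne]
      · intro j hj
        have : (Sum.inr j : TVar) ≠ Sum.inr k := by simpa using hj
        simp [Derivation.leibniz, tp, tm, pderiv_X_of_ne, this]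
  -- The candidate `F` is symmetric under exchange of `t⁺` and `t⁻`, so both families of derivatives
  -- are computed at once.
  · have main (a b : ℕ+ → TVar) (hab : (a = Sum.inl ∧ b = Sum.inr) ∨ (a = Sum.inr ∧ b = Sum.inl))
        (k : ℕ+) : pderiv ℂ (a k) F = C (1 / (k : ℂ)) * X (b k) * F := by
      ext d
      have hba : b k ≠ a k := by rcases hab with ⟨rfl, rfl⟩ | ⟨rfl, rfl⟩ <;> simp
      rw [coeff_pderiv, mul_assoc, coeff_C_mul, X, coeff_monomial_mul, hF, one_mul]
      by_cases hd : d (b k) = 0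
      · rw [if_neg, if_neg]
        · simp
        · rw [Finsupp.single_le_iff]; omega
        · intro h
          have := h k
          rcases hab with ⟨rfl, rfl⟩ | ⟨rfl, rfl⟩ <;> simp at this <;> omega
      · have hle : Finsupp.single (b k) 1 ≤ d := by
          rw [Finsupp.single_le_iff]; omega
        rw [if_pos hle, hF]
        obtain ⟨d', rfl⟩ := exists_add_of_le hle
        rw [add_tsub_cancel_left]
        have hiff : (∀ j, (Finsupp.single (b k) 1 + d' + Finsupp.single (a k) 1 : TVar →₀ ℕ)
              (Sum.inl j) =
            (Finsupp.single (b k) 1 + d' + Finsupp.single (a k) 1 : TVar →₀ ℕ) (Sum.inr j)) ↔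
            ∀ j, d' (Sum.inl j) = d' (Sum.inr j) := by
          refine forall_congr' fun j => ?_
          rcases hab with ⟨rfl, rfl⟩ | ⟨rfl, rfl⟩ <;> by_cases hjk : k = j <;>
            simp [hjk] <;> omega
        simp only [hiff]
        split_ifs with hd'
        · have hcomap : (Finsupp.single (b k) 1 + d' + Finsupp.single (a k) 1).comapDomain Sum.inl
              Sum.inl_injective.injOn =
              d'.comapDomain Sum.inl Sum.inl_injective.injOn + Finsupp.single k 1 := by
            ext j
            rcases hab with ⟨rfl, rfl⟩ | ⟨rfl, rfl⟩ <;> by_cases hjk : k = j <;>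
              simp [hjk, add_comm]
          rw [hcomap, ← hlin]
          congr 1
          simp only [Finsupp.add_apply, Finsupp.comapDomain_apply, Finsupp.single_apply,
            if_neg hba]
          rcases hab with ⟨rfl, rfl⟩ | ⟨rfl, rfl⟩ <;> simp [hd' k]
        · simp
    rintro (k | k)
    · exact main Sum.inl Sum.inr (Or.inl ⟨rfl, rfl⟩) k
    · exact main Sum.inr Sum.inl (Or.inr ⟨rfl, rfl⟩) k
  · rw [ZTildeInf, constantCoeff_formalExp, ← coeff_zero_eq_constantCoeff_apply, hF]
    · have : (0 : TVar →₀ ℕ).comapDomain Sum.inl Sum.inl_injective.injOn = 0 := by ext; simp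
      simp [this, constantCoeff_linExp]
    · simp only [← mul_assoc]
      exact constantCoeff_formalSum_mul_X _ _

end Models

/-! ### Signed sums over integer intervals, covering negative powers of `U`. -/

section SignedSum

variable {M : Type*} [AddCommGroup M]

/-- The sum `f 0 + ⋯ + f (k - 1)`, read as `-(f k + ⋯ + f (-1))` for negative `k`. -/
def ssum (f : ℤ → M) (k : ℤ) : M :=
  ∑ j ∈ Finset.Ico 0 k, f j - ∑ j ∈ Finset.Ico k 0, f j

@[simp]
theorem ssum_zero (f : ℤ → M) : ssum f 0 = 0 := by simp [ssum]

/-- The sign convention is chosen so that this recursion holds for every integer `k`; together with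
the value at `0` it characterizes `ssum`. -/
theorem ssum_add_one (f : ℤ → M) (k : ℤ) : ssum f (k + 1) = ssum f k + f k := by
  unfold ssum
  rcases le_or_gt 0 k with hk | hk
  · have h1 : Finset.Ico (k + 1) 0 = ∅ := Finset.Ico_eq_empty (by omega)
    have h2 : Finset.Ico k 0 = ∅ := Finset.Ico_eq_empty (by omega)
    have h3 : Finset.Ico 0 (k + 1) = insert k (Finset.Ico 0 k) := by
      ext j; simp only [Finset.mem_Ico, Finset.mem_insert]; omega
    rw [h1, h2, h3, Finset.sum_insert (by simp)]
    simp [add_comm]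
  · have h1 : Finset.Ico 0 (k + 1) = ∅ := Finset.Ico_eq_empty (by omega)
    have h2 : Finset.Ico 0 k = ∅ := Finset.Ico_eq_empty (by omega)
    have h3 : Finset.Ico k 0 = insert k (Finset.Ico (k + 1) 0) := by
      ext j; simp only [Finset.mem_Ico, Finset.mem_insert]; omega
    rw [h1, h2, h3, Finset.sum_insert (by simp)]
    simp

/-- Injectivity of the step maps allows the recursion to be run backwards to negative integers. -/
theorem int_eq_of_add_one {α : Type*} {F G : ℤ → α} (s : ℤ → α → α) (hs : ∀ k, (s k).Injective)
    (hF : ∀ k, F (k + 1) = s k (F k)) (hG : ∀ k, G (k + 1) = s k (G k)) (h0 : F 0 = G 0) (k : ℤ) :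
    F k = G k := by
  induction k using Int.induction_on with
  | zero => exact h0
  | succ n ih => rw [hF, hG, ih]
  | pred n ih =>
    apply hs (-n - 1)
    rw [← hF, ← hG]
    simpa using ih

theorem eq_ssum {F f : ℤ → M} (h0 : F 0 = 0) (h : ∀ k, F (k + 1) = F k + f k) (k : ℤ) :
    F k = ssum f k :=
  int_eq_of_add_one (fun k a => a + f k) (fun k => add_left_injective (f k)) h (ssum_add_one f)
    (by simp [h0]) k

theorem ssum_sub (g : ℤ → M) (k : ℤ) : ssum (fun j => g (j + 1) - g j) k = g k - g 0 :=
  (eq_ssum (F := fun k => g k - g 0) (by simp) (fun k => by abel) k).symm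

theorem map_ssum {M' F : Type*} [AddCommGroup M'] [FunLike F M M'] [AddMonoidHomClass F M M']
    (φ : F) (f : ℤ → M) (k : ℤ) : φ (ssum f k) = ssum (fun j => φ (f j)) k := by
  simp [ssum]

theorem ssum_sum {ι : Type*} (s : Finset ι) (f : ι → ℤ → M) (k : ℤ) :
    ssum (fun j => ∑ i ∈ s, f i j) k = ∑ i ∈ s, ssum (f i) k := by
  simp only [ssum, Finset.sum_sub_distrib]
  rw [Finset.sum_comm, Finset.sum_comm (s := Finset.Ico k 0)]

theorem ssum_const (a : M) (k : ℤ) : ssum (fun _ => a) k = k • a :=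
  (eq_ssum (F := fun k => k • a) (by simp) (fun k => by rw [add_smul, one_smul]) k).symm

theorem ssum_mul {R : Type*} [Ring R] (f : ℤ → R) (a : R) (k : ℤ) :
    ssum f k * a = ssum (fun j => f j * a) k := by
  simp only [ssum, sub_mul, Finset.sum_mul]

end SignedSum

/-! ### Loop operators on polynomials in power sums -/

/-- Polynomials in formal power sums `p_k`, `k ∈ ℤ`. -/
abbrev PowerSumRing : Type := MvPolynomial ℤ ℂ

open MvPolynomial in
/-- The power sum `p_k` in `N` variables, with `p_0 = N`. -/
def pvar (N : ℕ) (k : ℤ) : PowerSumRing :=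
  if k = 0 then MvPolynomial.C (N : ℂ) else MvPolynomial.X k

/-- The derivation `p_l ↦ l p_{k+l}`. -/
def shiftDer (N : ℕ) (k : ℤ) : Derivation ℂ PowerSumRing PowerSumRing :=
  MvPolynomial.mkDerivation ℂ fun l => MvPolynomial.C (l : ℂ) * pvar N (k + l)

/-- The divergence of the vector field `U ↦ Uᵏ F(U)` on the unitary group, for a polynomial `F` in
the traces of powers of `U`. -/
def loopOp (N : ℕ) (k : ℤ) : PowerSumRing →ₗ[ℂ] PowerSumRing :=
  (shiftDer N k : PowerSumRing →ₗ[ℂ] PowerSumRing) +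
    LinearMap.mulLeft ℂ (ssum (fun j => pvar N j * pvar N (k - j)) k)

theorem loopOp_apply (N : ℕ) (k : ℤ) (F : PowerSumRing) :
    loopOp N k F = shiftDer N k F + ssum (fun j => pvar N j * pvar N (k - j)) k * F := rfl

/-- The product rule for a divergence, which is the source of integration by parts. -/
theorem loopOp_mul (N : ℕ) (k : ℤ) (F G : PowerSumRing) :
    loopOp N k (F * G) = F * loopOp N k G + shiftDer N k F * G := by
  simp only [loopOp_apply, Derivation.leibniz, smul_eq_mul]
  ring

/-! ### Laurent polynomials on the torus -/

/-- Laurent polynomials in `N` variables. -/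
abbrev TorusRing (N : ℕ) : Type := AddMonoidAlgebra ℂ (Fin N → ℤ)

section Torus

variable {N : ℕ}

/-- The monomial `xᵢᵏ`. -/
def xpow (i : Fin N) (k : ℤ) : TorusRing N := AddMonoidAlgebra.single (Pi.single i k) 1

theorem xpow_mul (i : Fin N) (k l : ℤ) : xpow i k * xpow i l = xpow i (k + l) := by
  simp [xpow, AddMonoidAlgebra.single_mul_single, Pi.single_add]

@[simp]
theorem xpow_zero (i : Fin N) : xpow i 0 = 1 := by
  simp [xpow, AddMonoidAlgebra.one_def]

theorem xpow_pow (i : Fin N) (k : ℤ) (n : ℕ) : xpow i k ^ n = xpow i (k * n) := by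
  induction n with
  | zero => simp
  | succ n ih => rw [pow_succ, ih, xpow_mul]; push_cast; ring_nf

/-- The power sum `∑ᵢ xᵢᵏ`. -/
def psum (N : ℕ) (k : ℤ) : TorusRing N := ∑ i, xpow i k

/-- Restriction of polynomials in power sums to the torus. -/
def toTorus (N : ℕ) : PowerSumRing →ₐ[ℂ] TorusRing N := MvPolynomial.aeval (psum N)

theorem toTorus_pvar (k : ℤ) : toTorus N (pvar N k) = psum N k := by
  unfold pvar
  split_ifs with h
  · subst h
    simp [toTorus, psum]
  · simp [toTorus]

/-- The constant term of a Laurent polynomial. -/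
def constTerm (N : ℕ) : TorusRing N →ₗ[ℂ] ℂ :=
  Finsupp.lapply 0 ∘ₗ (AddMonoidAlgebra.coeffLinearEquiv ℂ).toLinearMap

theorem constTerm_apply (f : TorusRing N) : constTerm N f = f.coeff 0 := rfl

theorem constTerm_single (m : Fin N → ℤ) (c : ℂ) :
    constTerm N (AddMonoidAlgebra.single m c) = if m = 0 then c else 0 := by
  rw [constTerm_apply, AddMonoidAlgebra.coeff_single, Finsupp.single_apply]

/-- The linear map `x^m ↦ mᵢ x^m`. -/
def eulerLin (i : Fin N) : TorusRing N →ₗ[ℂ] TorusRing N :=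
  (AddMonoidAlgebra.coeffLinearEquiv ℂ).symm.toLinearMap ∘ₗ
    Finsupp.lsum ℂ (fun m : Fin N → ℤ => (m i : ℂ) • Finsupp.lsingle m) ∘ₗ
    (AddMonoidAlgebra.coeffLinearEquiv ℂ).toLinearMap

theorem eulerLin_single (i : Fin N) (m : Fin N → ℤ) (c : ℂ) :
    eulerLin i (AddMonoidAlgebra.single m c) = AddMonoidAlgebra.single m ((m i : ℂ) * c) := by
  apply AddMonoidAlgebra.coeff_injective
  simp [eulerLin, AddMonoidAlgebra.coeffLinearEquiv, AddMonoidAlgebra.coeff_single]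

theorem coeff_eulerLin (i : Fin N) (f : TorusRing N) (m : Fin N → ℤ) :
    (eulerLin i f).coeff m = m i * f.coeff m := by
  classical
  induction f using AddMonoidAlgebra.induction_linear with
  | zero => simp
  | add f g hf hg => simp [hf, hg, mul_add]
  | single a c =>
    rw [eulerLin_single, AddMonoidAlgebra.coeff_single, AddMonoidAlgebra.coeff_single,
      Finsupp.single_apply, Finsupp.single_apply]
    split_ifs with h <;> simp [h]

/-- The derivation `xᵢ ∂/∂xᵢ`. -/
def euler (i : Fin N) : Derivation ℂ (TorusRing N) (TorusRing N) :=
  Derivation.mk' (eulerLin i) fun f g => by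
    induction f using AddMonoidAlgebra.induction_linear with
    | zero => simp
    | add f f' hf hf' =>
      simp only [add_mul, map_add, hf, hf', smul_eq_mul]
      ring
    | single a c =>
      induction g using AddMonoidAlgebra.induction_linear with
      | zero => simp
      | add g g' hg hg' =>
        simp only [mul_add, map_add, hg, hg', smul_eq_mul]
        ring
      | single b d =>
        simp only [AddMonoidAlgebra.single_mul_single, eulerLin_single, smul_eq_mul,
          Pi.add_apply]
        rw [add_comm b a, ← AddMonoidAlgebra.single_add]
        congr 1
        push_cast
        ring

theorem euler_apply (i : Fin N) (f : TorusRing N) : euler i f = eulerLin i f := rfl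

theorem euler_xpow_self (i : Fin N) (k : ℤ) : euler i (xpow i k) = (k : ℂ) • xpow i k := by
  rw [euler_apply, xpow, eulerLin_single, AddMonoidAlgebra.smul_single]
  simp

theorem euler_xpow_of_ne {i j : Fin N} (h : i ≠ j) (k : ℤ) : euler i (xpow j k) = 0 := by
  rw [euler_apply, xpow, eulerLin_single, Pi.single_eq_of_ne h]
  simp

theorem constTerm_euler (i : Fin N) (f : TorusRing N) : constTerm N (euler i f) = 0 := by
  rw [constTerm_apply, euler_apply, coeff_eulerLin]
  simp

/-- The vector field `∑ᵢ xᵢᵏ (xᵢ ∂/∂xᵢ)`. -/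
def torusField (N : ℕ) (k : ℤ) : Derivation ℂ (TorusRing N) (TorusRing N) :=
  ∑ i, xpow i k • euler i

theorem torusField_apply (k : ℤ) (f : TorusRing N) :
    torusField N k f = ∑ i, xpow i k * euler i f := by
  rw [torusField, ← Derivation.coeFnAddMonoidHom_apply, map_sum, Finset.sum_apply]
  rfl

theorem torusField_xpow (k l : ℤ) (i : Fin N) :
    torusField N k (xpow i l) = (l : ℂ) • xpow i (k + l) := by
  rw [torusField_apply, Finset.sum_eq_single i]
  · rw [euler_xpow_self, mul_smul_comm, xpow_mul]
  · intro j _ hj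
    rw [euler_xpow_of_ne hj, mul_zero]
  · simp

theorem toTorus_shiftDer (k : ℤ) (F : PowerSumRing) :
    toTorus N (shiftDer N k F) = torusField N k (toTorus N F) := by
  induction F using MvPolynomial.induction_on with
  | C a =>
    rw [← MvPolynomial.algebraMap_eq, Derivation.map_algebraMap, AlgHom.commutes,
      Derivation.map_algebraMap, map_zero]
  | add p q hp hq => simp only [map_add, hp, hq]
  | mul_X p l hp =>
    rw [Derivation.leibniz, map_mul, Derivation.leibniz, map_add, smul_eq_mul, smul_eq_mul,
      smul_eq_mul, smul_eq_mul, map_mul, map_mul, hp]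
    congr 2
    rw [shiftDer, MvPolynomial.mkDerivation_X, map_mul, toTorus_pvar, ← MvPolynomial.algebraMap_eq,
      AlgHom.commutes]
    simp only [toTorus, MvPolynomial.aeval_X, psum, map_sum, torusField_xpow]
    rw [← Finset.smul_sum, Algebra.smul_def]

/-- The squared modulus of the Vandermonde determinant. -/
def weylDensity (N : ℕ) : TorusRing N :=
  ∏ i, ∏ j ∈ {i}ᶜ, (1 - xpow i 1 * xpow j (-1))

theorem derivation_prod {A : Type*} [CommRing A] [Algebra ℂ A] (D : Derivation ℂ A A) {ι : Type*}
    (s : Finset ι) (f g : ι → A) (h : ∀ i ∈ s, D (f i) = g i * f i) :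
    D (∏ i ∈ s, f i) = (∑ i ∈ s, g i) * ∏ i ∈ s, f i := by
  classical
  induction s using Finset.induction_on with
  | empty => simp
  | insert a s ha ih =>
    rw [Finset.prod_insert ha, Finset.sum_insert ha, Derivation.leibniz,
      ih fun i hi => h i (Finset.mem_insert_of_mem hi), h a (Finset.mem_insert_self a s)]
    simp only [smul_eq_mul]
    ring

/-- The derivative is `-(xᵢᵏ - xⱼᵏ) xᵢ/xⱼ`, and dividing by `1 - xᵢ/xⱼ` leaves a geometric sum of
`|k|` terms. -/
theorem torusField_one_sub (k : ℤ) {i j : Fin N} :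
    torusField N k (1 - xpow i 1 * xpow j (-1)) =
      ssum (fun m => xpow j m * xpow i (k - m)) k * (1 - xpow i 1 * xpow j (-1)) := by
  rw [ssum_mul]
  -- Multiplied by `1 - xᵢ/xⱼ`, the geometric sum telescopes.
  have h : (fun m => xpow j m * xpow i (k - m) * (1 - xpow i 1 * xpow j (-1))) =
      fun m => (fun m => xpow j (m - 1) * xpow i (k - m + 1)) (m + 1) -
        (fun m => xpow j (m - 1) * xpow i (k - m + 1)) m := by
    funext m
    simp only [add_sub_cancel_right]
    rw [show k - (m + 1) + 1 = k - m by ring, show m - 1 = m + -1 by ring, ← xpow_mul j,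
      ← xpow_mul i (k - m)]
    ring
  rw [h, ssum_sub fun m => xpow j (m - 1) * xpow i (k - m + 1), map_sub,
    Derivation.map_one_eq_zero, Derivation.leibniz, torusField_xpow,
    torusField_xpow]
  simp only [smul_eq_mul, sub_self, zero_add, zero_sub, sub_zero, Int.cast_one, Int.cast_neg,
    one_smul, neg_smul]
  rw [show k - 1 = k + -1 by ring]
  ring

theorem torusField_weylDensity (k : ℤ) :
    torusField N k (weylDensity N) =
      (∑ i, ∑ j ∈ {i}ᶜ, ssum (fun m => xpow j m * xpow i (k - m)) k) * weylDensity N :=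
  derivation_prod _ _ _ _ fun _ _ => derivation_prod _ _ _ _ fun _ _ => torusField_one_sub k

/-- The terms with `i ≠ j` form the logarithmic derivative of the Weyl density; the diagonal terms
add up to the divergence `k p_k` of the field `∑ᵢ xᵢᵏ (xᵢ ∂/∂xᵢ)`. -/
theorem ssum_psum (k : ℤ) :
    ssum (fun j => psum N j * psum N (k - j)) k =
      (∑ i, ∑ j ∈ {i}ᶜ, ssum (fun m => xpow j m * xpow i (k - m)) k) + (k : ℂ) • psum N k := by
  have h (m : ℤ) : psum N m * psum N (k - m) = ∑ i, ∑ j, xpow j m * xpow i (k - m) := by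
    rw [psum, psum, Finset.sum_mul_sum, Finset.sum_comm]
  simp only [h, ssum_sum]
  rw [psum, Finset.smul_sum, ← Finset.sum_add_distrib]
  refine Finset.sum_congr rfl fun i _ => ?_
  rw [← Finset.sum_compl_add_sum {i}, Finset.sum_singleton]
  congr 1
  simp only [xpow_mul, add_sub_cancel]
  rw [ssum_const, Int.cast_smul_eq_zsmul]

/-- The expression is the total derivative `∑ᵢ xᵢ ∂/∂xᵢ (xᵢᵏ f)`, and a total derivative has no
constant term. -/
theorem constTerm_torusField (k : ℤ) (f : TorusRing N) :
    constTerm N (torusField N k f + (k : ℂ) • (psum N k * f)) = 0 := by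
  have h : torusField N k f + (k : ℂ) • (psum N k * f) = ∑ i, euler i (xpow i k * f) := by
    rw [torusField_apply, psum, Finset.sum_mul, Finset.smul_sum, ← Finset.sum_add_distrib]
    refine Finset.sum_congr rfl fun i _ => ?_
    rw [Derivation.leibniz, euler_xpow_self]
    simp only [smul_eq_mul]
    rw [mul_smul_comm, mul_comm f]
  rw [h, map_sum]
  exact Finset.sum_eq_zero fun i _ => constTerm_euler i _

/-- The Weyl integral of a polynomial in power sums over the torus. -/
def weylFun (N : ℕ) : PowerSumRing →ₗ[ℂ] ℂ :=
  ((N.factorial : ℂ)⁻¹) • (constTerm N ∘ₗ LinearMap.mulLeft ℂ (weylDensity N) ∘ₗ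
    (toTorus N).toLinearMap)

theorem weylFun_apply (F : PowerSumRing) :
    weylFun N F = (N.factorial : ℂ)⁻¹ * constTerm N (weylDensity N * toTorus N F) := rfl

/-- The loop equation on the torus: multiplied by the Weyl density, the divergence becomes a total
derivative. -/
theorem weylFun_loopOp (k : ℤ) (F : PowerSumRing) : weylFun N (loopOp N k F) = 0 := by
  rw [weylFun_apply, loopOp_apply, map_add, toTorus_shiftDer, map_mul (toTorus N), map_ssum]
  simp only [map_mul, toTorus_pvar]
  rw [ssum_psum]
  have h := constTerm_torusField k (weylDensity N * toTorus N F)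
  rw [Derivation.leibniz, torusField_weylDensity] at h
  simp only [smul_eq_mul] at h
  rw [mul_eq_zero]
  right
  rw [← h]
  congr 1
  simp only [Algebra.smul_def]
  ring

end Torus

/-! ### Loop equations for the Haar measure of the unitary group -/

section Haar

variable {N : ℕ}

instance instIsMulLeftInvariantHaarU (N : ℕ) : (haarU N).IsMulLeftInvariant := by
  unfold haarU; infer_instance

instance instIsOpenPosMeasureHaarU (N : ℕ) : (haarU N).IsOpenPosMeasure := by
  unfold haarU; infer_instance

theorem integrable_haarU {f : U N → ℂ} (hf : Continuous f) : Integrable f (haarU N) :=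
  hf.integrable_of_hasCompactSupport (HasCompactSupport.of_compactSpace f)

/-- The integral of the derivative of a function along a one-parameter group vanishes. -/
theorem integral_deriv_eq_zero (γ : ℝ → U N) (hγ : ∀ s t, γ (s + t) = γ s * γ t)
    {f f' : U N → ℂ} (hf : Continuous f) (hf' : Continuous f')
    (h : ∀ u, HasDerivAt (fun t => f (γ t * u)) (f' u) 0) : ∫ u, f' u ∂haarU N = 0 := by
  have h0 : γ 0 = 1 := by
    have := hγ 0 0
    rwa [add_zero, left_eq_mul] at this
  have hd (u : U N) (t : ℝ) : HasDerivAt (fun t => f (γ t * u)) (f' (γ t * u)) t := by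
    have h1 := h (γ t * u)
    rw [← sub_self t] at h1
    have h2 := h1.comp_sub_const t t
    refine h2.congr_of_eventuallyEq (Filter.Eventually.of_forall fun s => ?_)
    simp only
    rw [← mul_assoc, ← hγ, sub_add_cancel]
  obtain ⟨B, hB⟩ := (isCompact_range hf').isBounded.exists_norm_le
  have key := hasDerivAt_integral_of_dominated_loc_of_deriv_le (μ := haarU N)
    (F := fun t u => f (γ t * u)) (F' := fun t u => f' (γ t * u)) (x₀ := (0 : ℝ))
    (s := Set.univ) (bound := fun _ => B) Filter.univ_mem
    (Filter.Eventually.of_forall fun t =>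
      (integrable_haarU (hf.comp (continuous_const_mul (γ t)))).aestronglyMeasurable)
    (integrable_haarU (hf.comp (continuous_const_mul (γ 0))))
    (integrable_haarU (hf'.comp (continuous_const_mul (γ 0)))).aestronglyMeasurable
    (Filter.Eventually.of_forall fun u t _ => hB _ ⟨_, rfl⟩) (integrable_const B)
    (Filter.Eventually.of_forall fun u t _ => hd u t)
  -- By left invariance of the measure the integral is constant in `t`.
  have hconst : (fun t => ∫ u, f (γ t * u) ∂haarU N) = fun _ => ∫ u, f u ∂haarU N := by
    funext t
    exact integral_mul_left_eq_self f (γ t)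
  have h3 := key.2
  rw [hconst] at h3
  simpa [h0] using h3.unique (hasDerivAt_const (0 : ℝ) _)

/-- The matrix of `uᵏ`. -/
def upow (u : U N) (k : ℤ) : Matrix (Fin N) (Fin N) ℂ := ((u ^ k : U N) : Matrix _ _ ℂ)

theorem tr_eq (u : U N) (k : ℤ) : tr u k = (upow u k).trace := rfl

theorem upow_mul (u : U N) (k l : ℤ) : upow u k * upow u l = upow u (k + l) := by
  simp [upow, zpow_add]

@[simp]
theorem upow_zero (u : U N) : upow u 0 = 1 := by simp [upow]

theorem upow_one (u : U N) : upow u 1 = u := by simp [upow]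

theorem upow_neg (u : U N) (k : ℤ) : upow u (-k) = star (upow u k) := by
  rw [upow, zpow_neg, upow, ← Unitary.star_eq_inv, Unitary.coe_star]

theorem tr_neg (u : U N) (k : ℤ) : tr u (-k) = star (tr u k) := by
  rw [tr_eq, tr_eq, upow_neg, Matrix.star_eq_conjTranspose, Matrix.trace_conjTranspose]

theorem continuous_upow (k : ℤ) : Continuous fun u : U N => upow u k :=
  continuous_subtype_val.comp (continuous_zpow k)

theorem continuous_upow_apply (k : ℤ) (a b : Fin N) : Continuous fun u : U N => upow u k a b :=
  (continuous_upow k).matrix_elem a b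

theorem continuous_tr (k : ℤ) : Continuous fun u : U N => tr u k := by
  simp only [tr_eq]
  exact (continuous_upow k).matrix_trace

/-- Entrywise differentiability at `0` of a curve of matrices. -/
def HasMatDeriv (A : ℝ → Matrix (Fin N) (Fin N) ℂ) (A' : Matrix (Fin N) (Fin N) ℂ) : Prop :=
  ∀ a b, HasDerivAt (fun t => A t a b) (A' a b) 0

theorem HasMatDeriv.mul {A B : ℝ → Matrix (Fin N) (Fin N) ℂ} {A' B' : Matrix (Fin N) (Fin N) ℂ}
    (hA : HasMatDeriv A A') (hB : HasMatDeriv B B') :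
    HasMatDeriv (fun t => A t * B t) (A' * B 0 + A 0 * B') := by
  intro a b
  simp only [Matrix.add_apply, Matrix.mul_apply, ← Finset.sum_add_distrib]
  exact HasDerivAt.fun_sum fun c _ => (hA a c).fun_mul (hB c b)

theorem hasMatDeriv_const (A : Matrix (Fin N) (Fin N) ℂ) : HasMatDeriv (fun _ => A) 0 :=
  fun _ _ => hasDerivAt_const _ _

theorem HasMatDeriv.trace {A : ℝ → Matrix (Fin N) (Fin N) ℂ} {A' : Matrix (Fin N) (Fin N) ℂ}
    (hA : HasMatDeriv A A') : HasDerivAt (fun t => (A t).trace) A'.trace 0 :=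
  HasDerivAt.fun_sum fun c _ => hA c c

open scoped Matrix.Norms.Operator in
theorem hasMatDeriv_exp (S : Matrix (Fin N) (Fin N) ℂ) :
    HasMatDeriv (fun t => NormedSpace.exp (t • S)) S := by
  intro a b
  let +nondep : NormedAlgebra ℚ (Matrix (Fin N) (Fin N) ℂ) := .restrictScalars ℚ ℂ _
  have h1 := hasDerivAt_exp_smul_const S (0 : ℝ)
  rw [zero_smul, NormedSpace.exp_zero, one_mul] at h1
  let φ : Matrix (Fin N) (Fin N) ℂ →ₗ[ℝ] ℂ := (Matrix.entryLinearMap ℂ ℂ a b).restrictScalars ℝ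
  exact (φ.toContinuousLinearMap.hasFDerivAt).comp_hasDerivAt (0 : ℝ) h1

/-- The curve is `exp (t S)`, unitary because `S` is skew-Hermitian. The Leibniz rule inserts `S` at
each position of the word `(exp (t S) u)ᵏ`; inverse letters contribute with a minus sign, as
recorded by `ssum`. -/
theorem exists_oneParameter (S : Matrix (Fin N) (Fin N) ℂ) (hS : star S = -S) :
    ∃ γ : ℝ → U N, (∀ s t, γ (s + t) = γ s * γ t) ∧
      ∀ (u : U N) (k : ℤ), HasMatDeriv (fun t => upow (γ t * u) k)
          (ssum (fun j => upow u j * S * upow u (k - j)) k) := by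
  have hstar (t : ℝ) : star (NormedSpace.exp (t • S)) = NormedSpace.exp (t • (-S)) := by
    rw [Matrix.star_eq_conjTranspose, ← Matrix.exp_conjTranspose, Matrix.conjTranspose_smul,
      ← Matrix.star_eq_conjTranspose, hS]
    simp
  have hexp (s t : ℝ) : NormedSpace.exp ((s + t) • S) =
      NormedSpace.exp (s • S) * NormedSpace.exp (t • S) := by
    rw [add_smul, Matrix.exp_add_of_commute]
    exact ((Commute.refl S).smul_left s).smul_right t
  let γ : ℝ → U N := fun t => ⟨NormedSpace.exp (t • S), by
    rw [Matrix.mem_unitaryGroup_iff, hstar, smul_neg, ← neg_smul, ← hexp, add_neg_cancel, zero_smul,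
      NormedSpace.exp_zero]⟩
  have hγ (t : ℝ) : (γ t : Matrix (Fin N) (Fin N) ℂ) = NormedSpace.exp (t • S) := rfl
  have hadd (s t : ℝ) : γ (s + t) = γ s * γ t := Subtype.ext (hexp s t)
  have hγ0 : γ 0 = 1 := Subtype.ext (by simp [hγ])
  have hone (u : U N) : HasMatDeriv (fun t => upow (γ t * u) 1) (S * u) := by
    have h1 := (hasMatDeriv_exp S).mul (hasMatDeriv_const (u : Matrix (Fin N) (Fin N) ℂ))
    simp only [mul_zero, add_zero] at h1
    simpa only [upow_one, Submonoid.coe_mul, hγ] using h1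
  have hinv (u : U N) : HasMatDeriv (fun t => upow (γ t * u) (-1)) (-(upow u (-1) * S)) := by
    have h1 := (hasMatDeriv_const (upow u (-1))).mul (hasMatDeriv_exp (-S))
    simp only [zero_mul, zero_add, mul_neg] at h1
    simp only [upow_neg, upow_one, Submonoid.coe_mul, star_mul, hγ, hstar] at h1 ⊢
    exact h1
  refine ⟨γ, hadd, fun u k => ?_⟩
  induction k using Int.induction_on with
  | zero =>
    simp only [upow_zero, ssum_zero]
    exact hasMatDeriv_const _
  | succ n ih =>
    have h1 := ih.mul (hone u)
    simp only [hγ0, one_mul, upow_mul] at h1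
    have h2 : ssum (fun j => upow u j * S * upow u ((n : ℤ) + 1 - j)) ((n : ℤ) + 1) =
        ssum (fun j => upow u j * S * upow u ((n : ℤ) - j)) n * upow u 1 + upow u n * (S * u) := by
      rw [ssum_add_one, ssum_mul]
      congr 1
      · congr 1
        funext j
        rw [mul_assoc _ _ (upow u 1), upow_mul]
        congr 2
        ring
      · rw [mul_assoc, show (n : ℤ) + 1 - n = 1 by ring, upow_one]
    rw [h2]
    exact h1
  | pred n ih =>
    have h1 := ih.mul (hinv u)
    simp only [hγ0, one_mul, upow_mul] at h1
    have h2 := ssum_add_one (fun j => upow u j * S * upow u (-(n : ℤ) - 1 - j)) (-(n : ℤ) - 1)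
    rw [sub_add_cancel] at h2
    have h3 : ssum (fun j => upow u j * S * upow u (-(n : ℤ) - 1 - j)) (-(n : ℤ) - 1) =
        ssum (fun j => upow u j * S * upow u (-(n : ℤ) - j)) (-(n : ℤ)) * upow u (-1) +
          upow u (-(n : ℤ)) * -(upow u (-1) * S) := by
      rw [ssum_mul, mul_neg, ← mul_assoc, upow_mul, ← sub_eq_add_neg, ← sub_eq_add_neg]
      have h3 : (fun j => upow u j * S * upow u (-(n : ℤ) - j) * upow u (-1)) =
          fun j => upow u j * S * upow u (-(n : ℤ) - 1 - j) := by
        funext j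
        rw [mul_assoc, upow_mul]
        congr 2
        ring
      rw [h3, h2]
      simp
    rw [h3]
    exact h1

/-- Evaluation of a polynomial in power sums at the traces of powers of `u`. -/
def evalU (u : U N) : PowerSumRing →ₐ[ℂ] ℂ := MvPolynomial.aeval (tr u)

theorem evalU_X (u : U N) (k : ℤ) : evalU u (MvPolynomial.X k) = tr u k := by simp [evalU]

theorem evalU_C (u : U N) (c : ℂ) : evalU u (MvPolynomial.C c) = c := by simp [evalU]

theorem evalU_pvar (u : U N) (k : ℤ) : evalU u (pvar N k) = tr u k := by
  unfold pvar
  split_ifs with h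
  · subst h
    simp [evalU, tr_eq]
  · simp [evalU]

theorem continuous_evalU (F : PowerSumRing) : Continuous fun u : U N => evalU u F := by
  induction F using MvPolynomial.induction_on with
  | C a => simpa only [evalU_C] using continuous_const
  | add p q hp hq =>
    simp only [map_add]
    exact hp.add hq
  | mul_X p k hp =>
    simp only [map_mul, evalU_X]
    exact hp.mul (continuous_tr k)

/-- The universal derivation `F ↦ (k ∂F/∂p_k)_k`. -/
def grad : Derivation ℂ PowerSumRing (ℤ →₀ PowerSumRing) :=
  MvPolynomial.mkDerivation ℂ fun k => Finsupp.single k (MvPolynomial.C (k : ℂ))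

theorem grad_X (k : ℤ) :
    grad (MvPolynomial.X k) = Finsupp.single k (MvPolynomial.C (k : ℂ)) := by
  rw [grad, MvPolynomial.mkDerivation_X]

theorem grad_C (c : ℂ) : grad (MvPolynomial.C c) = 0 := MvPolynomial.derivation_C _ _

/-- The matrix `∑ₖ v_k(u) uᵏ` of a vector field `v`. -/
def fieldU (u : U N) : (ℤ →₀ PowerSumRing) →ₗ[ℂ] Matrix (Fin N) (Fin N) ℂ :=
  Finsupp.lsum ℂ fun k => (evalU u).toLinearMap.smulRight (upow u k)

theorem fieldU_single (u : U N) (k : ℤ) (F : PowerSumRing) :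
    fieldU u (Finsupp.single k F) = evalU u F • upow u k := by
  simp [fieldU]

theorem fieldU_smul (u : U N) (F : PowerSumRing) (v : ℤ →₀ PowerSumRing) :
    fieldU u (F • v) = evalU u F • fieldU u v := by
  induction v using Finsupp.induction_linear with
  | zero => simp
  | add v w hv hw => simp only [smul_add, map_add, hv, hw]
  | single k G =>
    rw [Finsupp.smul_single, fieldU_single, fieldU_single, smul_eq_mul, map_mul, smul_smul]

theorem continuous_fieldU (v : ℤ →₀ PowerSumRing) : Continuous fun u : U N => fieldU u v := by
  induction v using Finsupp.induction_linear with
  | zero => simpa using continuous_const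
  | add v w hv hw =>
    simp only [map_add]
    exact hv.add hw
  | single k G =>
    simp only [fieldU_single]
    exact (continuous_evalU G).smul (continuous_upow k)

theorem fieldU_grad_mul (u : U N) (F G : PowerSumRing) :
    fieldU u (grad (F * G)) =
      evalU u F • fieldU u (grad G) + evalU u G • fieldU u (grad F) := by
  rw [Derivation.leibniz, map_add, fieldU_smul, fieldU_smul]

theorem fieldU_grad_X (u : U N) (k : ℤ) :
    fieldU u (grad (MvPolynomial.X k)) = (k : ℂ) • upow u k := by
  rw [grad_X, fieldU_single, evalU_C]

theorem trace_ssum (u : U N) (S : Matrix (Fin N) (Fin N) ℂ) (k : ℤ) :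
    (ssum (fun j => upow u j * S * upow u (k - j)) k).trace = (k : ℂ) * (S * upow u k).trace := by
  have h := map_ssum (Matrix.traceAddMonoidHom (Fin N) ℂ)
    (fun j => upow u j * S * upow u (k - j)) k
  simp only [Matrix.traceAddMonoidHom_apply] at h
  rw [h]
  have h2 (j : ℤ) : (upow u j * S * upow u (k - j)).trace = (S * upow u k).trace := by
    rw [Matrix.trace_mul_comm, ← mul_assoc, upow_mul, Matrix.trace_mul_comm, sub_add_cancel]
  simp only [h2]
  rw [ssum_const, zsmul_eq_mul]

/-- The integral of `f ∘ u` over the unitary group, for `f` a polynomial in power sums. -/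
def haarFun (N : ℕ) : PowerSumRing →ₗ[ℂ] ℂ where
  toFun F := ∫ u : U N, evalU u F ∂haarU N
  map_add' F G := by
    simp only [map_add]
    exact integral_add (integrable_haarU (continuous_evalU F))
      (integrable_haarU (continuous_evalU G))
  map_smul' c F := by
    simp only [map_smul, RingHom.id_apply]
    exact integral_smul c _

theorem haarFun_apply (F : PowerSumRing) : haarFun N F = ∫ u : U N, evalU u F ∂haarU N := rfl

/-- Writing the derivation as a contraction of `grad F` lets later arguments run by induction on
vector fields, where linearity suffices. -/
theorem shiftDer_eq (k : ℤ) (F : PowerSumRing) (N : ℕ) :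
    shiftDer N k F = (grad F).sum fun l G => G * pvar N (k + l) := by
  let φ : (ℤ →₀ PowerSumRing) →ₗ[PowerSumRing] PowerSumRing :=
    Finsupp.lsum PowerSumRing fun l => LinearMap.mulRight PowerSumRing (pvar N (k + l))
  have h : shiftDer N k = φ.compDer grad := by
    refine MvPolynomial.derivation_ext fun l => ?_
    simp [φ, shiftDer, MvPolynomial.mkDerivation_X, grad_X]
  rw [h]
  change φ (grad F) = _
  simp only [φ, Finsupp.lsum_apply]
  rfl

theorem trace_upow_mul_fieldU (u : U N) (k : ℤ) (F : PowerSumRing) :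
    (upow u k * fieldU u (grad F)).trace = evalU u (shiftDer N k F) := by
  rw [shiftDer_eq]
  generalize grad F = v
  induction v using Finsupp.induction_linear with
  | zero => simp
  | add v w hv hw =>
    rw [map_add, mul_add, Matrix.trace_add, hv, hw, Finsupp.sum_add_index', map_add]
    · simp
    · intro l a b; ring
  | single l G =>
    rw [fieldU_single, mul_smul_comm, upow_mul, Matrix.trace_smul,
      Finsupp.sum_single_index (by simp), map_mul, evalU_pvar, tr_eq, smul_eq_mul]

/-- The chain rule: by cyclicity of the trace, `Tr uᵏ` has derivative `k Tr (S uᵏ)` in the direction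
`S`. -/
theorem hasDerivAt_evalU (γ : ℝ → U N) (hγ0 : γ 0 = 1) (S : Matrix (Fin N) (Fin N) ℂ) (u : U N)
    (h : ∀ k : ℤ, HasMatDeriv (fun t => upow (γ t * u) k)
      (ssum (fun j => upow u j * S * upow u (k - j)) k)) (F : PowerSumRing) :
    HasDerivAt (fun t => evalU (γ t * u) F) ((S * fieldU u (grad F)).trace) 0 := by
  induction F using MvPolynomial.induction_on with
  | C a =>
    simp only [evalU_C, grad_C, map_zero, mul_zero, Matrix.trace_zero]
    exact hasDerivAt_const _ _
  | add p q hp hq =>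
    simp only [map_add, mul_add, Matrix.trace_add]
    exact hp.add hq
  | mul_X p k hp =>
    have h1 := (h k).trace
    rw [trace_ssum] at h1
    have h2 := hp.fun_mul h1
    simp only [map_mul, evalU_X]
    simp only [hγ0, one_mul] at h2
    have h3 : (S * fieldU u (grad (p * MvPolynomial.X k))).trace =
        (S * fieldU u (grad p)).trace * (upow u k).trace +
          evalU u p * ((k : ℂ) * (S * upow u k).trace) := by
      simp only [fieldU_grad_mul, fieldU_grad_X, evalU_X, mul_add, Matrix.trace_add,
        mul_smul_comm, Matrix.trace_smul, smul_eq_mul, tr_eq]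
      ring
    rw [h3]
    exact h2

/-- The derivative of `(uᵏ)_{ab} F(u)` in the direction `S`. -/
def entryDeriv (k : ℤ) (F : PowerSumRing) (a b : Fin N) (u : U N) :
    Matrix (Fin N) (Fin N) ℂ →ₗ[ℂ] ℂ where
  toFun S := (ssum (fun j => upow u j * S * upow u (k - j)) k) a b * evalU u F +
    upow u k a b * (S * fieldU u (grad F)).trace
  map_add' S T := by
    have h : ssum (fun j => upow u j * (S + T) * upow u (k - j)) k =
        ssum (fun j => upow u j * S * upow u (k - j)) k +
          ssum (fun j => upow u j * T * upow u (k - j)) k := by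
      simp only [ssum, mul_add, add_mul, Finset.sum_add_distrib]
      abel
    rw [h, Matrix.add_apply, add_mul S T, Matrix.trace_add]
    ring
  map_smul' c S := by
    have h : ssum (fun j => upow u j * (c • S) * upow u (k - j)) k =
        c • ssum (fun j => upow u j * S * upow u (k - j)) k := by
      simp only [ssum, mul_smul_comm, smul_mul_assoc, ← Finset.smul_sum, smul_sub]
    rw [h, Matrix.smul_apply, smul_mul_assoc c S, Matrix.trace_smul]
    simp only [smul_eq_mul, RingHom.id_apply]
    ring

theorem entryDeriv_apply (k : ℤ) (F : PowerSumRing) (a b : Fin N) (u : U N)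
    (S : Matrix (Fin N) (Fin N) ℂ) :
    entryDeriv k F a b u S = (ssum (fun j => upow u j * S * upow u (k - j)) k) a b * evalU u F +
      upow u k a b * (S * fieldU u (grad F)).trace := rfl

theorem continuous_entryDeriv (k : ℤ) (F : PowerSumRing) (a b : Fin N)
    (S : Matrix (Fin N) (Fin N) ℂ) : Continuous fun u : U N => entryDeriv k F a b u S := by
  simp only [entryDeriv_apply]
  refine Continuous.add (Continuous.mul ?_ (continuous_evalU F))
    ((continuous_upow_apply k a b).mul
      (continuous_const.matrix_mul (continuous_fieldU _)).matrix_trace)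
  refine Continuous.matrix_elem ?_ a b
  have h (j : ℤ) : Continuous fun u : U N => upow u j * S * upow u (k - j) :=
    ((continuous_upow j).matrix_mul continuous_const).matrix_mul (continuous_upow _)
  exact (continuous_finsetSum _ fun j _ => h j).sub (continuous_finsetSum _ fun j _ => h j)

/-- Only skew-Hermitian directions are tangent to the group. Every matrix is a complex combination
of two of them, and the expression is complex linear in the direction. -/
theorem integral_entryDeriv (k : ℤ) (F : PowerSumRing) (a b : Fin N)
    (S : Matrix (Fin N) (Fin N) ℂ) : ∫ u, entryDeriv k F a b u S ∂haarU N = 0 := by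
  have hskew (S : Matrix (Fin N) (Fin N) ℂ) (hS : star S = -S) :
      ∫ u, entryDeriv k F a b u S ∂haarU N = 0 := by
    obtain ⟨γ, hγ, hd⟩ := exists_oneParameter S hS
    have hγ0 : γ 0 = 1 := by
      have := hγ 0 0
      rwa [add_zero, left_eq_mul] at this
    refine integral_deriv_eq_zero γ hγ (f := fun u => upow u k a b * evalU u F)
      ((continuous_upow_apply k a b).mul (continuous_evalU F)) (continuous_entryDeriv k F a b S)
      fun u => ?_
    have h2 := (hd u k a b).fun_mul (hasDerivAt_evalU γ hγ0 S u (hd u) F)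
    simp only [hγ0, one_mul] at h2
    exact h2
  have h1 : star (S - star S) = -(S - star S) := by
    simp
  have h2 : star (Complex.I • (S + star S)) = -(Complex.I • (S + star S)) := by
    rw [star_smul, star_add, star_star, add_comm (star S), Complex.star_def, Complex.conj_I, neg_smul]
  have hS : S = (1 / 2 : ℂ) • (S - star S) + (-Complex.I / 2) • (Complex.I • (S + star S)) := by
    rw [smul_smul]
    have : -Complex.I / 2 * Complex.I = 1 / 2 := by
      rw [neg_div, neg_mul, div_mul_eq_mul_div, Complex.I_mul_I]; norm_num
    rw [this, ← smul_add, sub_add_add_cancel, ← two_smul ℂ S, smul_smul]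
    norm_num
  have hsplit (u : U N) : entryDeriv k F a b u S =
      (1 / 2 : ℂ) * entryDeriv k F a b u (S - star S) +
        (-Complex.I / 2) * entryDeriv k F a b u (Complex.I • (S + star S)) := by
    rw [← smul_eq_mul, ← smul_eq_mul, ← map_smul, ← map_smul, ← map_add, ← hS]
  simp only [hsplit]
  rw [integral_add, integral_const_mul, integral_const_mul, hskew _ h1, hskew _ h2]
  · simp
  · exact (integrable_haarU (continuous_entryDeriv k F a b _)).const_mul _
  · exact (integrable_haarU (continuous_entryDeriv k F a b _)).const_mul _

/-- The `(a, b)` entry of `uʲ E_{ab} u^{k-j}` is `(uʲ)_{aa} (u^{k-j})_{bb}`, so summing over matrix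
units turns insertions into products of two traces. -/
theorem sum_entryDeriv (k : ℤ) (F : PowerSumRing) (u : U N) :
    ∑ a, ∑ b, entryDeriv k F a b u (Matrix.single a b 1) = evalU u (loopOp N k F) := by
  have h1 : ∑ a, ∑ b, (ssum (fun j => upow u j * Matrix.single a b (1 : ℂ) * upow u (k - j)) k :
      Matrix (Fin N) (Fin N) ℂ) a b =
      evalU u (ssum (fun j => pvar N j * pvar N (k - j)) k) := by
    rw [map_ssum]
    simp only [map_mul, evalU_pvar]
    have h (a b : Fin N) :
        (ssum (fun j => upow u j * Matrix.single a b (1 : ℂ) * upow u (k - j)) k :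
          Matrix (Fin N) (Fin N) ℂ) a b =
        ssum (fun j => upow u j a a * upow u (k - j) b b) k := by
      have := map_ssum (Matrix.entryAddMonoidHom ℂ a b)
        (fun j => upow u j * Matrix.single a b 1 * upow u (k - j)) k
      simp only [Matrix.entryAddMonoidHom_apply] at this
      rw [this]
      congr 1
      funext j
      rw [Matrix.mul_apply, Finset.sum_eq_single b]
      · simp
      · intro c _ hc
        rw [Matrix.mul_single_apply_of_ne _ _ _ _ _ hc, zero_mul]
      · simp
    simp only [h, ← ssum_sum]
    congr 1
    funext j
    rw [tr_eq, tr_eq, Matrix.trace, Matrix.trace, Finset.sum_mul_sum]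
    rfl
  have h2 : ∑ a, ∑ b, upow u k a b * (Matrix.single a b 1 * fieldU u (grad F)).trace =
      evalU u (shiftDer N k F) := by
    rw [← trace_upow_mul_fieldU, Matrix.trace]
    refine Finset.sum_congr rfl fun a _ => ?_
    rw [Matrix.diag_apply, Matrix.mul_apply]
    refine Finset.sum_congr rfl fun b _ => ?_
    rw [Matrix.trace_single_mul, one_smul]
  simp only [entryDeriv_apply, Finset.sum_add_distrib, ← Finset.sum_mul, h1, h2]
  rw [loopOp_apply, map_add, map_mul, add_comm]

theorem haarFun_loopOp (k : ℤ) (F : PowerSumRing) : haarFun N (loopOp N k F) = 0 := by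
  rw [haarFun_apply]
  simp only [← sum_entryDeriv]
  rw [integral_finsetSum]
  · refine Finset.sum_eq_zero fun a _ => ?_
    rw [integral_finsetSum]
    · exact Finset.sum_eq_zero fun b _ => integral_entryDeriv k F a b _
    · exact fun b _ => integrable_haarU (continuous_entryDeriv k F a b _)
  · exact fun a _ => integrable_haarU
      (continuous_finsetSum _ fun b _ => continuous_entryDeriv k F a b _)

end Haar

/-! ### Toeplitz determinants as torus integrals -/

section Toeplitz

variable {N : ℕ}

/-- The charge of a variable: `k` for `t⁺ₖ` and `-k` for `t⁻ₖ`. -/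
def chargeVar : TVar → ℤ := Sum.elim (fun k => (k : ℤ)) (fun k => -(k : ℤ))

/-- The charge of a monomial in the variables `t⁺, t⁻`. -/
def charge : (TVar →₀ ℕ) →+ ℤ := Finsupp.weight chargeVar

theorem charge_apply (d : TVar →₀ ℕ) : charge d = d.sum fun v e => e • chargeVar v := by
  rw [charge, Finsupp.weight_apply]

/-- The component of charge `n` of a power series. -/
def chargeComp (n : ℤ) (f : MvPowerSeries TVar ℂ) : MvPowerSeries TVar ℂ :=
  fun d => if charge d = n then coeff d f else 0

theorem coeff_chargeComp (n : ℤ) (f : MvPowerSeries TVar ℂ) (d : TVar →₀ ℕ) :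
    coeff d (chargeComp n f) = if charge d = n then coeff d f else 0 := rfl

/-- The Toeplitz determinant whose symbol has the charge components of `f` as Fourier
coefficients. -/
def toeplitzDet (N : ℕ) (f : MvPowerSeries TVar ℂ) : MvPowerSeries TVar ℂ :=
  (Matrix.of fun i j : Fin N => chargeComp ((i : ℤ) - j) f).det

/-- The monomial `∏ᵥ p_{charge v}^{dᵥ}` in the power sums. -/
def powerSumMonomial (d : TVar →₀ ℕ) : PowerSumRing :=
  d.prod fun v e => MvPolynomial.X (chargeVar v) ^ e

theorem xpow_prod {ι : Type*} (i : Fin N) (s : Finset ι) (k : ι → ℤ) :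
    ∏ j ∈ s, xpow i (k j) = xpow i (∑ j ∈ s, k j) := by
  classical
  induction s using Finset.induction_on with
  | empty => simp
  | insert a s ha ih => rw [Finset.prod_insert ha, Finset.sum_insert ha, ih, xpow_mul]

theorem prod_xpow (k : Fin N → ℤ) :
    ∏ i, xpow i (k i) = AddMonoidAlgebra.single k (1 : ℂ) := by
  have h (s : Finset (Fin N)) : ∏ i ∈ s, xpow i (k i) =
      AddMonoidAlgebra.single (∑ i ∈ s, Pi.single i (k i)) (1 : ℂ) := by
    induction s using Finset.induction_on with
    | empty => simp [AddMonoidAlgebra.one_def]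
    | insert a s ha ih =>
      rw [Finset.prod_insert ha, Finset.sum_insert ha, ih, xpow,
        AddMonoidAlgebra.single_mul_single, one_mul]
  rw [h, Finset.univ_sum_single]

theorem det_vandermonde_xpow (ε : ℤ) :
    (Matrix.vandermonde fun i : Fin N => xpow i ε).det =
      ∑ σ : Equiv.Perm (Fin N), (Equiv.Perm.sign σ : ℂ) • ∏ i, xpow i (ε * (σ i : ℤ)) := by
  rw [← Matrix.det_transpose, Matrix.det_apply]
  refine Finset.sum_congr rfl fun σ _ => ?_
  simp only [Matrix.transpose_apply, Matrix.vandermonde_apply, xpow_pow]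
  rcases Int.units_eq_one_or (Equiv.Perm.sign σ) with h | h <;> simp [h]

theorem weylDensity_eq_det : weylDensity N =
    (Matrix.vandermonde fun i : Fin N => xpow i 1).det *
      (Matrix.vandermonde fun i : Fin N => xpow i (-1)).det := by
  rw [weylDensity, ← Finset.prod_prod_Ioi_mul_eq_prod_prod_off_diag
    (fun j i : Fin N => 1 - xpow i 1 * xpow j (-1)), Matrix.det_vandermonde,
    Matrix.det_vandermonde, ← Finset.prod_mul_distrib]
  refine Finset.prod_congr rfl fun i _ => ?_
  rw [← Finset.prod_mul_distrib]
  refine Finset.prod_congr rfl fun j _ => ?_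
  have hi : xpow i 1 * xpow i (-1) = 1 := by rw [xpow_mul]; simp
  have hj : xpow j 1 * xpow j (-1) = 1 := by rw [xpow_mul]; simp
  linear_combination (xpow j 1 * xpow j (-1)) * hi - hi

theorem weylDensity_eq_sum : weylDensity N =
    ∑ τ : Equiv.Perm (Fin N), ∑ σ : Equiv.Perm (Fin N),
      ((Equiv.Perm.sign τ : ℂ) * (Equiv.Perm.sign σ : ℂ)) •
        ∏ i, xpow i (-((τ i : ℤ) - (σ i : ℤ))) := by
  rw [weylDensity_eq_det, mul_comm, det_vandermonde_xpow, det_vandermonde_xpow, Finset.sum_mul_sum]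
  refine Finset.sum_congr rfl fun τ _ => Finset.sum_congr rfl fun σ _ => ?_
  rw [smul_mul_smul_comm, ← Finset.prod_mul_distrib]
  congr 1
  refine Finset.prod_congr rfl fun i _ => ?_
  rw [xpow_mul]
  congr 1
  ring

theorem toTorus_powerSumMonomial (d : TVar →₀ ℕ) :
    toTorus N (powerSumMonomial d) = d.prod fun v e => psum N (chargeVar v) ^ e := by
  simp [powerSumMonomial, Finsupp.prod, toTorus]

theorem coeff_linExp_smul {σ A : Type*} [CommRing A] [Algebra ℂ A] (c : σ → ℂ) (x : σ → A)
    (d : σ →₀ ℕ) :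
    coeff d (linExp fun v => c v • x v) =
      coeff d (linExp c) • d.prod fun v e => x v ^ e := by
  simp only [coeff_linExp, Finsupp.prod]
  rw [Algebra.smul_def, map_prod, ← Finset.prod_mul_distrib]
  refine Finset.prod_congr rfl fun v _ => ?_
  rw [smul_pow, smul_smul, ← Algebra.smul_def, smul_eq_mul]

theorem coeff_linExp_xpow (c : TVar → ℂ) (i : Fin N) (d : TVar →₀ ℕ) :
    coeff d (linExp fun v => c v • xpow i (chargeVar v)) =
      coeff d (linExp c) • xpow i (charge d) := by
  rw [coeff_linExp_smul, charge_apply]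
  congr 1
  simp only [Finsupp.prod, Finsupp.sum, xpow_pow, xpow_prod]
  congr 1
  refine Finset.sum_congr rfl fun v _ => ?_
  rw [nsmul_eq_mul, mul_comm]

theorem linExp_sum {ι σ A : Type*} [CommRing A] [Algebra ℂ A] (s : Finset ι) (c : ι → σ → A) :
    linExp (∑ i ∈ s, c i) = ∏ i ∈ s, linExp (c i) := by
  classical
  induction s using Finset.induction_on with
  | empty => simp [linExp_zero]
  | insert a s ha ih => rw [Finset.prod_insert ha, Finset.sum_insert ha, linExp_add, ih]

/-- In the product of one exponential per torus variable, the exponent of `xᵢ` records the charge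
taken from the `i`-th factor; pairing with `∏ xᵢ^(-nᵢ)` selects charge `nᵢ`. -/
theorem coeff_prod_chargeComp (c : TVar → ℂ) (n : Fin N → ℤ) (d : TVar →₀ ℕ) :
    coeff d (∏ i, chargeComp (n i) (linExp c)) =
      coeff d (linExp c) *
        constTerm N ((∏ i, xpow i (-(n i))) * toTorus N (powerSumMonomial d)) := by
  classical
  have h1 : coeff d (∏ i : Fin N, linExp fun v => c v • xpow i (chargeVar v)) =
      coeff d (linExp c) • toTorus N (powerSumMonomial d) := by
    rw [← linExp_sum, toTorus_powerSumMonomial, ← coeff_linExp_smul]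
    congr 2
    funext v
    rw [Finset.sum_apply, psum, Finset.smul_sum]
  rw [← smul_eq_mul, ← map_smul, ← mul_smul_comm, ← h1, coeff_prod, coeff_prod, Finset.mul_sum,
    map_sum]
  refine Finset.sum_congr rfl fun l _ => ?_
  simp only [coeff_linExp_xpow, coeff_chargeComp]
  rw [Finset.prod_smul, mul_smul_comm, map_smul, ← Finset.prod_mul_distrib]
  simp only [xpow_mul]
  rw [prod_xpow, constTerm_single, smul_eq_mul]
  by_cases h : ∀ i, charge (l i) = n i
  · rw [if_pos (by funext i; simp [h i]), mul_one]
    exact Finset.prod_congr rfl fun i _ => if_pos (h i)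
  · rw [if_neg, mul_zero]
    · push Not at h
      obtain ⟨i, hi⟩ := h
      exact Finset.prod_eq_zero (Finset.mem_univ i) (if_neg hi)
    · intro h0
      apply h
      intro i
      have := congrFun h0 i
      simp only [Pi.zero_apply] at this
      omega

theorem sum_sign_prod_toeplitz (f : ℤ → MvPowerSeries TVar ℂ) (τ : Equiv.Perm (Fin N)) :
    ∑ σ : Equiv.Perm (Fin N), ((Equiv.Perm.sign τ : ℂ) * (Equiv.Perm.sign σ : ℂ)) •
      ∏ i, f ((τ i : ℤ) - (σ i : ℤ)) = (Matrix.of fun i j : Fin N => f ((i : ℤ) - j)).det := by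
  have h := Matrix.det_permute τ (Matrix.of fun i j : Fin N => f ((i : ℤ) - j))
  have h2 : (Equiv.Perm.sign τ : MvPowerSeries TVar ℂ) * (Equiv.Perm.sign τ) = 1 := by
    rcases Int.units_eq_one_or (Equiv.Perm.sign τ) with h | h <;> simp [h]
  rw [← one_mul (Matrix.det _), ← h2, mul_assoc, ← h, ← Matrix.det_transpose, Matrix.det_apply',
    Finset.mul_sum]
  refine Finset.sum_congr rfl fun σ _ => ?_
  rw [← mul_assoc]
  simp only [Matrix.transpose_apply, Matrix.submatrix_apply, Matrix.of_apply, id_eq]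
  rcases Int.units_eq_one_or (Equiv.Perm.sign τ) with h | h <;>
    rcases Int.units_eq_one_or (Equiv.Perm.sign σ) with h' | h' <;> simp [h, h']

/-- The Heine–Szegő identity for the symbol `exp (∑ᵥ cᵥ tᵥ x^{charge v})`. -/
theorem coeff_toeplitzDet (c : TVar → ℂ) (d : TVar →₀ ℕ) :
    coeff d (toeplitzDet N (linExp c)) =
      coeff d (linExp c) * weylFun N (powerSumMonomial d) := by
  have h : (N.factorial : ℂ) * coeff d (toeplitzDet N (linExp c)) =
      coeff d (linExp c) * constTerm N (weylDensity N * toTorus N (powerSumMonomial d)) := by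
    rw [weylDensity_eq_sum, Finset.sum_mul, map_sum, Finset.mul_sum]
    -- For each fixed `τ` the sum over `σ` is the whole determinant with permuted rows; summing over
    -- `τ` gives the factor `N!`.
    have hτ (τ : Equiv.Perm (Fin N)) : coeff d (linExp c) *
        constTerm N ((∑ σ : Equiv.Perm (Fin N),
          ((Equiv.Perm.sign τ : ℂ) * (Equiv.Perm.sign σ : ℂ)) •
            ∏ i, xpow i (-((τ i : ℤ) - (σ i : ℤ)))) * toTorus N (powerSumMonomial d)) =
        coeff d (toeplitzDet N (linExp c)) := by
      rw [toeplitzDet, ← sum_sign_prod_toeplitz (fun n => chargeComp n (linExp c)) τ, map_sum,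
        Finset.sum_mul, map_sum, Finset.mul_sum]
      refine Finset.sum_congr rfl fun σ _ => ?_
      rw [MvPowerSeries.coeff_smul, coeff_prod_chargeComp, smul_mul_assoc, map_smul]
      simp only [smul_eq_mul]
      ring
    simp only [hτ]
    simp [Fintype.card_perm]
  have hN : (N.factorial : ℂ) ≠ 0 := Nat.cast_ne_zero.2 N.factorial_ne_zero
  rw [weylFun_apply]
  field_simp
  rw [mul_comm, h]

/-- The normalization is the Heine–Szegő identity for the trivial symbol, whose Toeplitz matrix is
the identity. -/
theorem weylFun_one : weylFun N 1 = 1 := by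
  have h := coeff_toeplitzDet (N := N) (fun _ => 0) 0
  have h0 (n : ℤ) : chargeComp n (linExp fun _ => 0) = if n = 0 then 1 else 0 := by
    classical
    have h1 : linExp (fun _ : TVar => (0 : ℂ)) = 1 := linExp_zero
    rw [h1]
    ext d
    rw [coeff_chargeComp, coeff_one]
    by_cases hd : d = 0
    · subst hd
      by_cases hn : n = 0
      · simp [hn]
      · simp [hn, Ne.symm hn]
    · by_cases hn : n = 0
      · simp [hn, hd, coeff_one]
      · simp [hn, hd]
  have h1 : toeplitzDet N (linExp fun _ => 0) = 1 := by
    rw [toeplitzDet]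
    simp only [h0]
    rw [← Matrix.det_one (n := Fin N)]
    congr 1
    ext i j
    simp [Matrix.one_apply, sub_eq_zero, Fin.ext_iff]
  rw [h1] at h
  simpa [coeff_linExp, powerSumMonomial] using h.symm

end Toeplitz

/-! ### Diagonalization of unitary matrices and evaluation on the torus -/

section Diagonal

variable {N : ℕ}

/-- Diagonal unitary matrices. -/
def diagU (N : ℕ) : (Fin N → Circle) →* U N where
  toFun x := ⟨Matrix.diagonal fun i => (x i : ℂ), by
    rw [Matrix.mem_unitaryGroup_iff, Matrix.star_eq_conjTranspose, Matrix.diagonal_conjTranspose,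
      Matrix.diagonal_mul_diagonal, ← Matrix.diagonal_one]
    congr 1
    funext i
    rw [Pi.star_apply, Complex.star_def, Complex.mul_conj, Complex.normSq_eq_norm_sq,
      Circle.norm_coe]
    simp⟩
  map_one' := Subtype.ext (by simp)
  map_mul' x y := Subtype.ext (by simp)

theorem upow_diagU (x : Fin N → Circle) (k : ℤ) :
    upow (diagU N x) k = Matrix.diagonal fun i => (x i : ℂ) ^ k := by
  rw [upow, ← map_zpow]
  change Matrix.diagonal _ = _
  congr 1

/-- The circle is infinite and the characteristic polynomial has finitely many roots. Such a `z`
makes the Cayley transform below well defined. -/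
theorem exists_unit_notMem_spectrum (M : Matrix (Fin N) (Fin N) ℂ) :
    ∃ z : ℂ, ‖z‖ = 1 ∧ IsUnit (z • (1 : Matrix (Fin N) (Fin N) ℂ) - M).det := by
  have hinf : (Set.range fun z : Circle => (z : ℂ)).Infinite := by
    have hinj : Function.Injective fun n : ℕ => ((Circle.exp (1 / (n + 1 : ℝ)) : Circle) : ℂ) := by
      intro m n hmn
      have harg (k : ℕ) : Complex.arg (Circle.exp (1 / (k + 1 : ℝ)) : Circle) = 1 / (k + 1 : ℝ) := by
        have h1 : (0 : ℝ) < 1 / (k + 1 : ℝ) := by positivity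
        have h2 : 1 / (k + 1 : ℝ) ≤ 1 := by
          rw [div_le_one (by positivity)]
          linarith [(Nat.cast_nonneg k : (0 : ℝ) ≤ k)]
        exact Circle.arg_exp (by linarith [Real.pi_pos]) (by linarith [Real.pi_gt_three])
      have h := congrArg Complex.arg hmn
      simp only [harg] at h
      rw [one_div, one_div, inv_inj] at h
      exact_mod_cast add_right_cancel h
    exact (Set.infinite_range_of_injective hinj).mono (by rintro _ ⟨n, rfl⟩; exact ⟨_, rfl⟩)
  obtain ⟨z, ⟨ζ, rfl⟩, hz⟩ := hinf.exists_notMem_finset M.charpoly.roots.toFinset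
  refine ⟨ζ, Circle.norm_coe ζ, ?_⟩
  rw [isUnit_iff_ne_zero]
  intro h0
  apply hz
  rw [Multiset.mem_toFinset, Polynomial.mem_roots M.charpoly_monic.ne_zero, Polynomial.IsRoot.def,
    Matrix.eval_charpoly, ← h0]
  simp [Matrix.scalar_apply, Matrix.smul_one_eq_diagonal]

/-- Every unitary matrix is unitarily conjugate to a diagonal one. -/
theorem exists_conj_eq_diagU (u : U N) : ∃ (v : U N) (x : Fin N → Circle),
    u = v * diagU N x * v⁻¹ := by
  obtain ⟨z, hz, hζ⟩ := exists_unit_notMem_spectrum (u : Matrix (Fin N) (Fin N) ℂ)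
  set M : Matrix (Fin N) (Fin N) ℂ := (u : Matrix (Fin N) (Fin N) ℂ) with hM
  have hzz : star z * z = 1 := by
    rw [Complex.star_def, mul_comm, Complex.mul_conj, Complex.normSq_eq_norm_sq, hz]
    simp
  have hu1 : star M * M = 1 := Matrix.mem_unitaryGroup_iff'.1 u.2
  set A := z • (1 : Matrix (Fin N) (Fin N) ℂ) - M with hA
  set B := z • (1 : Matrix (Fin N) (Fin N) ℂ) + M with hB
  have hstarA : star A = star z • 1 - star M := by simp [hA, star_smul]
  have hstarB : star B = star z • 1 + star M := by simp [hB, star_smul]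
  have hcomm : star A * B = -(star B * A) := by
    rw [hstarA, hstarB, hA, hB]
    have hzz' : z * star z = 1 := by rw [mul_comm, hzz]
    simp only [mul_add, add_mul, mul_sub, sub_mul, smul_mul_assoc, mul_smul_comm, one_mul, mul_one,
      hu1, smul_add, smul_sub, smul_smul, hzz', one_smul]
    abel
  have hAinv : A * A⁻¹ = 1 := Matrix.mul_nonsing_inv _ hζ
  have hAinv' : A⁻¹ * A = 1 := Matrix.nonsing_inv_mul _ hζ
  -- The Cayley transform `i (z + M)(z - M)⁻¹` is Hermitian, so the spectral theorem for Hermitian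
  -- matrices applies.
  set H := Complex.I • (B * A⁻¹) with hH
  have hHerm : H.IsHermitian := by
    have h1 : star (A⁻¹) * star A = 1 := by rw [← star_mul, hAinv, star_one]
    have h2 : star H = -Complex.I • (star A⁻¹ * star B) := by
      rw [hH, star_smul, star_mul, Complex.star_def, Complex.conj_I]
    have h3 : B * A⁻¹ = -(star A⁻¹ * star B) := by
      calc B * A⁻¹ = star (A⁻¹) * star A * (B * A⁻¹) := by rw [h1, one_mul]
        _ = star (A⁻¹) * (star A * B) * A⁻¹ := by simp only [mul_assoc]
        _ = -(star A⁻¹ * star B * (A * A⁻¹)) := by rw [hcomm]; simp [mul_assoc]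
        _ = _ := by rw [hAinv, mul_one]
    rw [Matrix.IsHermitian, ← Matrix.star_eq_conjTranspose, h2, hH, h3, smul_neg, neg_smul]
  -- The Cayley transform solved for `M`, in the form `(H + i) M = z (H - i)`.
  have hHu : H * M + Complex.I • M = z • H - (Complex.I * z) • 1 := by
    have h1 : H * A = Complex.I • B := by
      rw [hH, smul_mul_assoc, mul_assoc, hAinv', mul_one]
    rw [hA, hB, mul_sub, mul_smul_comm, mul_one, smul_add, sub_eq_iff_eq_add] at h1
    rw [h1, mul_smul]
    abel
  set V : U N := hHerm.eigenvectorUnitary with hV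
  set D : Matrix (Fin N) (Fin N) ℂ := Matrix.diagonal (RCLike.ofReal ∘ hHerm.eigenvalues) with hD
  have hspec : H = (V : Matrix (Fin N) (Fin N) ℂ) * D * star (V : Matrix (Fin N) (Fin N) ℂ) := by
    conv_lhs => rw [hHerm.spectral_theorem]
    rw [Unitary.conjStarAlgAut_apply]
  have hVV : star (V : Matrix (Fin N) (Fin N) ℂ) * V = 1 := Matrix.mem_unitaryGroup_iff'.1 V.2
  set W : Matrix (Fin N) (Fin N) ℂ := (V : Matrix (Fin N) (Fin N) ℂ) with hW
  set T : Matrix (Fin N) (Fin N) ℂ := star W * M * W with hT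
  have hDT : D * T + Complex.I • T = z • D - (Complex.I * z) • 1 := by
    have h1 : star W * (H * M + Complex.I • M) * W =
        star W * (z • H - (Complex.I * z) • 1) * W := by rw [hHu]
    rw [hspec] at h1
    simp only [mul_add, add_mul, mul_sub, sub_mul, mul_smul_comm, smul_mul_assoc, mul_one,
      hVV] at h1
    have h2 : star W * (W * D * star W * M) * W = D * T := by
      rw [hT]
      calc star W * (W * D * star W * M) * W = (star W * W) * (D * (star W * M * W)) := by
            simp only [mul_assoc]
        _ = _ := by rw [hVV, one_mul]
    have h3 : star W * (W * D * star W) * W = D := by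
      calc star W * (W * D * star W) * W = (star W * W) * D * (star W * W) := by
            simp only [mul_assoc]
        _ = _ := by rw [hVV, one_mul, mul_one]
    rw [h2, h3] at h1
    exact h1
  -- An off-diagonal entry is annihilated by `λ_a + i`, which is nonzero because the eigenvalue
  -- `λ_a` is real.
  have hoff : ∀ a b, a ≠ b → T a b = 0 := by
    intro a b hab
    have h1 := congrFun (congrFun hDT a) b
    simp only [Matrix.add_apply, Matrix.sub_apply, Matrix.smul_apply, hD, Matrix.diagonal_mul,
      Matrix.diagonal_apply_ne _ hab, Matrix.one_apply_ne hab, smul_eq_mul, mul_zero,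
      sub_zero, Function.comp_apply] at h1
    rw [← add_mul] at h1
    rcases mul_eq_zero.1 h1 with h2 | h2
    · exfalso
      have := congrArg Complex.im h2
      simp at this
    · exact h2
  have hTmem : ((V⁻¹ * u * V : U N) : Matrix (Fin N) (Fin N) ℂ) = T := by
    rw [← Unitary.star_eq_inv]
    simp [hT, hM, hW]
  have hTdiag : T = Matrix.diagonal fun i => T i i := by
    ext a b
    by_cases hab : a = b
    · subst hab; simp
    · rw [hoff a b hab, Matrix.diagonal_apply_ne _ hab]
  have hnorm (i : Fin N) : ‖T i i‖ = 1 := by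
    have h1 : star T * T = 1 := by
      rw [← hTmem]; exact Matrix.mem_unitaryGroup_iff'.1 (V⁻¹ * u * V).2
    rw [hTdiag, Matrix.star_eq_conjTranspose, Matrix.diagonal_conjTranspose,
      Matrix.diagonal_mul_diagonal] at h1
    have h2 := congrFun (congrFun h1 i) i
    simp only [Matrix.diagonal_apply_eq, Matrix.one_apply_eq, Pi.star_apply] at h2
    have h3 := congrArg norm h2
    rw [norm_mul, norm_star, norm_one] at h3
    nlinarith [norm_nonneg (T i i)]
  refine ⟨V, fun i => ⟨T i i, mem_sphere_zero_iff_norm.2 (hnorm i)⟩, ?_⟩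
  have hfin : V⁻¹ * u * V = diagU N fun i => ⟨T i i, mem_sphere_zero_iff_norm.2 (hnorm i)⟩ := by
    apply Subtype.ext
    rw [hTmem]
    exact hTdiag
  rw [← hfin]
  group

theorem exists_tr_eq_diagU (u : U N) : ∃ x : Fin N → Circle, ∀ k, tr u k = tr (diagU N x) k := by
  obtain ⟨v, x, rfl⟩ := exists_conj_eq_diagU u
  refine ⟨x, fun k => ?_⟩
  rw [tr, conj_zpow, Submonoid.coe_mul, Matrix.trace_mul_comm, ← Submonoid.coe_mul, ← mul_assoc,
    inv_mul_cancel, one_mul]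
  rfl

/-- The character `x ↦ ∏ᵢ xᵢ^mᵢ` of the torus. -/
def torusChar (m : Fin N → ℤ) : (Fin N → Circle) →* ℂ where
  toFun x := ((∏ i, x i ^ m i : Circle) : ℂ)
  map_one' := by simp
  map_mul' x y := by simp [mul_zpow, Finset.prod_mul_distrib]

theorem torusChar_apply (m : Fin N → ℤ) (x : Fin N → Circle) :
    torusChar m x = ((∏ i, x i ^ m i : Circle) : ℂ) := rfl

theorem torusChar_injective : Function.Injective (torusChar (N := N)) := by
  intro m n h
  funext i
  by_contra hne
  have hw : ((m i - n i : ℤ) : ℝ) ≠ 0 := Int.cast_ne_zero.2 (sub_ne_zero.2 hne)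
  -- At this point the quotient of the two characters is `exp (iπ) = -1`.
  have h1 := DFunLike.congr_fun h (Pi.mulSingle i (Circle.exp (Real.pi / (m i - n i : ℤ))))
  rw [torusChar_apply, torusChar_apply, Circle.coe_inj] at h1
  have hp (l : Fin N → ℤ) (w : Circle) :
      ∏ j, (Pi.mulSingle i w : Fin N → Circle) j ^ l j = w ^ l i := by
    rw [Finset.prod_eq_single i]
    · simp
    · intro j _ hj
      simp [Pi.mulSingle_eq_of_ne hj]
    · simp
  rw [hp, hp, ← div_eq_one, div_eq_mul_inv, ← zpow_sub,
    ← Circle.exp_zsmul, zsmul_eq_mul, mul_div_cancel₀ _ hw] at h1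
  have h2 := congrArg (fun z : Circle => (z : ℂ)) h1
  simp only [Circle.coe_exp, Circle.coe_one, Complex.exp_pi_mul_I] at h2
  norm_num at h2

/-- Evaluation of a Laurent polynomial at a point of the torus. -/
def evalTorus (x : Fin N → Circle) : TorusRing N →ₐ[ℂ] ℂ :=
  AddMonoidAlgebra.lift ℂ ℂ (Fin N → ℤ)
    { toFun := fun m => torusChar (Multiplicative.toAdd m) x
      map_one' := by simp [torusChar_apply]
      map_mul' := fun m n => by
        simp [torusChar_apply, zpow_add, Finset.prod_mul_distrib] }

theorem evalTorus_single (x : Fin N → Circle) (m : Fin N → ℤ) (c : ℂ) :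
    evalTorus x (AddMonoidAlgebra.single m c) = c * torusChar m x := by
  rw [evalTorus, AddMonoidAlgebra.lift_single]
  rfl

theorem evalTorus_xpow (x : Fin N → Circle) (i : Fin N) (k : ℤ) :
    evalTorus x (xpow i k) = (x i : ℂ) ^ k := by
  rw [xpow, evalTorus_single, one_mul, torusChar_apply, Finset.prod_eq_single i]
  · simp
  · intro j _ hj
    simp [Pi.single_eq_of_ne hj]
  · simp

/-- Dedekind's independence of characters, applied to the monomials. -/
theorem eq_zero_of_evalTorus (f : TorusRing N) (h : ∀ x, evalTorus x f = 0) : f = 0 := by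
  have hli : LinearIndependent ℂ fun m : Fin N → ℤ => (torusChar m : (Fin N → Circle) → ℂ) :=
    (linearIndependent_monoidHom (Fin N → Circle) ℂ).comp torusChar torusChar_injective
  rw [linearIndependent_iff] at hli
  have hf : Finsupp.linearCombination ℂ
      (fun m : Fin N → ℤ => (torusChar m : (Fin N → Circle) → ℂ)) f.coeff = 0 := by
    funext x
    rw [Pi.zero_apply, ← h x]
    clear h
    induction f using AddMonoidAlgebra.induction_linear with
    | zero => simp
    | add f g hf hg => rw [AddMonoidAlgebra.coeff_add, map_add, map_add, Pi.add_apply, hf, hg]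
    | single m c =>
      rw [AddMonoidAlgebra.coeff_single, Finsupp.linearCombination_single, evalTorus_single]
      rfl
  exact AddMonoidAlgebra.coeff_injective (hli _ hf)

theorem evalU_diagU (x : Fin N → Circle) (F : PowerSumRing) :
    evalU (diagU N x) F = evalTorus x (toTorus N F) := by
  have h : evalU (diagU N x) = (evalTorus x).comp (toTorus N) := by
    refine MvPolynomial.algHom_ext fun k => ?_
    rw [evalU_X, tr_eq, upow_diagU, Matrix.trace_diagonal, AlgHom.comp_apply, toTorus,
      MvPolynomial.aeval_X, psum, map_sum]
    simp only [evalTorus_xpow]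
  rw [h]
  rfl

/-- At a diagonal matrix the gradient is diagonal and its entries are the Euler derivatives; this
carries a vanishing gradient over to the torus. -/
theorem evalTorus_euler (x : Fin N → Circle) (a : Fin N) (F : PowerSumRing) :
    evalTorus x (euler a (toTorus N F)) = fieldU (diagU N x) (grad F) a a := by
  induction F using MvPolynomial.induction_on with
  | C c =>
    rw [grad_C, ← MvPolynomial.algebraMap_eq, AlgHom.commutes, Derivation.map_algebraMap]
    simp
  | add p q hp hq => simp only [map_add, hp, hq, Matrix.add_apply]
  | mul_X p k hp =>
    rw [fieldU_grad_mul, fieldU_grad_X, upow_diagU, map_mul, Derivation.leibniz, map_add,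
      smul_eq_mul, smul_eq_mul, map_mul, map_mul, hp, evalU_diagU, evalU_diagU]
    simp only [Matrix.add_apply, Matrix.smul_apply, smul_eq_mul, Matrix.diagonal_apply_eq]
    have hX : euler a (toTorus N (MvPolynomial.X k)) = (k : ℂ) • xpow a k := by
      rw [toTorus, MvPolynomial.aeval_X, psum, map_sum, Finset.sum_eq_single a]
      · exact euler_xpow_self a k
      · intro b _ hb
        exact euler_xpow_of_ne hb.symm k
      · simp
    rw [hX, map_smul, evalTorus_xpow, smul_eq_mul]

/-- A polynomial in power sums with vanishing gradient is constant. -/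
theorem evalU_eq_const {F : PowerSumRing} (h : ∀ u : U N, fieldU u (grad F) = 0) :
    ∃ c : ℂ, toTorus N F = algebraMap ℂ _ c ∧ ∀ u : U N, evalU u F = c := by
  have heuler (a : Fin N) : euler a (toTorus N F) = 0 :=
    eq_zero_of_evalTorus _ fun x => by rw [evalTorus_euler, h]; rfl
  -- A Laurent polynomial killed by every `xₐ ∂/∂xₐ` contains only the exponent `0`.
  have hc : toTorus N F = algebraMap ℂ _ ((toTorus N F).coeff 0) := by
    apply AddMonoidAlgebra.coeff_injective
    ext m
    rw [AddMonoidAlgebra.coe_algebraMap, Function.comp_apply, AddMonoidAlgebra.coeff_single,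
      Finsupp.single_apply]
    split_ifs with hm
    · rw [← hm]; rfl
    · obtain ⟨a, ha⟩ := Function.ne_iff.1 (Ne.symm hm)
      have := congrArg (fun f : TorusRing N => f.coeff m) (heuler a)
      rw [euler_apply] at this
      simp only [coeff_eulerLin, AddMonoidAlgebra.coeff_zero, Finsupp.zero_apply] at this
      exact (mul_eq_zero.1 this).resolve_left (Int.cast_ne_zero.2 ha)
  refine ⟨_, hc, fun u => ?_⟩
  obtain ⟨x, hx⟩ := exists_tr_eq_diagU u
  have : evalU u = evalU (diagU N x) :=
    MvPolynomial.algHom_ext fun k => by rw [evalU_X, evalU_X, hx]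
  rw [this, evalU_diagU, hc, AlgHom.commutes]
  simp

end Diagonal

/-! ### The Laplacian on class functions -/

section Laplacian

variable {N : ℕ}

/-- The Laplacian of the unitary group on polynomials in power sums. -/
def laplace (N : ℕ) : PowerSumRing →ₗ[ℂ] PowerSumRing :=
  Finsupp.lsum ℂ (loopOp N) ∘ₗ (grad : PowerSumRing →ₗ[ℂ] ℤ →₀ PowerSumRing)

theorem laplace_apply (F : PowerSumRing) :
    laplace N F = Finsupp.lsum ℂ (loopOp N) (grad F) := rfl

/-- Applied to both the Haar and the Weyl functional. -/
theorem map_laplace_eq_zero (L : PowerSumRing →ₗ[ℂ] ℂ) (hL : ∀ k F, L (loopOp N k F) = 0)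
    (F : PowerSumRing) : L (laplace N F) = 0 := by
  rw [laplace_apply]
  generalize grad F = v
  induction v using Finsupp.induction_linear with
  | zero => simp
  | add v w hv hw => rw [map_add, map_add, hv, hw, add_zero]
  | single k G => rw [Finsupp.lsum_single, hL]

/-- Green's formula: for each component `G` of the gradient it is the loop equation for `A * G`,
expanded by the product rule. -/
theorem haarFun_mul_laplace (A F : PowerSumRing) :
    haarFun N (A * laplace N F) =
      -∫ u : U N, (fieldU u (grad F) * fieldU u (grad A)).trace ∂haarU N := by
  have hcont (v : ℤ →₀ PowerSumRing) :
      Continuous fun u : U N => (fieldU u v * fieldU u (grad A)).trace :=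
    ((continuous_fieldU v).matrix_mul (continuous_fieldU _)).matrix_trace
  rw [laplace_apply]
  generalize grad F = v
  induction v using Finsupp.induction_linear with
  | zero => simp
  | add v w hv hw =>
    simp only [map_add, mul_add, add_mul, Matrix.trace_add, hv, hw]
    rw [integral_add (integrable_haarU (hcont v)) (integrable_haarU (hcont w)), neg_add]
  | single k G =>
    rw [Finsupp.lsum_single]
    have h := haarFun_loopOp (N := N) k (A * G)
    rw [loopOp_mul, map_add] at h
    rw [eq_neg_of_add_eq_zero_left h, haarFun_apply]
    congr 2
    funext u
    rw [fieldU_single, smul_mul_assoc, Matrix.trace_smul, trace_upow_mul_fieldU, map_mul,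
      smul_eq_mul, mul_comm]

/-- Complex conjugation of coefficients together with `p_k ↦ p_{-k}`. -/
def conjR : PowerSumRing →+* PowerSumRing :=
  (MvPolynomial.rename (Neg.neg : ℤ → ℤ)).toRingHom.comp (MvPolynomial.map (starRingEnd ℂ))

theorem conjR_C (c : ℂ) : conjR (MvPolynomial.C c) = MvPolynomial.C (star c) := by
  simp [conjR]

theorem conjR_X (k : ℤ) : conjR (MvPolynomial.X k) = MvPolynomial.X (-k) := by
  simp [conjR]

theorem evalU_conjR (u : U N) (F : PowerSumRing) : evalU u (conjR F) = star (evalU u F) := by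
  induction F using MvPolynomial.induction_on with
  | C c => rw [conjR_C, evalU_C, evalU_C]
  | add p q hp hq => rw [map_add, map_add, map_add, hp, hq, star_add]
  | mul_X p k hp => rw [map_mul, map_mul, map_mul, hp, conjR_X, evalU_X, evalU_X, tr_neg, star_mul']

theorem fieldU_grad_conjR (u : U N) (F : PowerSumRing) :
    fieldU u (grad (conjR F)) = -star (fieldU u (grad F)) := by
  induction F using MvPolynomial.induction_on with
  | C c => simp [conjR_C]
  | add p q hp hq => simp only [map_add, hp, hq, star_add, neg_add]
  | mul_X p k hp =>
    rw [map_mul, fieldU_grad_mul, fieldU_grad_mul, conjR_X, hp, fieldU_grad_X, fieldU_grad_X,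
      evalU_conjR, evalU_X, evalU_X, tr_neg, upow_neg, star_add, star_smul, star_smul, star_smul]
    simp only [Int.cast_neg, neg_smul, smul_neg, neg_add, Complex.star_def, map_intCast]

theorem haarFun_conjR_mul_laplace (F G : PowerSumRing) :
    haarFun N (conjR G * laplace N F) =
      ∫ u : U N, (fieldU u (grad F) * star (fieldU u (grad G))).trace ∂haarU N := by
  rw [haarFun_mul_laplace, ← integral_neg]
  congr 1
  funext u
  rw [fieldU_grad_conjR, mul_neg, Matrix.trace_neg, neg_neg]

/-- The Laplacian is Hermitian for the form `∫ conj(G) F`, because the Dirichlet form is. -/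
theorem haarFun_conjR_mul_laplace_comm (F G : PowerSumRing) :
    haarFun N (conjR F * laplace N G) = star (haarFun N (conjR G * laplace N F)) := by
  have h (u : U N) : (fieldU u (grad G) * star (fieldU u (grad F))).trace =
      starRingEnd ℂ (fieldU u (grad F) * star (fieldU u (grad G))).trace := by
    rw [starRingEnd_apply, ← Matrix.trace_conjTranspose, ← Matrix.star_eq_conjTranspose, star_mul,
      star_star]
  rw [haarFun_conjR_mul_laplace, haarFun_conjR_mul_laplace]
  simp only [h]
  exact integral_conj

theorem eq_zero_of_integral_ofReal_eq_zero {f : U N → ℝ} (hf : Continuous f) (h0 : ∀ u, 0 ≤ f u)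
    (h : ∫ u, (f u : ℂ) ∂haarU N = 0) (u : U N) : f u = 0 := by
  have h1 : ∫ u, f u ∂haarU N = 0 := by
    have := integral_ofReal (f := f) (μ := haarU N) (𝕜 := ℂ)
    rw [RCLike.ofReal_eq_complex_ofReal] at this
    rw [this] at h
    exact_mod_cast h
  have h2 : Integrable f (haarU N) :=
    hf.integrable_of_hasCompactSupport (HasCompactSupport.of_compactSpace f)
  have h3 := (integral_eq_zero_iff_of_nonneg h0 h2).1 h1
  exact congrFun ((hf.ae_eq_iff_eq (haarU N) continuous_const).1 h3) u

/-- Polynomials in power sums that vanish on the unitary group. -/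
def VanishesU (N : ℕ) (F : PowerSumRing) : Prop := ∀ u : U N, evalU u F = 0

theorem vanishesU_of_sq {F : PowerSumRing} (h : haarFun N (conjR F * F) = 0) : VanishesU N F := by
  intro u
  rw [haarFun_apply] at h
  have h1 (u : U N) : evalU u (conjR F * F) = ((Complex.normSq (evalU u F) : ℝ) : ℂ) := by
    rw [map_mul, evalU_conjR, Complex.star_def, mul_comm, Complex.mul_conj]
  simp only [h1] at h
  exact Complex.normSq_eq_zero.1 (eq_zero_of_integral_ofReal_eq_zero
    (Complex.continuous_normSq.comp (continuous_evalU F)) (fun u => Complex.normSq_nonneg _) h u)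

theorem VanishesU.haarFun_mul {F : PowerSumRing} (hF : VanishesU N F) (G : PowerSumRing) :
    haarFun N (G * F) = 0 := by
  rw [haarFun_apply]
  simp [hF _]

/-- By Hermitian symmetry the squared norm of `ΔF` is the conjugate of `⟨F, Δ²F⟩ = 0`. Vanishing is
as a function on the group, since the power sums satisfy relations there. -/
theorem VanishesU.of_laplace_laplace {F : PowerSumRing}
    (h : VanishesU N (laplace N (laplace N F))) : VanishesU N (laplace N F) := by
  apply vanishesU_of_sq
  rw [haarFun_conjR_mul_laplace_comm, h.haarFun_mul, star_zero]

/-- The Dirichlet form of `F` with itself is the integral of the squared Hilbert–Schmidt norm of its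
gradient, a continuous nonnegative function. -/
theorem VanishesU.fieldU_grad {F : PowerSumRing} (h : VanishesU N (laplace N F)) (u : U N) :
    fieldU u (grad F) = 0 := by
  have h1 := h.haarFun_mul (conjR F)
  rw [haarFun_conjR_mul_laplace] at h1
  have h2 (u : U N) : (fieldU u (grad F) * star (fieldU u (grad F))).trace =
      ((∑ i, ∑ j, Complex.normSq (fieldU u (grad F) i j) : ℝ) : ℂ) := by
    rw [Matrix.trace]
    push_cast
    refine Finset.sum_congr rfl fun i _ => ?_
    rw [Matrix.diag_apply, Matrix.mul_apply]
    refine Finset.sum_congr rfl fun j _ => ?_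
    rw [Matrix.star_apply, Complex.star_def, Complex.mul_conj]
  simp only [h2] at h1
  have h3 := eq_zero_of_integral_ofReal_eq_zero
    (continuous_finsetSum _ fun i _ => continuous_finsetSum _ fun j _ =>
      Complex.continuous_normSq.comp ((continuous_fieldU (grad F)).matrix_elem i j))
    (fun u => Finset.sum_nonneg fun i _ => Finset.sum_nonneg fun j _ => Complex.normSq_nonneg _)
    h1 u
  ext i j
  have h4 := (Finset.sum_eq_zero_iff_of_nonneg fun i _ => Finset.sum_nonneg fun j _ =>
    Complex.normSq_nonneg _).1 h3 i (Finset.mem_univ i)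
  have h5 := (Finset.sum_eq_zero_iff_of_nonneg fun j _ => Complex.normSq_nonneg _).1 h4 j
    (Finset.mem_univ j)
  exact Complex.normSq_eq_zero.1 h5

theorem VanishesU.of_laplace_pow {F : PowerSumRing} (n : ℕ)
    (h : VanishesU N ((laplace N ^ (n + 1)) F)) : VanishesU N (laplace N F) := by
  induction n with
  | zero => simpa using h
  | succ n ih =>
    apply ih
    rw [pow_succ', pow_succ', Module.End.mul_apply, Module.End.mul_apply] at h
    rw [pow_succ', Module.End.mul_apply]
    exact h.of_laplace_laplace

/-! ### The filtration by weight -/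

/-- The exponents of monomials of weight at most `d` without the variable `p_0`. -/
def weightSet (d : ℕ) : Set (ℤ →₀ ℕ) := {a | a 0 = 0 ∧ Finsupp.weight Int.natAbs a ≤ d}

/-- Excluding `p_0`, whose weight is zero, is what makes the set finite: all remaining indices and
exponents are bounded by `d`. -/
theorem weightSet_finite (d : ℕ) : (weightSet d).Finite := by
  refine (Set.finite_Iic (Finsupp.indicator (Finset.Icc (-(d : ℤ)) d) fun _ _ => d)).subset ?_
  intro a ha k
  rw [Finsupp.indicator_apply]
  by_cases hk0 : k = 0
  · subst hk0; rw [ha.1]; exact Nat.zero_le _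
  by_cases hak : a k = 0
  · rw [hak]; exact Nat.zero_le _
  have h1 : a k ≤ Finsupp.weight Int.natAbs a := Finsupp.le_weight _ (by simpa using hk0) a
  have h2 : k.natAbs ≤ Finsupp.weight Int.natAbs a := Finsupp.le_weight_of_ne_zero' _ hak
  have h3 := ha.2
  rw [dif_pos (by rw [Finset.mem_Icc]; omega)]
  omega

/-- Polynomials in power sums of weight at most `d`. -/
def weightFilt (d : ℕ) : Submodule ℂ PowerSumRing :=
  Submodule.span ℂ ((fun a => MvPolynomial.monomial a (1 : ℂ)) '' weightSet d)

instance instFiniteWeightFilt (d : ℕ) : FiniteDimensional ℂ (weightFilt d) :=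
  FiniteDimensional.span_of_finite ℂ ((weightSet_finite d).image _)

theorem monomial_mem_weightFilt {d : ℕ} {a : ℤ →₀ ℕ} (ha : a ∈ weightSet d) (c : ℂ) :
    MvPolynomial.monomial a c ∈ weightFilt d := by
  have h : MvPolynomial.monomial a c = c • MvPolynomial.monomial a (1 : ℂ) := by
    rw [MvPolynomial.smul_monomial, smul_eq_mul, mul_one]
  rw [h]
  exact Submodule.smul_mem _ _ (Submodule.subset_span ⟨a, ha, rfl⟩)

theorem weightFilt_mono {d e : ℕ} (h : d ≤ e) : weightFilt d ≤ weightFilt e :=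
  Submodule.span_mono (Set.image_mono fun _ ha => ⟨ha.1, ha.2.trans h⟩)

theorem mul_mem_weightFilt {d e : ℕ} {F G : PowerSumRing} (hF : F ∈ weightFilt d)
    (hG : G ∈ weightFilt e) : F * G ∈ weightFilt (d + e) := by
  have h := Submodule.mul_mem_mul hF hG
  rw [weightFilt, weightFilt, Submodule.span_mul_span] at h
  refine (Submodule.span_le.2 ?_) h
  rintro _ ⟨_, ⟨a, ha, rfl⟩, _, ⟨b, hb, rfl⟩, rfl⟩
  simp only [MvPolynomial.monomial_mul]
  refine monomial_mem_weightFilt ⟨?_, ?_⟩ _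
  · simp [ha.1, hb.1]
  · rw [map_add]; exact add_le_add ha.2 hb.2

theorem X_mem_weightFilt {k : ℤ} (hk : k ≠ 0) : MvPolynomial.X k ∈ weightFilt k.natAbs := by
  refine monomial_mem_weightFilt ⟨?_, ?_⟩ _
  · rw [Finsupp.single_apply, if_neg hk]
  · rw [Finsupp.weight_single, one_smul]

theorem C_mem_weightFilt (c : ℂ) (d : ℕ) : MvPolynomial.C c ∈ weightFilt d :=
  monomial_mem_weightFilt ⟨by simp, by simp⟩ c

theorem pvar_mem_weightFilt (N : ℕ) (k : ℤ) : pvar N k ∈ weightFilt k.natAbs := by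
  unfold pvar
  split_ifs with h
  · exact C_mem_weightFilt _ _
  · exact X_mem_weightFilt h

/-- Vector fields of weight at most `d`. -/
def fieldFilt (d : ℕ) : Submodule ℂ (ℤ →₀ PowerSumRing) :=
  Submodule.span ℂ {v | ∃ k e G, G ∈ weightFilt e ∧ e + k.natAbs ≤ d ∧ v = Finsupp.single k G}

theorem grad_mem_fieldFilt {d : ℕ} {F : PowerSumRing} (hF : F ∈ weightFilt d) :
    grad F ∈ fieldFilt d := by
  induction hF using Submodule.span_induction with
  | zero => simp
  | add x y _ _ hx hy => rw [map_add]; exact Submodule.add_mem _ hx hy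
  | smul c x _ hx => rw [Derivation.map_smul]; exact Submodule.smul_mem _ _ hx
  | mem x hx =>
    obtain ⟨a, ha, rfl⟩ := hx
    simp only [grad]
    rw [MvPolynomial.mkDerivation_monomial, one_smul]
    refine Submodule.sum_mem _ fun k hk => ?_
    beta_reduce
    rw [Finsupp.smul_single, smul_eq_mul]
    have hak : a k ≠ 0 := Finsupp.mem_support_iff.1 hk
    have hw := Finsupp.weight_sub_single_add (w := Int.natAbs) hak
    refine Submodule.subset_span ⟨k, Finsupp.weight Int.natAbs (a - Finsupp.single k 1), _, ?_, ?_,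
      rfl⟩
    · rw [← add_zero (Finsupp.weight Int.natAbs _)]
      refine mul_mem_weightFilt (monomial_mem_weightFilt ⟨?_, le_rfl⟩ _) (C_mem_weightFilt _ _)
      rw [Finsupp.tsub_apply, ha.1, Nat.zero_sub]
    · rw [hw]; exact ha.2

theorem shiftDer_mem_weightFilt {d : ℕ} {F : PowerSumRing} (hF : F ∈ weightFilt d) (k : ℤ) :
    shiftDer N k F ∈ weightFilt (d + k.natAbs) := by
  rw [shiftDer_eq]
  have hv := grad_mem_fieldFilt hF
  generalize grad F = v at hv
  have hlin : (v.sum fun l G => G * pvar N (k + l)) =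
      Finsupp.lsum ℂ (fun l => LinearMap.mulRight ℂ (pvar N (k + l))) v := by
    simp only [Finsupp.lsum_apply]; rfl
  rw [hlin]
  clear hlin
  induction hv using Submodule.span_induction with
  | zero => simp
  | add x y _ _ hx hy => rw [map_add]; exact Submodule.add_mem _ hx hy
  | smul c x _ hx => rw [map_smul]; exact Submodule.smul_mem _ _ hx
  | mem x hx =>
    obtain ⟨l, e, G, hG, he, rfl⟩ := hx
    rw [Finsupp.lsum_single, LinearMap.mulRight_apply]
    exact weightFilt_mono (by omega) (mul_mem_weightFilt hG (pvar_mem_weightFilt N (k + l)))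

/-- In the quadratic term `j` lies between `0` and `k`, so `|j| + |k - j| = |k|`. -/
theorem loopOp_mem_weightFilt {d : ℕ} {F : PowerSumRing} (hF : F ∈ weightFilt d) (k : ℤ) :
    loopOp N k F ∈ weightFilt (d + k.natAbs) := by
  rw [loopOp_apply]
  refine Submodule.add_mem _ (shiftDer_mem_weightFilt hF k) ?_
  rw [add_comm]
  refine mul_mem_weightFilt ?_ hF
  have h (j : ℤ) (hj : j.natAbs + (k - j).natAbs = k.natAbs) :
      pvar N j * pvar N (k - j) ∈ weightFilt k.natAbs := by
    rw [← hj]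
    exact mul_mem_weightFilt (pvar_mem_weightFilt N j) (pvar_mem_weightFilt N _)
  refine Submodule.sub_mem _ (Submodule.sum_mem _ fun j hj => h j ?_)
    (Submodule.sum_mem _ fun j hj => h j ?_) <;>
  · rw [Finset.mem_Ico] at hj
    omega

/-- The `k`-th gradient component loses weight `|k|`, and `loopOp N k` restores at most that much.
-/
theorem laplace_mem_weightFilt {d : ℕ} {F : PowerSumRing} (hF : F ∈ weightFilt d) :
    laplace N F ∈ weightFilt d := by
  rw [laplace_apply]
  have hv := grad_mem_fieldFilt hF
  generalize grad F = v at hv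
  induction hv using Submodule.span_induction with
  | zero => simp
  | add x y _ _ hx hy => rw [map_add]; exact Submodule.add_mem _ hx hy
  | smul c x _ hx => rw [map_smul]; exact Submodule.smul_mem _ _ hx
  | mem x hx =>
    obtain ⟨k, e, G, hG, he, rfl⟩ := hx
    rw [Finsupp.lsum_single]
    exact weightFilt_mono he (loopOp_mem_weightFilt hG k)

/-- The Weyl integration formula for polynomials in power sums. -/
theorem haarFun_eq_weylFun {d : ℕ} {F : PowerSumRing} (hF : F ∈ weightFilt d) :
    haarFun N F = weylFun N F := by
  let T : Module.End ℂ (weightFilt d) :=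
    (laplace N).restrict fun F hF => laplace_mem_weightFilt hF
  -- Fitting decomposition of a finite-dimensional space. The power `n + 1` is used because it is
  -- positive, so that its range lies in the image of the Laplacian.
  obtain ⟨n, hn⟩ := Filter.eventually_atTop.1 T.eventually_isCompl_ker_pow_range_pow
  have hcompl := hn (n + 1) (Nat.le_succ n)
  have htop : (⟨F, hF⟩ : weightFilt d) ∈ LinearMap.ker (T ^ (n + 1)) ⊔
      LinearMap.range (T ^ (n + 1)) := by
    rw [hcompl.sup_eq_top]; trivial
  obtain ⟨F₁, h₁, F₂, h₂, h₁₂⟩ := Submodule.mem_sup.1 htop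
  have hFsum : F = F₁ + F₂ := congrArg Subtype.val h₁₂.symm
  have hpow (m : ℕ) (G : weightFilt d) : ((T ^ m) G : PowerSumRing) = (laplace N ^ m) G := by
    induction m with
    | zero => simp
    | succ m ih => rw [pow_succ', pow_succ', Module.End.mul_apply, Module.End.mul_apply, ← ih]; rfl
  have hF₂ : haarFun N F₂ = weylFun N F₂ := by
    obtain ⟨G, hG⟩ := h₂
    rw [pow_succ', Module.End.mul_apply] at hG
    have hG' : (F₂ : PowerSumRing) = laplace N ((T ^ n) G : weightFilt d) := by
      rw [← hG]; rfl
    rw [hG', map_laplace_eq_zero _ haarFun_loopOp, map_laplace_eq_zero _ weylFun_loopOp]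
  have hF₁ : haarFun N F₁ = weylFun N F₁ := by
    have h0 : (laplace N ^ (n + 1)) (F₁ : PowerSumRing) = 0 := by
      rw [← hpow, LinearMap.mem_ker.1 h₁]; rfl
    -- On the generalized kernel, positivity forces `F₁` to be constant, and both functionals send
    -- `1` to `1`.
    have hvan : VanishesU N (laplace N F₁) :=
      VanishesU.of_laplace_pow n fun u => by rw [h0, map_zero]
    obtain ⟨c, hc, hcu⟩ := evalU_eq_const hvan.fieldU_grad
    have hw : weylFun N F₁ = c := by
      have h1 : toTorus N F₁ = toTorus N (MvPolynomial.C c) := by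
        rw [hc, ← MvPolynomial.algebraMap_eq, AlgHom.commutes]
      rw [weylFun_apply, h1, ← weylFun_apply, ← mul_one (MvPolynomial.C c), ← MvPolynomial.smul_eq_C_mul,
        map_smul, weylFun_one, smul_eq_mul, mul_one]
    rw [hw, haarFun_apply]
    simp [hcu]
  rw [hFsum, map_add, map_add, hF₁, hF₂]

end Laplacian

/-! ### Power series over Laurent polynomials -/

/-- The ring of power series in `t⁺, t⁻` whose coefficients are Laurent polynomials in `z`. -/
abbrev LoopSeries : Type := MvPowerSeries TVar (LaurentPolynomial ℂ)

/-- The coefficient of `zⁿ`. -/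
def zc (n : ℤ) : LoopSeries →+ MvPowerSeries TVar ℂ where
  toFun h := fun d => (coeff d h).coeff n
  map_zero' := by ext d; rfl
  map_add' _ _ := by ext d; rfl

theorem coeff_zc (n : ℤ) (h : LoopSeries) (d : TVar →₀ ℕ) :
    coeff d (zc n h) = (coeff d h).coeff n := rfl

theorem zc_ext {g h : LoopSeries} (H : ∀ n, zc n g = zc n h) : g = h := by
  ext d n
  rw [← coeff_zc, H, coeff_zc]

/-- The projection to nonnegative powers of `z`. -/
def posProj : LoopSeries →+ LoopSeries where
  toFun h := fun d => AddMonoidAlgebra.ofCoeff ((coeff d h).coeff.filter fun n => 0 ≤ n)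
  map_zero' := by
    ext d n
    change ((0 : LaurentPolynomial ℂ).coeff.filter fun n => 0 ≤ n) n = 0
    rw [Finsupp.filter_apply]
    split_ifs <;> rfl
  map_add' g h := by
    ext d n
    change ((coeff d (g + h)).coeff.filter fun n => 0 ≤ n) n =
      ((coeff d g).coeff.filter fun n => 0 ≤ n) n + ((coeff d h).coeff.filter fun n => 0 ≤ n) n
    rw [map_add, AddMonoidAlgebra.coeff_add, Finsupp.filter_add, Finsupp.add_apply]

theorem zc_posProj (n : ℤ) (h : LoopSeries) :
    zc n (posProj h) = if 0 ≤ n then zc n h else 0 := by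
  ext d
  change ((coeff d h).coeff.filter fun n => 0 ≤ n) n = _
  rw [Finsupp.filter_apply]
  split_ifs <;> rfl

/-- The inclusion of the series that do not involve `z`. -/
def constLoop : MvPowerSeries TVar ℂ →+* LoopSeries := MvPowerSeries.map LaurentPolynomial.C

theorem zc_constLoop_mul (n : ℤ) (r : MvPowerSeries TVar ℂ) (h : LoopSeries) :
    zc n (constLoop r * h) = r * zc n h := by
  classical
  ext d
  rw [coeff_zc, coeff_mul, coeff_mul, AddMonoidAlgebra.coeff_sum, Finsupp.finsetSum_apply]
  refine Finset.sum_congr rfl fun p _ => ?_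
  rw [constLoop, coeff_map, ← LaurentPolynomial.smul_eq_C_mul, AddMonoidAlgebra.coeff_smul_apply,
    coeff_zc, smul_eq_mul]

theorem posProj_constLoop_mul (r : MvPowerSeries TVar ℂ) (h : LoopSeries) :
    posProj (constLoop r * h) = constLoop r * posProj h := by
  refine zc_ext fun n => ?_
  rw [zc_posProj, zc_constLoop_mul, zc_constLoop_mul, zc_posProj]
  split_ifs <;> simp

/-- The monomial `zⁿ`. -/
def zpw (n : ℤ) : LoopSeries := C (LaurentPolynomial.T n)

theorem zc_mul_zpw (n m : ℤ) (h : LoopSeries) : zc n (h * zpw m) = zc (n - m) h := by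
  ext d
  rw [coeff_zc, zpw, coeff_mul_C, coeff_zc, LaurentPolynomial.T]
  have := AddMonoidAlgebra.coeff_mul_single_apply (coeff d h) (1 : ℂ) m n
  simpa [sub_eq_add_neg] using this

theorem zc_one (n : ℤ) : zc n 1 = if n = 0 then 1 else 0 := by
  classical
  ext d
  rw [coeff_zc, coeff_one]
  by_cases hd : d = 0
  · by_cases hn : n = 0
    · rw [if_pos hd, if_pos hn, hn, hd, coeff_zero_one, AddMonoidAlgebra.one_def]
      exact Finsupp.single_eq_same
    · rw [if_pos hd, if_neg hn, map_zero, AddMonoidAlgebra.one_def]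
      exact Finsupp.single_eq_of_ne hn
  · split_ifs <;> simp [hd, coeff_one]

theorem zc_zpw (n m : ℤ) : zc n (zpw m) = if n = m then 1 else 0 := by
  rw [← one_mul (zpw m), zc_mul_zpw, zc_one]
  simp only [sub_eq_zero]

/-- The powers of `z` that occur in `h` lie in `S`. -/
def ZSupp (S : Set ℤ) (h : LoopSeries) : Prop := ∀ n, n ∉ S → zc n h = 0

theorem ZSupp.mul {S T V : Set ℤ} {g h : LoopSeries} (hg : ZSupp S g) (hh : ZSupp T h)
    (hV : ∀ a ∈ S, ∀ b ∈ T, a + b ∈ V) : ZSupp V (g * h) := by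
  classical
  intro n hn
  ext d
  rw [coeff_zc, coeff_mul, AddMonoidAlgebra.coeff_sum, Finsupp.finsetSum_apply]
  refine Finset.sum_eq_zero fun p _ => ?_
  by_contra hne
  have h1 := AddMonoidAlgebra.support_coeff_mul_subset (coeff p.1 g) (coeff p.2 h)
    (Finsupp.mem_support_iff.2 hne)
  obtain ⟨a, ha, b, hb, hab⟩ := Finset.mem_add.1 h1
  rw [Finsupp.mem_support_iff, ← coeff_zc] at ha hb
  have haS : a ∈ S := by
    by_contra h; exact ha (by rw [hg a h]; rfl)
  have hbT : b ∈ T := by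
    by_contra h; exact hb (by rw [hh b h]; rfl)
  exact hn (hab ▸ hV a haS b hbT)

theorem ZSupp.posProj_eq {h : LoopSeries} (hh : ZSupp (Set.Ici 0) h) : posProj h = h := by
  refine zc_ext fun n => ?_
  rw [zc_posProj]
  split_ifs with hn
  · rfl
  · exact (hh n hn).symm

theorem ZSupp.posProj_eq_zero {h : LoopSeries} (hh : ZSupp (Set.Iio 0) h) : posProj h = 0 := by
  refine zc_ext fun n => ?_
  rw [zc_posProj, map_zero]
  split_ifs with hn
  · exact hh n (by simpa using hn)
  · rfl

theorem zSupp_posProj (h : LoopSeries) : ZSupp (Set.Ici 0) (posProj h) := by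
  intro n hn
  rw [zc_posProj]
  exact if_neg hn

theorem zSupp_sub_posProj (h : LoopSeries) : ZSupp (Set.Iio 0) (h - posProj h) := by
  intro n hn
  rw [map_sub, zc_posProj, if_pos (by simpa using hn), sub_self]

/-- Multiplication by nonpositive powers keeps the negative part negative, so an inner projection
may be dropped. -/
theorem ZSupp.posProj_mul_posProj {g : LoopSeries} (hg : ZSupp (Set.Iic 0) g) (h : LoopSeries) :
    posProj (g * posProj h) = posProj (g * h) := by
  have h1 : ZSupp (Set.Iio 0) (g * (h - posProj h)) :=
    hg.mul (zSupp_sub_posProj h) fun a ha b hb => by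
      simp only [Set.mem_Iic, Set.mem_Iio] at *; omega
  have h2 := h1.posProj_eq_zero
  rw [mul_sub, map_sub, sub_eq_zero] at h2
  exact h2.symm

theorem zSupp_zpw (n : ℤ) {S : Set ℤ} (h : n ∈ S) : ZSupp S (zpw n) := by
  intro m hm
  rw [zc_zpw, if_neg]
  rintro rfl
  exact hm h

theorem ZSupp.mul_Ici_zero {g h : LoopSeries} (hg : ZSupp (Set.Ici 0) g)
    {M : ℤ} (hh : ZSupp (Set.Ici M) h) : ZSupp (Set.Ici M) (g * h) :=
  hg.mul hh fun a ha b hb => by simp only [Set.mem_Ici] at *; omega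

theorem zc_sum_constLoop_mul_zpw (M : ℕ) (f : ℕ → MvPowerSeries TVar ℂ) (n : ℤ) :
    zc n (∑ l ∈ Finset.range M, constLoop (f l) * zpw l) =
      if 0 ≤ n ∧ n < M then f n.toNat else 0 := by
  rw [map_sum]
  simp only [zc_constLoop_mul, zc_zpw]
  split_ifs with h
  · rw [Finset.sum_eq_single n.toNat]
    · rw [if_pos (by omega), mul_one]
    · intro l _ hl
      rw [if_neg (by omega), mul_zero]
    · intro hn
      exact absurd (Finset.mem_range.2 (by omega)) hn
  · refine Finset.sum_eq_zero fun l hl => ?_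
    rw [Finset.mem_range] at hl
    rw [if_neg (by omega), mul_zero]

theorem ZSupp.eq_sum {h : LoopSeries} {M : ℕ} (hh : ZSupp (Set.Ico 0 M) h) :
    h = ∑ l ∈ Finset.range M, constLoop (zc l h) * zpw l := by
  refine zc_ext fun n => ?_
  rw [zc_sum_constLoop_mul_zpw M (fun l => zc l h)]
  split_ifs with hn
  · rw [Int.toNat_of_nonneg hn.1]
  · exact hh n hn

/-! ### The symbols -/

/-- The exponential of `∑ᵥ cᵥ z^{charge v} tᵥ`. -/
def loopExp (c : TVar → ℂ) : LoopSeries :=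
  linExp fun v => c v • LaurentPolynomial.T (chargeVar v)

theorem loopExp_add (c c' : TVar → ℂ) : loopExp (c + c') = loopExp c * loopExp c' := by
  rw [loopExp, loopExp, loopExp, ← linExp_add]
  congr 1
  funext v
  rw [Pi.add_apply, Pi.add_apply, add_smul]

theorem loopExp_zero : loopExp 0 = 1 := by
  rw [loopExp, ← linExp_zero]
  congr 1
  funext v
  simp

theorem coeff_linExp_zpow {A : Type*} [CommRing A] [Algebra ℂ A] (x : Aˣ) (c : TVar → ℂ)
    (d : TVar →₀ ℕ) :
    coeff d (linExp fun v => c v • ((x ^ chargeVar v : Aˣ) : A)) =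
      coeff d (linExp c) • ((x ^ charge d : Aˣ) : A) := by
  rw [coeff_linExp_smul, charge_apply]
  congr 1
  have h (s : Finset TVar) : ∏ v ∈ s, ((x ^ chargeVar v : Aˣ) : A) ^ d v =
      ((x ^ (∑ v ∈ s, d v • chargeVar v) : Aˣ) : A) := by
    classical
    induction s using Finset.induction_on with
    | empty => simp
    | insert v s hv ih =>
      rw [Finset.prod_insert hv, Finset.sum_insert hv, ih, zpow_add, Units.val_mul, nsmul_eq_mul,
        mul_comm (d v : ℤ), zpow_mul, zpow_natCast, Units.val_pow_eq_pow_val]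
  exact h _

theorem coeff_loopExp (c : TVar → ℂ) (d : TVar →₀ ℕ) :
    coeff d (loopExp c) = coeff d (linExp c) • LaurentPolynomial.T (charge d) := by
  rw [loopExp, coeff_linExp_smul, charge_apply]
  congr 1
  have h (s : Finset TVar) : ∏ v ∈ s, LaurentPolynomial.T (R := ℂ) (chargeVar v) ^ d v =
      LaurentPolynomial.T (∑ v ∈ s, d v • chargeVar v) := by
    classical
    induction s using Finset.induction_on with
    | empty => simp
    | insert v s hv ih =>
      rw [Finset.prod_insert hv, Finset.sum_insert hv, ih, LaurentPolynomial.T_add,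
        LaurentPolynomial.T_pow, nsmul_eq_mul]
  exact h _

theorem zc_loopExp (n : ℤ) (c : TVar → ℂ) : zc n (loopExp c) = chargeComp n (linExp c) := by
  ext d
  rw [coeff_zc, coeff_loopExp, AddMonoidAlgebra.coeff_smul_apply, LaurentPolynomial.T_apply,
    coeff_chargeComp, smul_eq_mul]
  split_ifs <;> simp

/-- The coefficients `1/k` at `t⁺ₖ`. -/
def plusCoeff : TVar → ℂ := Sum.elim (fun k => 1 / (k : ℂ)) 0

/-- The coefficients `1/k` at `t⁻ₖ`. -/
def minusCoeff : TVar → ℂ := Sum.elim 0 fun k => 1 / (k : ℂ)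

/-- The degree of a monomial in the variables `t⁺`. -/
def plusDeg : (TVar →₀ ℕ) →+ ℕ := Finsupp.weight (Sum.elim (fun k : ℕ+ => (k : ℕ)) fun _ => 0)

theorem charge_le_plusDeg (d : TVar →₀ ℕ) : charge d ≤ plusDeg d := by
  rw [charge_apply, plusDeg, Finsupp.weight_apply, Finsupp.sum, Finsupp.sum, Nat.cast_sum]
  refine Finset.sum_le_sum fun v _ => ?_
  cases v with
  | inl k => simp [chargeVar]
  | inr k =>
    simp only [chargeVar, Sum.elim_inr, nsmul_eq_mul, smul_zero, Nat.cast_zero]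
    exact mul_nonpos_of_nonneg_of_nonpos (by positivity) (by simp)

theorem coeff_linExp_eq_zero {c : TVar → ℂ} {d : TVar →₀ ℕ} {v : TVar} (hc : c v = 0)
    (hv : d v ≠ 0) : coeff d (linExp c) = 0 := by
  rw [coeff_linExp]
  refine Finset.prod_eq_zero (Finsupp.mem_support_iff.2 hv) ?_
  beta_reduce
  rw [hc, zero_pow hv, smul_zero]

/-- Only the variables `t⁺` occur, and each has positive charge. This makes the corresponding
Toeplitz matrix triangular with ones on the diagonal. -/
theorem plusCoeff_charge {c : TVar → ℂ} (hc : ∀ k, c (Sum.inr k) = 0) {d : TVar →₀ ℕ}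
    (hd : coeff d (linExp c) ≠ 0) : 0 ≤ charge d ∧ (charge d = 0 → d = 0) := by
  have h0 (k : ℕ+) : d (Sum.inr k) = 0 := by
    by_contra h; exact hd (coeff_linExp_eq_zero (hc k) h)
  have hnn : ∀ v ∈ d.support, 0 ≤ d v • chargeVar v := by
    intro v hv
    cases v with
    | inl k => simp only [chargeVar, Sum.elim_inl]; positivity
    | inr k => rw [h0]; simp
  rw [charge_apply, Finsupp.sum]
  refine ⟨Finset.sum_nonneg hnn, fun h => ?_⟩
  rw [Finset.sum_eq_zero_iff_of_nonneg hnn] at h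
  ext v
  cases v with
  | inl k =>
    by_contra hk
    have := h (Sum.inl k) (Finsupp.mem_support_iff.2 hk)
    simp only [chargeVar, Sum.elim_inl, nsmul_eq_mul, mul_eq_zero, Nat.cast_eq_zero] at this
    rcases this with h | h
    · exact hk h
    · exact k.ne_zero (by exact_mod_cast h)
  | inr k => exact h0 k

theorem minusCoeff_charge {c : TVar → ℂ} (hc : ∀ k, c (Sum.inl k) = 0) {d : TVar →₀ ℕ}
    (hd : coeff d (linExp c) ≠ 0) : charge d ≤ 0 ∧ (charge d = 0 → d = 0) := by
  have h0 (k : ℕ+) : d (Sum.inl k) = 0 := by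
    by_contra h; exact hd (coeff_linExp_eq_zero (hc k) h)
  have hnn : ∀ v ∈ d.support, d v • chargeVar v ≤ 0 := by
    intro v hv
    cases v with
    | inl k => rw [h0]; simp
    | inr k =>
      simp only [chargeVar, Sum.elim_inr, smul_neg, Left.neg_nonpos_iff]; positivity
  rw [charge_apply, Finsupp.sum]
  refine ⟨Finset.sum_nonpos hnn, fun h => ?_⟩
  rw [Finset.sum_eq_zero_iff_of_nonpos hnn] at h
  ext v
  cases v with
  | inl k => exact h0 k
  | inr k =>
    by_contra hk
    have := h (Sum.inr k) (Finsupp.mem_support_iff.2 hk)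
    simp only [chargeVar, Sum.elim_inr, nsmul_eq_mul, mul_eq_zero, Nat.cast_eq_zero,
      neg_eq_zero] at this
    rcases this with h | h
    · exact hk h
    · exact k.ne_zero (by exact_mod_cast h)

theorem chargeComp_zero_of {c : TVar → ℂ}
    (h : ∀ d, coeff d (linExp c) ≠ 0 → charge d = 0 → d = 0) :
    chargeComp 0 (linExp c) = 1 := by
  classical
  ext d
  rw [coeff_chargeComp, coeff_one]
  by_cases hd : d = 0
  · rw [hd, map_zero, if_pos rfl, if_pos rfl, coeff_zero_eq_constantCoeff_apply,
      constantCoeff_linExp]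
  · rw [if_neg hd]
    split_ifs with h0
    · by_contra hne; exact hd (h d hne h0)
    · rfl

theorem zSupp_loopExp {c : TVar → ℂ} {S : Set ℤ}
    (h : ∀ d, coeff d (linExp c) ≠ 0 → charge d ∈ S) : ZSupp S (loopExp c) := by
  intro n hn
  ext d
  rw [zc_loopExp, coeff_chargeComp, map_zero]
  split_ifs with hd
  · by_contra hne; exact hn (hd ▸ h d hne)
  · rfl

/-! ### The ideals of series of large degree in `t⁺` -/

/-- The ideal of power series all of whose monomials have degree greater than `M` in `t⁺`. -/
def plusIdeal (A : Type*) [CommRing A] (M : ℕ) : Ideal (MvPowerSeries TVar A) where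
  carrier := {f | ∀ d, plusDeg d ≤ M → coeff d f = 0}
  zero_mem' := fun d _ => by simp
  add_mem' := fun hf hg d hd => by rw [map_add, hf d hd, hg d hd, add_zero]
  smul_mem' := fun c f hf d hd => by
    classical
    rw [smul_eq_mul, coeff_mul]
    refine Finset.sum_eq_zero fun p hp => ?_
    rw [hf p.2 ?_, mul_zero]
    rw [← Finset.HasAntidiagonal.mem_antidiagonal.1 hp, map_add] at hd
    omega

theorem plusIdeal_anti {A : Type*} [CommRing A] {M M' : ℕ} (h : M ≤ M') :
    plusIdeal A M' ≤ plusIdeal A M := fun _ hf d hd => hf d (hd.trans h)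

theorem mem_plusIdeal_iff_zc {M : ℕ} {h : LoopSeries} :
    h ∈ plusIdeal (LaurentPolynomial ℂ) M ↔ ∀ n, zc n h ∈ plusIdeal ℂ M := by
  constructor
  · intro hh n d hd
    rw [coeff_zc, hh d hd]; rfl
  · intro hh d hd
    ext n
    rw [← coeff_zc, hh n d hd]; rfl

theorem posProj_mem_plusIdeal {M : ℕ} {h : LoopSeries}
    (hh : h ∈ plusIdeal (LaurentPolynomial ℂ) M) :
    posProj h ∈ plusIdeal (LaurentPolynomial ℂ) M := by
  rw [mem_plusIdeal_iff_zc] at hh ⊢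
  intro n
  rw [zc_posProj]
  split_ifs
  · exact hh n
  · exact zero_mem _

/-! ### The Borodin–Okounkov identity -/

/-- The coefficients of `J`. -/
def twistCoeff : TVar → ℂ := plusCoeff - minusCoeff

/-- The symbol `ψ` of the Toeplitz determinants. -/
def toeplitzCoeff : TVar → ℂ := -(plusCoeff + minusCoeff)

theorem zSupp_loopExp_plus : ZSupp (Set.Ici 0) (loopExp plusCoeff) :=
  zSupp_loopExp fun _ hd => (plusCoeff_charge (fun _ => rfl) hd).1

theorem zSupp_loopExp_neg_plus : ZSupp (Set.Ici 0) (loopExp (-plusCoeff)) :=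
  zSupp_loopExp fun _ hd => (plusCoeff_charge (fun _ => neg_zero) hd).1

theorem zSupp_loopExp_minus : ZSupp (Set.Iic 0) (loopExp minusCoeff) :=
  zSupp_loopExp fun _ hd => (minusCoeff_charge (fun _ => rfl) hd).1

theorem zSupp_loopExp_neg_minus : ZSupp (Set.Iic 0) (loopExp (-minusCoeff)) :=
  zSupp_loopExp fun _ hd => (minusCoeff_charge (fun _ => neg_zero) hd).1

/-- The Toeplitz operator with symbol `ψ`, multiplied by triangular Toeplitz operators. -/
def toeplitzOp (h : LoopSeries) : LoopSeries :=
  posProj (loopExp plusCoeff * posProj (loopExp toeplitzCoeff * posProj (loopExp minusCoeff * h)))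

/-- The projection to nonnegative powers of `z`, conjugated by `J`. -/
def twistProj (h : LoopSeries) : LoopSeries :=
  loopExp twistCoeff * posProj (loopExp (-twistCoeff) * h)

theorem toeplitzOp_add (g h : LoopSeries) : toeplitzOp (g + h) = toeplitzOp g + toeplitzOp h := by
  simp only [toeplitzOp, mul_add, map_add]

theorem toeplitzOp_constLoop_mul (r : MvPowerSeries TVar ℂ) (h : LoopSeries) :
    toeplitzOp (constLoop r * h) = constLoop r * toeplitzOp h := by
  simp only [toeplitzOp, mul_left_comm _ (constLoop r), posProj_constLoop_mul]

theorem toeplitzOp_sum {ι : Type*} (s : Finset ι) (f : ι → LoopSeries) :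
    toeplitzOp (∑ i ∈ s, f i) = ∑ i ∈ s, toeplitzOp (f i) := by
  simp only [toeplitzOp, Finset.mul_sum, map_sum]

theorem toeplitzOp_mem_plusIdeal {M : ℕ} {h : LoopSeries}
    (hh : h ∈ plusIdeal (LaurentPolynomial ℂ) M) :
    toeplitzOp h ∈ plusIdeal (LaurentPolynomial ℂ) M :=
  posProj_mem_plusIdeal (Ideal.mul_mem_left _ _ (posProj_mem_plusIdeal (Ideal.mul_mem_left _ _
    (posProj_mem_plusIdeal (Ideal.mul_mem_left _ _ hh)))))

/-- Write `p`, `m` for the exponentials of the plus and minus parts, so that `J = p/m` and the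
symbol is `1/(p m)`. The factors cancel one after the other: `m J = p`, `p · 1/(p m) = 1/m`, `(1/m)
J⁻¹ = 1/p`, `p · 1/p = 1`. At each stage the projections are harmless, since `p` preserves
nonnegative modes and `m` negative ones. -/
theorem toeplitzOp_twistProj {b : LoopSeries} (hb : ZSupp (Set.Ici 0) b) :
    toeplitzOp (posProj (twistProj b)) = b := by
  set x := posProj (loopExp (-twistCoeff) * b) with hx
  have hxp : ZSupp (Set.Ici 0) x := zSupp_posProj _
  have h1 : posProj (loopExp minusCoeff * posProj (loopExp twistCoeff * x)) =
      loopExp plusCoeff * x := by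
    rw [zSupp_loopExp_minus.posProj_mul_posProj, ← mul_assoc, ← loopExp_add]
    rw [show minusCoeff + twistCoeff = plusCoeff by rw [twistCoeff]; ring]
    exact (zSupp_loopExp_plus.mul_Ici_zero hxp).posProj_eq
  have h2 : posProj (loopExp toeplitzCoeff * (loopExp plusCoeff * x)) =
      loopExp (-plusCoeff) * b := by
    rw [← mul_assoc, ← loopExp_add,
      show toeplitzCoeff + plusCoeff = -minusCoeff by rw [toeplitzCoeff]; ring, hx,
      zSupp_loopExp_neg_minus.posProj_mul_posProj, ← mul_assoc, ← loopExp_add,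
      show -minusCoeff + -twistCoeff = -plusCoeff by rw [twistCoeff]; ring]
    exact (zSupp_loopExp_neg_plus.mul_Ici_zero hb).posProj_eq
  rw [toeplitzOp, twistProj, ← hx, h1, h2, ← mul_assoc, ← loopExp_add, add_neg_cancel,
    loopExp_zero, one_mul]
  exact hb.posProj_eq

/-- The entries of the operator `toeplitzOp`. -/
def toeplitzEntry (i j : ℤ) : MvPowerSeries TVar ℂ := zc i (toeplitzOp (zpw j))

/-- The kernel `K̃(a + 1/2, b + 1/2)`. -/
def kern (a b : ℤ) : MvPowerSeries TVar ℂ := zc a (zpw b - twistProj (zpw b))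

/-- The kernel is that of `J (1 - P) J⁻¹`, with `P` the projection to nonnegative modes. The
condition `charge p.2 + b < 0` says that `J⁻¹` has moved mode `b` to a negative mode. -/
theorem coeff_kern (a b : ℤ) (d : TVar →₀ ℕ) :
    coeff d (kern a b) = ∑ p ∈ Finset.HasAntidiagonal.antidiagonal d,
      if charge p.2 + b < 0 ∧ charge d + b = a then
        coeff p.1 (linExp twistCoeff) * coeff p.2 (linExp (-twistCoeff)) else 0 := by
  classical
  have h1 : zpw b - twistProj (zpw b) = loopExp twistCoeff *
      (loopExp (-twistCoeff) * zpw b - posProj (loopExp (-twistCoeff) * zpw b)) := by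
    rw [mul_sub, ← mul_assoc, ← loopExp_add, add_neg_cancel, loopExp_zero, one_mul, twistProj]
  rw [kern, h1, coeff_zc, coeff_mul, AddMonoidAlgebra.coeff_sum, Finsupp.finsetSum_apply]
  refine Finset.sum_congr rfl fun p hp => ?_
  have hd : charge p.1 + charge p.2 = charge d := by
    rw [← map_add, Finset.HasAntidiagonal.mem_antidiagonal.1 hp]
  have h2 : coeff p.2 (loopExp (-twistCoeff) * zpw b - posProj (loopExp (-twistCoeff) * zpw b)) =
      (if charge p.2 + b < 0 then coeff p.2 (linExp (-twistCoeff)) else 0) •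
        LaurentPolynomial.T (charge p.2 + b) := by
    ext n
    rw [← coeff_zc, map_sub, zc_posProj, zc_mul_zpw, zc_loopExp,
      AddMonoidAlgebra.coeff_smul_apply, LaurentPolynomial.T_apply, smul_eq_mul]
    by_cases hn : charge p.2 + b = n
    · rw [if_pos hn, mul_one]
      by_cases h0 : 0 ≤ n
      · rw [if_pos h0, sub_self, map_zero, if_neg (by omega)]
      · rw [if_neg h0, sub_zero, coeff_chargeComp, if_pos (by omega), if_pos (by omega)]
    · rw [if_neg hn, mul_zero]
      split_ifs with h0
      · rw [sub_self, map_zero]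
      · rw [sub_zero, coeff_chargeComp, if_neg (by omega)]
  rw [h2, coeff_loopExp, smul_mul_smul_comm, ← LaurentPolynomial.T_add,
    AddMonoidAlgebra.coeff_smul_apply, LaurentPolynomial.T_apply, smul_eq_mul]
  by_cases h3 : charge p.2 + b < 0
  · by_cases h4 : charge d + b = a
    · rw [if_pos h3, if_pos (by omega), if_pos ⟨h3, h4⟩, mul_one]
    · rw [if_neg (show ¬ (charge p.1 + (charge p.2 + b) = a) by omega), mul_zero,
        if_neg (fun h => h4 h.2)]
  · rw [if_neg h3, mul_zero, zero_mul, if_neg (fun h => h3 h.1)]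

/-- To return from a negative mode to mode `a`, the factor `J` must supply charge greater than `a`,
and charge is at most `t⁺`-degree. -/
theorem kern_mem_plusIdeal (a : ℕ) (b : ℤ) : kern a b ∈ plusIdeal ℂ a := by
  intro d hd
  rw [coeff_kern]
  refine Finset.sum_eq_zero fun p hp => if_neg fun h => ?_
  have h1 : charge p.1 + charge p.2 = charge d := by
    rw [← map_add, Finset.HasAntidiagonal.mem_antidiagonal.1 hp]
  have h2 : plusDeg p.1 + plusDeg p.2 = plusDeg d := by
    rw [← map_add, Finset.HasAntidiagonal.mem_antidiagonal.1 hp]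
  have h3 := charge_le_plusDeg p.1
  omega

theorem zc_posProj_twistProj (a b : ℕ) :
    zc a (posProj (twistProj (zpw b))) = (if a = b then 1 else 0) - kern a b := by
  rw [kern, map_sub, zc_zpw, zc_posProj, if_pos (Int.natCast_nonneg a)]
  simp

theorem toeplitzOp_neg (h : LoopSeries) : toeplitzOp (-h) = -toeplitzOp h := by
  simp only [toeplitzOp, mul_neg, map_neg]

/-- Modes from `M` on have coefficients in the ideal, so up to the ideal the operator acts on `y` as
a finite matrix. -/
theorem zc_toeplitzOp_sub_mem {M : ℕ} {y : LoopSeries} (hneg : ∀ n < 0, zc n y = 0)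
    (hM : ∀ n : ℕ, M ≤ n → zc n y ∈ plusIdeal ℂ M) (i : ℤ) :
    zc i (toeplitzOp y) - ∑ j ∈ Finset.range M, zc j y * toeplitzEntry i j ∈ plusIdeal ℂ M := by
  have h0 : y - ∑ j ∈ Finset.range M, constLoop (zc j y) * zpw j ∈
      plusIdeal (LaurentPolynomial ℂ) M := by
    rw [mem_plusIdeal_iff_zc]
    intro n
    rw [map_sub, zc_sum_constLoop_mul_zpw M (fun j => zc j y)]
    split_ifs with hn
    · rw [Int.toNat_of_nonneg hn.1, sub_self]
      exact zero_mem _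
    · rw [sub_zero]
      by_cases h1 : 0 ≤ n
      · obtain ⟨n, rfl⟩ := Int.eq_ofNat_of_zero_le h1
        exact hM n (by omega)
      · rw [hneg n (by omega)]
        exact zero_mem _
  have h1 := mem_plusIdeal_iff_zc.1 (toeplitzOp_mem_plusIdeal h0) i
  rw [sub_eq_add_neg, toeplitzOp_add, toeplitzOp_neg, ← sub_eq_add_neg, toeplitzOp_sum, map_sub,
    map_sum] at h1
  simp only [toeplitzOp_constLoop_mul, zc_constLoop_mul] at h1
  exact h1

/-- The truncations of `toeplitzOp` and `1 - K̃` to `M` modes are inverse up to the discarded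
entries `kern n b` with `n ≥ M`. -/
theorem sum_toeplitzEntry_mul (M i b : ℕ) (hb : b < M) :
    ∑ j ∈ Finset.range M, toeplitzEntry i j * ((if j = b then 1 else 0) - kern j b) -
      (if i = b then 1 else 0) ∈ plusIdeal ℂ M := by
  have h1 := zc_toeplitzOp_sub_mem (M := M) (y := posProj (twistProj (zpw b)))
    (fun n hn => by rw [zc_posProj, if_neg (by omega)])
    (fun n hn => by
      rw [zc_posProj_twistProj, if_neg (by omega), zero_sub]
      exact neg_mem (plusIdeal_anti hn (kern_mem_plusIdeal n b))) i
  rw [toeplitzOp_twistProj (zSupp_zpw _ (by simp)), zc_zpw] at h1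
  simp only [zc_posProj_twistProj, Nat.cast_inj] at h1
  have h2 := neg_mem h1
  rw [neg_sub] at h2
  simpa only [mul_comm] using h2

/-- The truncation of the triple product is exact: the minus factor never raises a mode `j < M`, and
the plus factor never brings a mode `≥ M` back below `M`. -/
theorem toeplitzEntry_eq (M : ℕ) {i j : ℕ} (hi : i < M) (hj : j < M) :
    toeplitzEntry i j = ∑ k ∈ Finset.range M, ∑ l ∈ Finset.range M,
      chargeComp (i - k) (linExp plusCoeff) * chargeComp (k - l) (linExp toeplitzCoeff) *
        chargeComp (l - j) (linExp minusCoeff) := by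
  set y := posProj (loopExp minusCoeff * zpw j) with hy
  have hzy (l : ℕ) : zc l y = chargeComp (l - j) (linExp minusCoeff) := by
    rw [hy, zc_posProj, if_pos (Int.natCast_nonneg l), zc_mul_zpw, zc_loopExp]
  have h1 : y = ∑ l ∈ Finset.range M, constLoop (zc l y) * zpw l := by
    refine ZSupp.eq_sum fun n hn => ?_
    rw [hy, zc_posProj]
    split_ifs with h0
    · refine (zSupp_loopExp_minus.mul (zSupp_zpw (S := Set.Iic (j : ℤ)) j (by simp))
        (V := Set.Iic (j : ℤ)) ?_) n ?_
      · intro a ha b hb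
        simp only [Set.mem_Iic] at *; omega
      · simp only [Set.mem_Ico, Set.mem_Iic] at *; omega
    · rfl
  set x := posProj (loopExp toeplitzCoeff * y) with hx
  have hzx (k : ℕ) : zc k x = ∑ l ∈ Finset.range M,
      chargeComp (l - j) (linExp minusCoeff) * chargeComp (k - l) (linExp toeplitzCoeff) := by
    rw [hx, zc_posProj, if_pos (Int.natCast_nonneg k), h1, Finset.mul_sum, map_sum]
    refine Finset.sum_congr rfl fun l _ => ?_
    rw [mul_left_comm, zc_constLoop_mul, zc_mul_zpw, zc_loopExp, hzy]
  have h2 : ZSupp (Set.Ici M) (x - ∑ k ∈ Finset.range M, constLoop (zc k x) * zpw k) := by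
    intro n hn
    rw [map_sub, zc_sum_constLoop_mul_zpw M (fun k => zc k x)]
    split_ifs with h0
    · rw [Int.toNat_of_nonneg h0.1, sub_self]
    · rw [sub_zero, hx, zc_posProj, if_neg]
      rw [Set.mem_Ici] at hn; omega
  have h3 := (zSupp_loopExp_plus.mul_Ici_zero h2) i (by simpa using hi)
  rw [mul_sub, map_sub, sub_eq_zero, Finset.mul_sum, map_sum] at h3
  rw [toeplitzEntry, toeplitzOp, ← hy, ← hx, zc_posProj, if_pos (Int.natCast_nonneg i), h3]
  refine Finset.sum_congr rfl fun k _ => ?_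
  rw [mul_left_comm, zc_constLoop_mul, zc_mul_zpw, zc_loopExp, hzx, Finset.sum_mul]
  refine Finset.sum_congr rfl fun l _ => ?_
  ring

theorem chargeComp_eq_zero_of_zSupp {c : TVar → ℂ} {S : Set ℤ} (h : ZSupp S (loopExp c)) {n : ℤ}
    (hn : n ∉ S) : chargeComp n (linExp c) = 0 := by
  rw [← zc_loopExp]; exact h n hn

/-- The outer factors are unitriangular and do not change the determinant. -/
theorem det_toeplitzEntry (M : ℕ) :
    (Matrix.of fun i j : Fin M => toeplitzEntry (i : ℕ) (j : ℕ)).det =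
      toeplitzDet M (linExp toeplitzCoeff) := by
  have h : (Matrix.of fun i j : Fin M => toeplitzEntry (i : ℕ) (j : ℕ)) =
      (Matrix.of fun i j : Fin M => chargeComp ((i : ℤ) - j) (linExp plusCoeff)) *
        (Matrix.of fun i j : Fin M => chargeComp ((i : ℤ) - j) (linExp toeplitzCoeff)) *
        (Matrix.of fun i j : Fin M => chargeComp ((i : ℤ) - j) (linExp minusCoeff)) := by
    ext1 i j
    rw [Matrix.of_apply, toeplitzEntry_eq M i.2 j.2, Matrix.mul_assoc, Matrix.mul_apply,
      Finset.sum_range]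
    refine Finset.sum_congr rfl fun k _ => ?_
    rw [Matrix.mul_apply, Finset.sum_range, Finset.mul_sum]
    refine Finset.sum_congr rfl fun l _ => ?_
    simp only [Matrix.of_apply, mul_assoc]
  have hp : (Matrix.of fun i j : Fin M => chargeComp ((i : ℤ) - j) (linExp plusCoeff)).det = 1 := by
    rw [Matrix.det_of_isLowerTriangular]
    · refine Finset.prod_eq_one fun i _ => ?_
      rw [Matrix.of_apply, sub_self]
      exact chargeComp_zero_of fun d hd => (plusCoeff_charge (fun _ => rfl) hd).2
    · intro i j hij
      have hij' : (i : ℕ) < j := hij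
      rw [Matrix.of_apply]
      refine chargeComp_eq_zero_of_zSupp zSupp_loopExp_plus ?_
      rw [Set.mem_Ici]; omega
  have hm : (Matrix.of fun i j : Fin M => chargeComp ((i : ℤ) - j) (linExp minusCoeff)).det =
      1 := by
    rw [Matrix.det_of_isUpperTriangular]
    · refine Finset.prod_eq_one fun i _ => ?_
      rw [Matrix.of_apply, sub_self]
      exact chargeComp_zero_of fun d hd => (minusCoeff_charge (fun _ => rfl) hd).2
    · intro i j hij
      have hij' : (j : ℕ) < i := hij
      rw [Matrix.of_apply]
      refine chargeComp_eq_zero_of_zSupp zSupp_loopExp_minus ?_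
      rw [Set.mem_Iic]; omega
  rw [h, Matrix.det_mul, Matrix.det_mul, hp, hm, one_mul, mul_one, toeplitzDet]

/-- Jacobi's identity for complementary minors of inverse matrices. -/
theorem det_mul_det_toBlocks {R m n : Type*} [CommRing R] [Fintype m] [Fintype n] [DecidableEq m]
    [DecidableEq n] {A B : Matrix (m ⊕ n) (m ⊕ n) R} (h : A * B = 1) :
    A.det * B.toBlocks₂₂.det = A.toBlocks₁₁.det := by
  -- The right factor replaces the first block column of `B` by that of the identity, so both sides
  -- are block triangular.
  have h1 : A * Matrix.fromBlocks 1 B.toBlocks₁₂ 0 B.toBlocks₂₂ =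
      Matrix.fromBlocks A.toBlocks₁₁ 0 A.toBlocks₂₁ 1 := by
    have hA := Matrix.fromBlocks_toBlocks A
    have hB := Matrix.fromBlocks_toBlocks B
    rw [← hA, ← hB, Matrix.fromBlocks_multiply, ← Matrix.fromBlocks_one,
      Matrix.fromBlocks_inj] at h
    nth_rw 1 [← hA]
    rw [Matrix.fromBlocks_multiply, h.2.1, h.2.2.2]
    simp
  have h2 := congrArg Matrix.det h1
  rwa [Matrix.det_mul, Matrix.det_fromBlocks_zero₂₁, Matrix.det_one, one_mul,
    Matrix.det_fromBlocks_zero₁₂, Matrix.det_one, mul_one] at h2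

/-- The determinant of `1 - K̃` on the levels between `N` and `N + n`. -/
def gapDet (N n : ℕ) : MvPowerSeries TVar ℂ :=
  (1 - Matrix.of fun i j : Fin n => kern ((N + i : ℕ) : ℤ) ((N + j : ℕ) : ℤ)).det

/-- The finite form of the Borodin–Okounkov identity: Jacobi's identity over the quotient ring, in
which the two truncated matrices are exactly inverse. -/
theorem toeplitzDet_sub_mem (N n : ℕ) :
    toeplitzDet (N + n) (linExp toeplitzCoeff) * gapDet N n - toeplitzDet N (linExp toeplitzCoeff) ∈
      plusIdeal ℂ (N + n) := by
  set q := Ideal.Quotient.mk (plusIdeal ℂ (N + n))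
  let A : Matrix (Fin (N + n)) (Fin (N + n)) (MvPowerSeries TVar ℂ) :=
    Matrix.of fun i j => toeplitzEntry (i : ℕ) (j : ℕ)
  let B : Matrix (Fin (N + n)) (Fin (N + n)) (MvPowerSeries TVar ℂ) :=
    1 - Matrix.of fun i j : Fin (N + n) => kern (i : ℕ) (j : ℕ)
  have hAB : q.mapMatrix (A * B) = 1 := by
    rw [← map_one q.mapMatrix]
    ext1 i j
    rw [RingHom.mapMatrix_apply, RingHom.mapMatrix_apply, Matrix.map_apply, Matrix.map_apply,
      Ideal.Quotient.eq]
    have := sum_toeplitzEntry_mul (N + n) i j j.2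
    convert this using 1
    rw [Matrix.mul_apply, Finset.sum_range, Matrix.one_apply]
    congr 1
    · refine Finset.sum_congr rfl fun k _ => ?_
      simp only [A, B, Matrix.of_apply, Matrix.sub_apply, Matrix.one_apply, Fin.ext_iff]
    · simp only [Fin.ext_iff]
  let e : Fin N ⊕ Fin n ≃ Fin (N + n) := finSumFinEquiv
  have hAB' : (q.mapMatrix A).submatrix e e * (q.mapMatrix B).submatrix e e = 1 := by
    rw [Matrix.submatrix_mul_equiv, ← map_mul, hAB, Matrix.submatrix_one_equiv]
  have h := det_mul_det_toBlocks hAB'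
  rw [Matrix.det_submatrix_equiv_self, ← RingHom.map_det, det_toeplitzEntry] at h
  have h22 : ((q.mapMatrix B).submatrix e e).toBlocks₂₂.det = q (gapDet N n) := by
    rw [gapDet, RingHom.map_det]
    congr 1
    ext1 i j
    simp [B, e, Matrix.toBlocks₂₂, Matrix.one_apply, Fin.ext_iff]
  have h11 : ((q.mapMatrix A).submatrix e e).toBlocks₁₁.det =
      q (toeplitzDet N (linExp toeplitzCoeff)) := by
    rw [← det_toeplitzEntry, RingHom.map_det]
    congr 1
  rw [h22, h11, ← map_mul] at h
  exact Ideal.Quotient.eq.1 h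

theorem gapDet_sub_one_mem (N n : ℕ) : gapDet N n - 1 ∈ plusIdeal ℂ N := by
  rw [← Ideal.Quotient.eq, gapDet, RingHom.map_det, map_sub, map_one, map_one,
    show (Ideal.Quotient.mk (plusIdeal ℂ N)).mapMatrix
      (Matrix.of fun i j : Fin n => kern ((N + i : ℕ) : ℤ) ((N + j : ℕ) : ℤ)) = 0 from ?_,
    sub_zero, Matrix.det_one]
  ext1 i j
  rw [RingHom.mapMatrix_apply, Matrix.map_apply, Matrix.zero_apply, Ideal.Quotient.eq_zero_iff_mem]
  exact plusIdeal_anti (Nat.le_add_right _ _) (kern_mem_plusIdeal (N + i) _)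

/-- The gap determinant is `1` modulo `t⁺`-degree greater than `N`, because all entries of `K̃` on
levels above `N` lie in that ideal. -/
theorem toeplitzDet_stable {N M : ℕ} (h : N ≤ M) :
    toeplitzDet M (linExp toeplitzCoeff) - toeplitzDet N (linExp toeplitzCoeff) ∈
      plusIdeal ℂ N := by
  obtain ⟨n, rfl⟩ := Nat.exists_eq_add_of_le h
  have h1 := plusIdeal_anti (Nat.le_add_right N n) (toeplitzDet_sub_mem N n)
  have h2 := Ideal.mul_mem_left _ (toeplitzDet (N + n) (linExp toeplitzCoeff))
    (gapDet_sub_one_mem N n)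
  convert sub_mem h1 h2 using 1
  ring

/-! ### Toeplitz determinants of large size -/

theorem chargeVar_injective : Function.Injective chargeVar := by
  rintro (k | k) (l | l) h
  · simp only [chargeVar, Sum.elim_inl, Nat.cast_inj, PNat.coe_inj] at h
    rw [h]
  · have := k.pos
    have := l.pos
    simp only [chargeVar, Sum.elim_inl, Sum.elim_inr] at h
    omega
  · have := k.pos
    have := l.pos
    simp only [chargeVar, Sum.elim_inl, Sum.elim_inr] at h
    omega
  · simp only [chargeVar, Sum.elim_inr, neg_inj, Nat.cast_inj, PNat.coe_inj] at h
    rw [h]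

theorem exists_chargeVar {k : ℤ} (hk : k ≠ 0) : ∃ v, chargeVar v = k := by
  rcases lt_or_gt_of_ne hk with h | h
  · exact ⟨Sum.inr ⟨k.natAbs, by omega⟩, by change -((k.natAbs : ℕ) : ℤ) = k; omega⟩
  · exact ⟨Sum.inl ⟨k.natAbs, by omega⟩, by change ((k.natAbs : ℕ) : ℤ) = k; omega⟩

theorem powerSumMonomial_eq (d : TVar →₀ ℕ) :
    powerSumMonomial d = MvPolynomial.monomial (d.mapDomain chargeVar) 1 := by
  rw [MvPolynomial.monomial_eq, Finsupp.prod_mapDomain_index_inj chargeVar_injective, map_one,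
    one_mul, powerSumMonomial]

/-- The weight of the positive part of a monomial in the power sums. -/
def posWeight : (ℤ →₀ ℕ) →+ ℕ := Finsupp.weight Int.toNat

theorem posWeight_mapDomain (d : TVar →₀ ℕ) : posWeight (d.mapDomain chargeVar) = plusDeg d := by
  rw [posWeight, plusDeg, Finsupp.weight_apply, Finsupp.weight_apply, Finsupp.sum_mapDomain_index]
  · refine Finsupp.sum_congr fun v _ => ?_
    cases v <;> simp [chargeVar]
  · simp
  · intro _ _ _; rw [add_smul]

theorem mapDomain_chargeVar_zero (d : TVar →₀ ℕ) : d.mapDomain chargeVar 0 = 0 := by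
  refine Finsupp.mapDomain_of_notMem_range _ _ ?_
  rintro ⟨v, hv⟩
  cases v <;> simp [chargeVar] at hv

theorem exists_mapDomain_eq {a : ℤ →₀ ℕ} (ha : a 0 = 0) :
    ∃ d : TVar →₀ ℕ, d.mapDomain chargeVar = a := by
  refine ⟨a.comapDomain chargeVar chargeVar_injective.injOn, ?_⟩
  refine Finsupp.mapDomain_comapDomain _ chargeVar_injective _ fun k hk => ?_
  rw [Finset.mem_coe, Finsupp.mem_support_iff] at hk
  exact exists_chargeVar fun h => hk (h ▸ ha)

theorem toeplitzCoeff_inl (k : ℕ+) : toeplitzCoeff (Sum.inl k) = -(1 / (k : ℂ)) := by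
  simp [toeplitzCoeff, plusCoeff, minusCoeff]

theorem toeplitzCoeff_inr (k : ℕ+) : toeplitzCoeff (Sum.inr k) = -(1 / (k : ℂ)) := by
  simp [toeplitzCoeff, plusCoeff, minusCoeff]

theorem coeff_linExp_ne_zero {c : TVar → ℂ} (hc : ∀ v, c v ≠ 0) (d : TVar →₀ ℕ) :
    coeff d (linExp c) ≠ 0 := by
  rw [coeff_linExp]
  refine Finset.prod_ne_zero_iff.2 fun v _ => ?_
  exact smul_ne_zero (inv_ne_zero (Nat.cast_ne_zero.2 (Nat.factorial_ne_zero _)))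
    (pow_ne_zero _ (hc v))

theorem toeplitzCoeff_ne_zero (v : TVar) : toeplitzCoeff v ≠ 0 := by
  cases v with
  | inl k => rw [toeplitzCoeff_inl]; simp
  | inr k => rw [toeplitzCoeff_inr]; simp

/-- The polynomials in the power sums whose Weyl functional is constant from rank `D` on. -/
def stableSubmodule (D : ℕ) : Submodule ℂ PowerSumRing where
  carrier := {F | ∀ M, D ≤ M → weylFun M F = weylFun D F}
  zero_mem' := fun M _ => by rw [map_zero, map_zero]
  add_mem' := fun hF hG M hM => by rw [map_add, map_add, hF M hM, hG M hM]
  smul_mem' := fun c F hF M hM => by rw [map_smul, map_smul, hF M hM]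

/-- Stability of the Toeplitz coefficients passes to Weyl integrals, since every coefficient of the
exponential of the symbol is nonzero. -/
theorem monomial_mem_stableSubmodule {D : ℕ} {a : ℤ →₀ ℕ} (h0 : a 0 = 0) (ha : posWeight a ≤ D)
    (c : ℂ) : MvPolynomial.monomial a c ∈ stableSubmodule D := by
  have h : MvPolynomial.monomial a c = c • MvPolynomial.monomial a (1 : ℂ) := by
    rw [MvPolynomial.smul_monomial, smul_eq_mul, mul_one]
  rw [h]
  refine Submodule.smul_mem _ _ fun M hM => ?_
  obtain ⟨d, rfl⟩ := exists_mapDomain_eq h0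
  rw [posWeight_mapDomain] at ha
  rw [← powerSumMonomial_eq]
  have h1 := toeplitzDet_stable hM d ha
  rw [map_sub, coeff_toeplitzDet, coeff_toeplitzDet, ← mul_sub, mul_eq_zero, sub_eq_zero] at h1
  exact h1.resolve_left (coeff_linExp_ne_zero toeplitzCoeff_ne_zero d)

theorem shiftDer_monomial (M : ℕ) (k : ℤ) (a : ℤ →₀ ℕ) :
    shiftDer M k (MvPolynomial.monomial a 1) = ∑ l ∈ a.support,
      MvPolynomial.monomial (a - Finsupp.single l 1) ((a l : ℂ) * l) * pvar M (k + l) := by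
  rw [shiftDer, MvPolynomial.mkDerivation_monomial, one_smul]
  refine Finset.sum_congr rfl fun l _ => ?_
  beta_reduce
  rw [smul_eq_mul, ← mul_assoc]
  congr 1
  rw [mul_comm, MvPolynomial.C_mul_monomial, mul_comm]

/-- The loop equation has the form `M · w(G) + w(S) = 0` with `G` and `S` independent of `M`. Both
Weyl integrals are already stable at `M` and `M + 1`, so `w(G) = 0`, which is the stated Gaussian
recursion. -/
theorem weylFun_X_mul_monomial {a : ℤ →₀ ℕ} (h0 : a 0 = 0) {k : ℕ} (hk : 0 < k) {M : ℕ}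
    (hM : posWeight a + k ≤ M) :
    weylFun M (MvPolynomial.X (k : ℤ) * MvPolynomial.monomial a 1) =
      k * a (-k) * weylFun M (MvPolynomial.monomial (a - Finsupp.single (-k : ℤ) 1) 1) := by
  set D := posWeight a + k with hD
  set F : PowerSumRing := MvPolynomial.monomial a 1 with hF
  -- The terms of the loop equation in which `p_0 = M` does not occur: `l ≠ -k` in the derivative
  -- and `0 < j < k` in the quadratic part.
  set S : PowerSumRing := (∑ l ∈ a.support.erase (-k : ℤ),
      MvPolynomial.monomial (a - Finsupp.single l 1) ((a l : ℂ) * l) * MvPolynomial.X (k + l)) +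
    ∑ j ∈ Finset.Ico 1 (k : ℤ), MvPolynomial.X j * MvPolynomial.X (k - j) * F with hS
  have hmono (b : ℤ →₀ ℕ) (i : ℤ) (c : ℂ) : MvPolynomial.monomial b c * MvPolynomial.X i =
      MvPolynomial.monomial (b + Finsupp.single i 1) c := by
    rw [MvPolynomial.X, MvPolynomial.monomial_mul, mul_one]
  have hpw (i : ℤ) : posWeight (Finsupp.single i 1) = i.toNat := by
    rw [posWeight, Finsupp.weight_single, one_smul]
  have hsub (l : ℤ) (hl : a l ≠ 0) :
      posWeight (a - Finsupp.single l 1) + l.toNat = posWeight a :=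
    Finsupp.weight_sub_single_add hl
  have hsub0 (l : ℤ) : (a - Finsupp.single l 1 : ℤ →₀ ℕ) 0 = 0 := by
    rw [Finsupp.tsub_apply, h0, Nat.zero_sub]
  have hS_mem : S ∈ stableSubmodule D := by
    refine Submodule.add_mem _ (Submodule.sum_mem _ fun l hl => ?_)
      (Submodule.sum_mem _ fun j hj => ?_)
    · rw [Finset.mem_erase, Finsupp.mem_support_iff] at hl
      rw [hmono]
      refine monomial_mem_stableSubmodule ?_ ?_ _
      · rw [Finsupp.add_apply, hsub0, Finsupp.single_eq_of_ne (by omega), add_zero]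
      · have := hsub l hl.2
        rw [map_add, hpw]
        omega
    · rw [Finset.mem_Ico] at hj
      rw [mul_comm, ← mul_assoc, hF, hmono, hmono]
      refine monomial_mem_stableSubmodule ?_ ?_ _
      · rw [Finsupp.add_apply, Finsupp.add_apply, h0, Finsupp.single_eq_of_ne (by omega),
          Finsupp.single_eq_of_ne (by omega)]
        rfl
      · rw [map_add, map_add, hpw, hpw]
        omega
  set G : PowerSumRing := MvPolynomial.X (k : ℤ) * F -
    ((k : ℂ) * a (-k)) • MvPolynomial.monomial (a - Finsupp.single (-k : ℤ) 1) 1 with hG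
  have hG_mem : G ∈ stableSubmodule D := by
    refine Submodule.sub_mem _ ?_ ?_
    · rw [mul_comm, hF, hmono]
      refine monomial_mem_stableSubmodule ?_ ?_ _
      · rw [Finsupp.add_apply, h0, Finsupp.single_eq_of_ne (by omega), add_zero]
      · rw [map_add, hpw]; omega
    · by_cases hak : a (-k) = 0
      · rw [hak]; simp
      · refine Submodule.smul_mem _ _ (monomial_mem_stableSubmodule (hsub0 _) ?_ _)
        have := hsub _ hak
        omega
  have hloop (M : ℕ) : loopOp M k F = (M : ℂ) • G + S := by
    have h1 : shiftDer M k F = -(((M : ℂ) * ((k : ℂ) * a (-k))) •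
        MvPolynomial.monomial (a - Finsupp.single (-k : ℤ) 1) (1 : ℂ)) +
        ∑ l ∈ a.support.erase (-k : ℤ),
          MvPolynomial.monomial (a - Finsupp.single l 1) ((a l : ℂ) * l) *
            MvPolynomial.X (k + l) := by
      rw [hF, shiftDer_monomial]
      have hr : ∑ l ∈ a.support.erase (-k : ℤ),
          MvPolynomial.monomial (a - Finsupp.single l 1) ((a l : ℂ) * l) *
            MvPolynomial.X (k + l) = ∑ l ∈ a.support.erase (-k : ℤ),
          MvPolynomial.monomial (a - Finsupp.single l 1) ((a l : ℂ) * l) * pvar M (k + l) := by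
        refine Finset.sum_congr rfl fun l hl => ?_
        rw [Finset.mem_erase] at hl
        rw [pvar, if_neg (by omega)]
      have ht : MvPolynomial.monomial (a - Finsupp.single (-k : ℤ) 1)
          ((a (-k) : ℂ) * ((-k : ℤ) : ℂ)) * pvar M (k + -k) =
          -(((M : ℂ) * ((k : ℂ) * a (-k))) •
            MvPolynomial.monomial (a - Finsupp.single (-k : ℤ) 1) (1 : ℂ)) := by
        rw [pvar, if_pos (by omega), mul_comm, MvPolynomial.C_mul_monomial,
          MvPolynomial.smul_monomial, ← map_neg]
        congr 1
        push_cast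
        rw [smul_eq_mul]
        ring
      rw [hr, ← ht]
      by_cases hak : a (-k) = 0
      · rw [Finset.erase_eq_of_notMem (by simpa using hak), hak]
        simp
      · rw [Finset.add_sum_erase _ (fun l => MvPolynomial.monomial (a - Finsupp.single l 1)
          ((a l : ℂ) * l) * pvar M (k + l)) (Finsupp.mem_support_iff.2 hak)]
    have h2 : ssum (fun j => pvar M j * pvar M (k - j)) k = (M : ℂ) • MvPolynomial.X (k : ℤ) +
        ∑ j ∈ Finset.Ico 1 (k : ℤ), MvPolynomial.X j * MvPolynomial.X (k - j) := by
      rw [ssum, Finset.Ico_eq_empty (a := (k : ℤ)) (by omega), Finset.sum_empty, sub_zero,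
        ← Finset.insert_Ico_add_one_left_eq_Ico (by omega), Finset.sum_insert (by simp)]
      congr 1
      · rw [pvar, if_pos rfl, pvar, if_neg (by omega), sub_zero, MvPolynomial.smul_eq_C_mul]
      · refine Finset.sum_congr rfl fun j hj => ?_
        rw [Finset.mem_Ico] at hj
        rw [pvar, if_neg (by omega), pvar, if_neg (by omega)]
    rw [loopOp_apply, h1, h2, hG, hS, add_mul, Finset.sum_mul, smul_sub, smul_smul, smul_mul_assoc]
    abel
  have key (M : ℕ) : (M : ℂ) * weylFun M G + weylFun M S = 0 := by
    rw [← weylFun_loopOp (N := M) k F, hloop, map_add (weylFun M) _ S, map_smul, smul_eq_mul]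
  -- Subtracting the loop equations for two consecutive ranks isolates the coefficient of `M`.
  have hG0 : weylFun M G = 0 := by
    have e1 := key M
    have e2 := key (M + 1)
    rw [hG_mem (M + 1) (by omega), hS_mem (M + 1) (by omega)] at e2
    rw [hG_mem M hM, hS_mem M hM] at e1
    rw [hG_mem M hM]
    push_cast at e2
    linear_combination e2 - e1
  rw [hG, map_sub, map_smul, smul_eq_mul, sub_eq_zero] at hG0
  exact hG0

/-- The loop equation for `k = 0` expresses invariance under scalar rotations: it multiplies the
monomial by its charge. -/
theorem weylFun_powerSumMonomial_eq_zero (M : ℕ) {d : TVar →₀ ℕ} (hd : charge d ≠ 0) :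
    weylFun M (powerSumMonomial d) = 0 := by
  have h := weylFun_loopOp (N := M) 0 (powerSumMonomial d)
  have h1 : shiftDer M 0 (powerSumMonomial d) = (charge d : ℂ) • powerSumMonomial d := by
    rw [powerSumMonomial, charge_apply]
    simp only [Finsupp.prod, Finsupp.sum]
    induction d.support using Finset.induction_on with
    | empty => simp
    | insert v s hv ih =>
      rw [Finset.prod_insert hv, Finset.sum_insert hv, Derivation.leibniz, ih,
        Derivation.leibniz_pow, shiftDer, MvPolynomial.mkDerivation_X, pvar, zero_add,
        if_neg (by cases v <;> simp [chargeVar])]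
      simp only [smul_eq_mul, MvPolynomial.smul_eq_C_mul, nsmul_eq_mul]
      cases hdv : d v with
      | zero => simp
      | succ n => simp [pow_succ]; ring
  rw [loopOp_apply, h1, ssum_zero, zero_mul, add_zero, map_smul, smul_eq_mul, mul_eq_zero] at h
  exact h.resolve_left (by exact_mod_cast hd)

theorem coeff_add_single_linExp (c : TVar → ℂ) (d : TVar →₀ ℕ) (v : TVar) :
    coeff (d + Finsupp.single v 1) (linExp c) * (d v + 1) = c v * coeff d (linExp c) := by
  rw [← coeff_pderiv, pderiv_linExp, coeff_C_mul]

/-- The moment recursion in generating form: up to `t⁺`-degree `M`, the Toeplitz determinant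
satisfies `∂D/∂t⁺ₖ = (1/k) t⁻ₖ D`, the equation of `Z̃_∞`. -/
theorem coeff_toeplitzDet_add_single {d : TVar →₀ ℕ} {k : ℕ+} {M : ℕ}
    (hM : plusDeg (d + Finsupp.single (Sum.inl k) 1) ≤ M) :
    coeff (d + Finsupp.single (Sum.inl k) 1) (toeplitzDet M (linExp toeplitzCoeff)) *
      (d (Sum.inl k) + 1) =
        1 / k * coeff d (X (Sum.inr k) * toeplitzDet M (linExp toeplitzCoeff)) := by
  classical
  have hk : ((k : ℕ) : ℂ) ≠ 0 := by simp
  set a := d.mapDomain chargeVar with ha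
  have ha0 : a 0 = 0 := mapDomain_chargeVar_zero d
  have hak : a (-(k : ℕ)) = d (Sum.inr k) :=
    Finsupp.mapDomain_apply chargeVar_injective d (Sum.inr k)
  have h1 : powerSumMonomial (d + Finsupp.single (Sum.inl k) 1) =
      MvPolynomial.X ((k : ℕ) : ℤ) * MvPolynomial.monomial a 1 := by
    rw [powerSumMonomial_eq, Finsupp.mapDomain_add, Finsupp.mapDomain_single, mul_comm,
      MvPolynomial.X, MvPolynomial.monomial_mul, mul_one]
    rfl
  have h2 : posWeight a + (k : ℕ) ≤ M := by
    rw [ha, posWeight_mapDomain]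
    rw [map_add, plusDeg, Finsupp.weight_single] at hM
    simpa [plusDeg] using hM
  rw [coeff_toeplitzDet, h1, weylFun_X_mul_monomial ha0 k.pos h2, hak, mul_right_comm,
    coeff_add_single_linExp, toeplitzCoeff_inl, X, coeff_monomial_mul, one_mul]
  by_cases h0 : d (Sum.inr k) = 0
  · rw [if_neg (by rw [Finsupp.single_le_iff]; omega), h0]
    simp
  · have hle : Finsupp.single (Sum.inr k) 1 ≤ d := by
      rw [Finsupp.single_le_iff]; omega
    obtain ⟨d', rfl⟩ := exists_add_of_le hle
    have h3 : a - Finsupp.single (-(k : ℕ) : ℤ) 1 = d'.mapDomain chargeVar := by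
      rw [ha, Finsupp.mapDomain_add, Finsupp.mapDomain_single]
      exact add_tsub_cancel_left _ _
    rw [if_pos hle, add_tsub_cancel_left, coeff_toeplitzDet, h3, ← powerSumMonomial_eq]
    have h4 := coeff_add_single_linExp toeplitzCoeff d' (Sum.inr k)
    rw [toeplitzCoeff_inr] at h4
    rw [add_comm d'] at h4
    simp only [Finsupp.add_apply, Finsupp.single_eq_same, Nat.cast_add, Nat.cast_one] at h4 ⊢
    generalize weylFun M (powerSumMonomial d') = w at *
    generalize coeff d' (linExp toeplitzCoeff) = x at *
    generalize coeff (Finsupp.single (Sum.inr k) 1 + d') (linExp toeplitzCoeff) = y at *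
    field_simp at h4 ⊢
    linear_combination (-w) * h4

theorem pderiv_ZTildeInf_inl (k : ℕ+) :
    pderiv ℂ (Sum.inl k) ZTildeInf = C (1 / (k : ℂ)) * X (Sum.inr k) * ZTildeInf := by
  have hLF : LocallyFinite fun k : ℕ+ =>
      (C (1 / (k : ℂ)) * (tp k * tm k) : MvPowerSeries TVar ℂ) := by
    refine locallyFinite_of_injective Sum.inr_injective fun k d h => ?_
    rw [← mul_assoc] at h
    exact coeff_mul_X_ne_zero h
  have h0 : constantCoeff (formalSum fun k : ℕ+ =>
      (C (1 / (k : ℂ)) * (tp k * tm k) : MvPowerSeries TVar ℂ)) = 0 := by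
    simp only [← mul_assoc]
    exact constantCoeff_formalSum_mul_X _ _
  rw [ZTildeInf, pderiv_formalExp h0, pderiv_formalSum hLF]
  congr 1
  rw [formalSum_eq_single k]
  · simp [Derivation.leibniz, tp, tm, pderiv_X_of_ne]
  · intro j hj
    have : (Sum.inl j : TVar) ≠ Sum.inl k := by simpa using hj
    simp [Derivation.leibniz, tp, tm, pderiv_X_of_ne, this]

theorem coeff_ZTildeInf_add_single (d : TVar →₀ ℕ) (k : ℕ+) :
    coeff (d + Finsupp.single (Sum.inl k) 1) ZTildeInf * (d (Sum.inl k) + 1) =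
      1 / k * coeff d (X (Sum.inr k) * ZTildeInf) := by
  rw [← coeff_pderiv, pderiv_ZTildeInf_inl, mul_assoc, coeff_C_mul]

/-- The strong Szegő limit theorem with its rate. The differential equations in `t⁺` reduce to
monomials in `t⁻` alone; a nontrivial one has nonzero charge and does not occur on either side. -/
theorem toeplitzDet_sub_ZTildeInf_mem (M : ℕ) :
    toeplitzDet M (linExp toeplitzCoeff) - ZTildeInf ∈ plusIdeal ℂ M := by
  classical
  intro d hd
  rw [map_sub, sub_eq_zero]
  induction hn : d.degree using Nat.strong_induction_on generalizing d with
  | _ n ih =>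
  subst hn
  by_cases h : ∃ k, d (Sum.inl k) ≠ 0
  · obtain ⟨k, hk⟩ := h
    have hle : Finsupp.single (Sum.inl k) 1 ≤ d := by
      rw [Finsupp.single_le_iff]; omega
    obtain ⟨d', rfl⟩ := exists_add_of_le hle
    rw [add_comm] at hd ⊢
    have h1 := coeff_toeplitzDet_add_single hd
    have h2 := coeff_ZTildeInf_add_single d' k
    have h3 : coeff d' (X (Sum.inr k) * toeplitzDet M (linExp toeplitzCoeff)) =
        coeff d' (X (Sum.inr k) * ZTildeInf) := by
      refine coeff_mul_congr fun e he => ih _ ?_ e ?_ rfl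
      · have := Finsupp.degree_mono he
        rw [map_add, Finsupp.degree_single]
        omega
      · obtain ⟨e', rfl⟩ := exists_add_of_le he
        rw [map_add, map_add] at hd
        omega
    rw [h3, ← h2] at h1
    exact mul_right_cancel₀ (Nat.cast_add_one_ne_zero _) h1
  · push Not at h
    by_cases h0 : d = 0
    · rw [h0, coeff_toeplitzDet, coeff_ZTildeInf, if_pos (by simp)]
      have : (0 : TVar →₀ ℕ).comapDomain Sum.inl Sum.inl_injective.injOn = 0 := by ext; simp
      rw [this, Finsupp.prod_zero_index, coeff_zero_eq_constantCoeff_apply, constantCoeff_linExp,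
        powerSumMonomial, Finsupp.prod_zero_index, weylFun_one, one_mul]
    · have hne : charge d ≠ 0 := by
        intro hc
        -- Nonvanishing of this coefficient encodes that `d` involves only `t⁻`, so that charge zero
        -- would force `d = 0`.
        have h1 : coeff d (linExp minusCoeff) ≠ 0 := by
          rw [coeff_linExp]
          refine Finset.prod_ne_zero_iff.2 fun v hv => ?_
          cases v with
          | inl k => exact absurd (h k) (Finsupp.mem_support_iff.1 hv)
          | inr k =>
            exact smul_ne_zero (inv_ne_zero (Nat.cast_ne_zero.2 (Nat.factorial_ne_zero _)))
              (pow_ne_zero _ (by simp [minusCoeff]))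
        exact h0 ((minusCoeff_charge (fun _ => rfl) h1).2 hc)
      rw [coeff_toeplitzDet, weylFun_powerSumMonomial_eq_zero M hne, mul_zero, coeff_ZTildeInf,
        if_neg]
      intro hall
      refine h0 ?_
      ext v
      cases v with
      | inl k => exact h k
      | inr k => rw [← hall k]; exact h k

/-! ### The two-point functions as kernel entries -/

/-- The half-integer `a + 1/2`. -/
def halfInt (a : ℤ) : HalfInt := ⟨a + 1 / 2, a, rfl⟩

theorem coe_halfInt (a : ℤ) : (halfInt a : ℚ) = a + 1 / 2 := rfl

theorem jCoeff_eq {A : Type*} [CommRing A] [Algebra ℂ A] (x : Aˣ) :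
    jCoeff x = fun v => twistCoeff v • ((x ^ chargeVar v : Aˣ) : A) := by
  funext v
  cases v with
  | inl k => simp [jCoeff, twistCoeff, plusCoeff, minusCoeff, chargeVar]
  | inr k => simp [jCoeff, twistCoeff, plusCoeff, minusCoeff, chargeVar]

theorem wUnit_zpow (n : ℤ) : ((wUnit ^ n : ZWˣ) : ZW) = HahnSeries.single n 1 := by
  induction n using Int.induction_on with
  | zero => simp
  | succ n ih =>
    rw [zpow_add_one, Units.val_mul, ih]
    change _ * HahnSeries.single 1 1 = _
    rw [HahnSeries.single_mul_single, one_mul]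
  | pred n ih =>
    rw [zpow_sub_one, Units.val_mul, ih]
    change _ * HahnSeries.single (-1) 1 = _
    rw [HahnSeries.single_mul_single, one_mul, sub_eq_add_neg]

theorem zUnit_zpow (n : ℤ) :
    ((zUnit ^ n : ZWˣ) : ZW) = HahnSeries.C (LaurentPolynomial.T n) := by
  induction n using Int.induction_on with
  | zero => simp
  | succ n ih =>
    rw [zpow_add_one, Units.val_mul, ih]
    change _ * HahnSeries.C (LaurentPolynomial.T 1) = _
    rw [← map_mul, ← LaurentPolynomial.T_add]
  | pred n ih =>
    rw [zpow_sub_one, Units.val_mul, ih]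
    change _ * HahnSeries.C (LaurentPolynomial.T (-1)) = _
    rw [← map_mul, ← LaurentPolynomial.T_add, sub_eq_add_neg]

theorem coeff_invZsubW (n : ℤ) :
    invZsubW.coeff n = if 0 ≤ n then LaurentPolynomial.T (-n - 1) else 0 := by
  split_ifs with hn
  · obtain ⟨n, rfl⟩ := Int.eq_ofNat_of_zero_le hn
    rw [invZsubW, HahnSeries.ofPowerSeries_apply_coeff, PowerSeries.coeff_mk]
  · rw [invZsubW, HahnSeries.ofPowerSeries_apply, HahnSeries.embDomain_of_notMem_range]
    rintro ⟨m, rfl⟩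
    exact hn (Int.natCast_nonneg m)

theorem algebraMap_ZW (x : ℂ) : algebraMap ℂ ZW x = HahnSeries.C (LaurentPolynomial.C x) := by
  rw [HahnSeries.algebraMap_apply', ← HahnSeries.ofPowerSeries_C, PowerSeries.algebraMap_apply]
  rfl

theorem coeff_zpow_mul_invZsubW (x y : ℂ) (p q m n : ℤ) :
    (((algebraMap ℂ ZW x * ((zUnit ^ p : ZWˣ) : ZW)) *
      (algebraMap ℂ ZW y * ((wUnit ^ q : ZWˣ) : ZW)) * invZsubW).coeff m).coeff n =
      if q ≤ m ∧ p + q - m - 1 = n then x * y else 0 := by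
  rw [mul_mul_mul_comm, ← map_mul, algebraMap_ZW, mul_assoc, mul_assoc, zUnit_zpow, wUnit_zpow,
    HahnSeries.C_mul_eq_smul, HahnSeries.C_mul_eq_smul, HahnSeries.coeff_smul,
    HahnSeries.coeff_smul, HahnSeries.coeff_single_mul, one_mul, coeff_invZsubW, smul_eq_mul,
    smul_eq_mul, ← LaurentPolynomial.smul_eq_C_mul, AddMonoidAlgebra.coeff_smul_apply, smul_eq_mul]
  by_cases h1 : q ≤ m
  · rw [if_pos (by omega), ← LaurentPolynomial.T_add, LaurentPolynomial.T_apply]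
    by_cases h2 : p + q - m - 1 = n
    · rw [if_pos (by omega), if_pos ⟨h1, h2⟩, mul_one]
    · rw [if_neg (by omega), if_neg (fun h => h2 h.2), mul_zero]
  · rw [if_neg (by omega), if_neg (fun h => h1 h.1), mul_zero]
    simp

theorem ringInverse_J {A : Type*} [CommRing A] [Algebra ℂ A] (x : Aˣ) :
    Ring.inverse (J x) = linExp fun v => (-twistCoeff) v • ((x ^ chargeVar v : Aˣ) : A) := by
  rw [J_eq, ringInverse_linExp, jCoeff_eq]
  congr 1
  funext v
  rw [Pi.neg_apply, Pi.neg_apply, neg_smul]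

/-- Expanding `1/(z - w)` in `|w| < |z|` keeps exactly the negative modes, so the generating
function describes `J (1 - P) J⁻¹`. The floor of `-b - 1/2` is `-b - 1`, which turns the expansion
condition into `charge p.2 + b < 0`. -/
theorem KTilde_halfInt (a b : ℤ) : KTilde (halfInt a) (halfInt b) = kern a b := by
  classical
  have ha : ⌊(halfInt a : ℚ)⌋ = a := by
    rw [coe_halfInt, Int.floor_intCast_add]
    norm_num
  have hb : ⌊-(halfInt b : ℚ)⌋ = -b - 1 := by
    rw [coe_halfInt, Int.floor_eq_iff]
    push_cast
    constructor <;> linarith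
  ext d
  rw [coeff_kern]
  change ((coeff d kappa).coeff ⌊-(halfInt b : ℚ)⌋).coeff ⌊(halfInt a : ℚ)⌋ = _
  rw [ha, hb, kappa, coeff_mul_C, ringInverse_J, J_eq, jCoeff_eq, coeff_mul,
    Finset.sum_mul, HahnSeries.coeff_sum, AddMonoidAlgebra.coeff_sum, Finsupp.finsetSum_apply]
  refine Finset.sum_congr rfl fun p hp => ?_
  have hd : charge p.1 + charge p.2 = charge d := by
    rw [← map_add, Finset.HasAntidiagonal.mem_antidiagonal.1 hp]
  rw [coeff_linExp_zpow, coeff_linExp_zpow, Algebra.smul_def, Algebra.smul_def,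
    coeff_zpow_mul_invZsubW]
  refine if_congr ?_ rfl rfl
  omega

/-! ### The matrix integral as an average of a Toeplitz determinant -/

theorem haarFun_powerSumMonomial (N : ℕ) (d : TVar →₀ ℕ) :
    haarFun N (powerSumMonomial d) = weylFun N (powerSumMonomial d) := by
  refine haarFun_eq_weylFun (d := Finsupp.weight Int.natAbs (d.mapDomain chargeVar)) ?_
  rw [powerSumMonomial_eq]
  exact monomial_mem_weightFilt ⟨mapDomain_chargeVar_zero d, le_rfl⟩ 1

theorem coeff_hsAverage (f : MvPowerSeries TVar ℂ) (n : ℕ+ →₀ ℕ) :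
    coeff n (hsAverage f) = (n.prod fun k e => (e.factorial : ℂ) * (k : ℂ) ^ e) *
      coeff (Finsupp.sumElim n n) f := rfl

theorem hsAverage_sum {ι : Type*} (s : Finset ι) (f : ι → MvPowerSeries TVar ℂ) :
    hsAverage (∑ i ∈ s, f i) = ∑ i ∈ s, hsAverage (f i) := by
  ext n
  rw [coeff_hsAverage, map_sum, map_sum, Finset.mul_sum]
  rfl

theorem hsAverage_smul (c : ℂ) (f : MvPowerSeries TVar ℂ) :
    hsAverage (c • f) = c • hsAverage f := by
  ext n
  rw [coeff_hsAverage, coeff_smul, coeff_smul, coeff_hsAverage]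
  ring

/-- The symbol's signs cancel because `t⁺ₖ` and `t⁻ₖ` occur equally often, and the weight `n! kⁿ`
turns `1/(n!² k²ⁿ)` into the coefficient `1/(n! kⁿ)` of the integrand. -/
theorem hsAverage_toeplitzDet (N : ℕ) :
    hsAverage (toeplitzDet N (linExp toeplitzCoeff)) = Z N := by
  ext n
  have hZ : coeff n (Z N) = (n.prod fun k e => ((e.factorial : ℂ)⁻¹) * (1 / (k : ℂ)) ^ e) *
      weylFun N (powerSumMonomial (Finsupp.sumElim n n)) := by
    change ∫ u : U N, coeff n (integrand u) ∂haarU N = _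
    rw [← haarFun_powerSumMonomial, haarFun_apply, ← integral_const_mul]
    congr 1
    funext u
    rw [integrand_eq, coeff_linExp, powerSumMonomial, Finsupp.prod_sumElim, ← Finsupp.prod_mul]
    simp only [Finsupp.prod, map_prod, ← Finset.prod_mul_distrib]
    refine Finset.prod_congr rfl fun k _ => ?_
    simp only [Function.comp_apply, chargeVar, Sum.elim_inl, Sum.elim_inr, map_mul, map_pow,
      evalU_X, smul_eq_mul, mul_pow]
    ring
  rw [coeff_hsAverage, coeff_toeplitzDet, hZ, ← mul_assoc]
  congr 1
  rw [coeff_linExp, Finsupp.prod_sumElim, ← Finsupp.prod_mul, ← Finsupp.prod_mul]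
  refine Finsupp.prod_congr fun k _ => ?_
  have hk : ((k : ℕ) : ℂ) ≠ 0 := by simp
  have he : ((n k).factorial : ℂ) ≠ 0 := Nat.cast_ne_zero.2 (Nat.factorial_ne_zero _)
  simp only [Function.comp_apply, toeplitzCoeff_inl, toeplitzCoeff_inr, smul_eq_mul]
  rw [neg_pow, one_div, inv_pow]
  have h1 : ((-1 : ℂ) ^ n k) * (-1) ^ n k = 1 := by rw [← mul_pow]; simp
  field_simp
  linear_combination h1

theorem hsAverage_ZTildeInf : hsAverage ZTildeInf = Zinf := by
  classical
  ext n
  rw [hasProd_Zinf.2, coeff_hsAverage, coeff_ZTildeInf,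
    if_pos (fun k => by rw [Finsupp.sumElim_inl, Finsupp.sumElim_inr]),
    Finsupp.comapDomain_inl_sumElim, ← Finsupp.prod_mul]
  refine Finset.prod_eq_one fun k _ => ?_
  have hk : ((k : ℕ) : ℂ) ≠ 0 := by simp
  have he : ((n k).factorial : ℂ) ≠ 0 := Nat.cast_ne_zero.2 (Nat.factorial_ne_zero _)
  simp only [smul_eq_mul]
  rw [one_div, inv_pow]
  field_simp

theorem Zinf_mul_inv : Zinf * Zinf⁻¹ = 1 := by
  refine MvPowerSeries.mul_inv_cancel _ ?_
  rw [← coeff_zero_eq_constantCoeff_apply, hasProd_Zinf.2]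
  exact one_ne_zero

/-- The degree of a monomial in the variables `g`. -/
abbrev gDeg (n : ℕ+ →₀ ℕ) : ℕ := Finsupp.weight (fun k : ℕ+ => (k : ℕ)) n

theorem gDeg_mono {e n : ℕ+ →₀ ℕ} (h : e ≤ n) : gDeg e ≤ gDeg n := by
  obtain ⟨d, rfl⟩ := exists_add_of_le h
  rw [gDeg, gDeg, map_add]
  omega

theorem plusDeg_sumElim (n : ℕ+ →₀ ℕ) : plusDeg (Finsupp.sumElim n n) = gDeg n := by
  rw [Finsupp.sumElim_eq_add, map_add, plusDeg, gDeg, Finsupp.weight_apply, Finsupp.weight_apply,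
    Finsupp.weight_apply, Finsupp.sum_mapDomain_index, Finsupp.sum_mapDomain_index]
  · simp
  · simp
  · intro _ _ _; rw [add_smul]
  · simp
  · intro _ _ _; rw [add_smul]

theorem coeff_hsAverage_congr {M : ℕ} {f g : MvPowerSeries TVar ℂ} (h : f - g ∈ plusIdeal ℂ M)
    {n : ℕ+ →₀ ℕ} (hn : gDeg n ≤ M) : coeff n (hsAverage f) = coeff n (hsAverage g) := by
  have h1 := h (Finsupp.sumElim n n) (by rwa [plusDeg_sumElim])
  rw [map_sub, sub_eq_zero] at h1
  rw [coeff_hsAverage, coeff_hsAverage, h1]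

/-- The finite Borodin–Okounkov identity with `D_{N+L}` replaced by `Z̃_∞`; both errors have
`t⁺`-degree above `N + L` and are invisible to the average at this monomial. -/
theorem coeff_Z {N L : ℕ} {n : ℕ+ →₀ ℕ} (hn : gDeg n ≤ N + L) :
    coeff n (Z N) = coeff n (hsAverage (ZTildeInf * gapDet N L)) := by
  rw [← hsAverage_toeplitzDet]
  refine coeff_hsAverage_congr ?_ hn
  have h1 := toeplitzDet_sub_mem N L
  have h2 := Ideal.mul_mem_left _ (gapDet N L) (toeplitzDet_sub_ZTildeInf_mem (N + L))
  convert neg_mem (add_mem h1 (neg_mem h2)) using 1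
  ring

/-! ### The expansion in minors -/

theorem sum_det_submatrix_powersetCard {R ι : Type*} [CommRing R] [Fintype ι] [LinearOrder ι]
    (M : Matrix ι ι R) (m : ℕ) :
    ∑ s ∈ (Finset.univ : Finset ι).powersetCard m,
      (M.submatrix (Subtype.val : s → ι) (Subtype.val : s → ι)).det =
    ∑ φ : Fin m ↪o ι, (M.submatrix φ φ).det := by
  refine Finset.sum_bij (fun s hs => s.orderEmbOfFin (Finset.mem_powersetCard.1 hs).2)
    (fun _ _ => Finset.mem_univ _) ?_ ?_ ?_
  · intro s hs t ht h
    have h1 := Finset.range_orderEmbOfFin s (Finset.mem_powersetCard.1 hs).2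
    rw [h, Finset.range_orderEmbOfFin] at h1
    exact_mod_cast h1.symm
  · intro φ _
    refine ⟨Finset.univ.map φ.toEmbedding, Finset.mem_powersetCard.2 ⟨Finset.subset_univ _, ?_⟩, ?_⟩
    · simp
    · exact (Finset.orderEmbOfFin_unique' _ fun x => by simp).symm
  · intro s hs
    rw [← Matrix.det_submatrix_equiv_self
      (Finset.orderIsoOfFin s (Finset.mem_powersetCard.1 hs).2).toEquiv]
    rfl

/-- The expansion of `det (1 - M)` in principal minors. -/
theorem det_one_sub_eq_sum {R : Type*} [CommRing R] {L : ℕ} (M : Matrix (Fin L) (Fin L) R) :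
    (1 - M).det = ∑ m ∈ Finset.range (L + 1),
      (-1) ^ m * ∑ φ : Fin m ↪o Fin L, (M.submatrix φ φ).det := by
  nontriviality R
  -- The determinant is the characteristic polynomial at `1`, whose coefficients are signed sums of
  -- principal minors.
  have h1 := Matrix.eval_charpoly M 1
  rw [map_one, Polynomial.eval_eq_sum_range, Matrix.charpoly_natDegree_eq_dim,
    Fintype.card_fin, ← Finset.sum_range_reflect] at h1
  rw [← h1]
  refine Finset.sum_congr rfl fun m hm => ?_
  rw [Finset.mem_range] at hm
  have h2 := Matrix.charpoly_coeff_eq_sum_minors M m (by rw [Fintype.card_fin]; omega)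
  rw [Fintype.card_fin] at h2
  rw [one_pow, mul_one, Nat.add_sub_cancel, h2, sum_det_submatrix_powersetCard]

theorem K_halfInt {m : ℕ} (a : Fin m → ℤ) : K (fun i => halfInt (a i)) =
    hsAverage (ZTildeInf * (Matrix.of fun i j => kern (a i) (a j)).det) * Zinf⁻¹ := by
  simp only [K, KTilde_halfInt]

theorem K_fin_zero (r : Fin 0 → HalfInt) : K r = 1 := by
  rw [K, Matrix.det_isEmpty, mul_one, hsAverage_ZTildeInf, Zinf_mul_inv]

/-- The tuple of levels above `N` given by an increasing tuple of natural numbers below `L`. -/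
def levelTuple (N L m : ℕ) (φ : Fin m ↪o Fin L) : Levels N m :=
  ⟨fun i => halfInt ((N + φ i : ℕ) : ℤ), by
    constructor
    · intro i j hij
      have h : (φ i : ℕ) < φ j := φ.strictMono hij
      change (halfInt _ : ℚ) < halfInt _
      rw [coe_halfInt, coe_halfInt]
      have : (((N + φ i : ℕ) : ℤ) : ℚ) < ((N + φ j : ℕ) : ℤ) := by exact_mod_cast (by omega)
      linarith
    · intro i
      rw [coe_halfInt]
      push_cast
      have : (0 : ℚ) ≤ (φ i : ℕ) := by positivity
      linarith⟩

theorem ZTildeInf_mul_gapDet (N L : ℕ) :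
    ZTildeInf * gapDet N L = ∑ m ∈ Finset.range (L + 1), ((-1 : ℂ) ^ m) •
      ∑ φ : Fin m ↪o Fin L, ZTildeInf * (Matrix.of fun i j : Fin m =>
        kern ((N + φ i : ℕ) : ℤ) ((N + φ j : ℕ) : ℤ)).det := by
  rw [gapDet, det_one_sub_eq_sum, Finset.mul_sum]
  refine Finset.sum_congr rfl fun m _ => ?_
  rw [← Finset.mul_sum, mul_left_comm, smul_eq_C_mul, map_pow, map_neg, map_one]
  congr 2

theorem hsAverage_ZTildeInf_mul_gapDet (N L : ℕ) :
    hsAverage (ZTildeInf * gapDet N L) * Zinf⁻¹ = ∑ m ∈ Finset.range (L + 1), ((-1 : ℂ) ^ m) •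
      ∑ φ : Fin m ↪o Fin L, K (levelTuple N L m φ).1 := by
  rw [ZTildeInf_mul_gapDet, hsAverage_sum, Finset.sum_mul]
  refine Finset.sum_congr rfl fun m _ => ?_
  rw [hsAverage_smul, hsAverage_sum, smul_mul_assoc, Finset.sum_mul]
  exact congrArg _ (Finset.sum_congr rfl fun φ _ =>
    (K_halfInt fun i => ((N + φ i : ℕ) : ℤ)).symm)

theorem coeff_Z_mul_inv {N L : ℕ} {n : ℕ+ →₀ ℕ} (hn : gDeg n ≤ N + L) :
    coeff n (Z N * Zinf⁻¹) = ∑ m ∈ Finset.range (L + 1), (-1) ^ m *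
      ∑ φ : Fin m ↪o Fin L, coeff n (K (levelTuple N L m φ).1) := by
  have h1 : coeff n (Z N * Zinf⁻¹) =
      coeff n (hsAverage (ZTildeInf * gapDet N L) * Zinf⁻¹) := by
    rw [mul_comm, mul_comm _ Zinf⁻¹]
    exact coeff_mul_congr fun e he => coeff_Z ((gDeg_mono he).trans hn)
  rw [h1, hsAverage_ZTildeInf_mul_gapDet, map_sum]
  refine Finset.sum_congr rfl fun m _ => ?_
  rw [coeff_smul, map_sum]

/-! ### Degree bounds -/

/-- Each term of the determinant takes one entry from every row, and row `a i` contributes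
`t⁺`-degree at least `a i + 1`. -/
theorem le_weightedOrder_det_kern {m : ℕ} (a : Fin m → ℕ) :
    ((∑ i, (a i + 1) : ℕ) : ℕ∞) ≤
      weightedOrder (Sum.elim (fun k : ℕ+ => (k : ℕ)) fun _ => 0)
        (Matrix.of fun i j => kern (a i) (a j)).det := by
  refine nat_le_weightedOrder _ fun d hd => ?_
  rw [Matrix.det_apply, map_sum]
  refine Finset.sum_eq_zero fun σ _ => ?_
  rw [Units.smul_def, map_zsmul, coeff_eq_zero_of_lt_weightedOrder
    (Sum.elim (fun k : ℕ+ => (k : ℕ)) fun _ => 0), smul_zero]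
  refine lt_of_lt_of_le (Nat.cast_lt.2 hd) (le_trans ?_ (le_weightedOrder_prod _ _ _))
  rw [← Equiv.sum_comp σ, Nat.cast_sum]
  refine Finset.sum_le_sum fun i _ => ?_
  refine nat_le_weightedOrder _ fun d hd => kern_mem_plusIdeal (a (σ i)) _ d ?_
  exact Nat.lt_succ_iff.1 hd

theorem le_weightedOrder_hsAverage {p : ℕ} {f : MvPowerSeries TVar ℂ}
    (hf : (p : ℕ∞) ≤ weightedOrder (Sum.elim (fun k : ℕ+ => (k : ℕ)) fun _ => 0) f) :
    (p : ℕ∞) ≤ weightedOrder (fun k : ℕ+ => (k : ℕ)) (hsAverage f) := by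
  refine nat_le_weightedOrder _ fun n hn => ?_
  rw [coeff_hsAverage, coeff_eq_zero_of_lt_weightedOrder
    (Sum.elim (fun k : ℕ+ => (k : ℕ)) fun _ => 0), mul_zero]
  refine lt_of_lt_of_le (Nat.cast_lt.2 ?_) hf
  exact (plusDeg_sumElim n).trans_lt hn

theorem le_weightedOrder_K {m : ℕ} (a : Fin m → ℕ) :
    ((∑ i, (a i + 1) : ℕ) : ℕ∞) ≤
      weightedOrder (fun k : ℕ+ => (k : ℕ)) (K fun i => halfInt (a i)) := by
  rw [K_halfInt]
  refine le_trans ?_ (le_weightedOrder_mul _)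
  refine le_trans (le_weightedOrder_hsAverage ?_) le_self_add
  refine le_trans (le_weightedOrder_det_kern a) ?_
  refine le_trans ?_ (le_weightedOrder_mul _)
  exact le_add_self

theorem exists_levels_eq {N m : ℕ} (r : Levels N m) :
    ∃ a : Fin m → ℕ, StrictMono a ∧ (∀ i, N ≤ a i) ∧ r.1 = fun i => halfInt (a i) := by
  obtain ⟨r, hmono, hN⟩ := r
  choose b hb using fun i => (r i).2
  have hbN (i : Fin m) : (N : ℤ) ≤ b i := by
    have h := hN i
    rw [hb i] at h
    have h1 : ((N : ℤ) : ℚ) < ((b i + 1 : ℤ) : ℚ) := by push_cast; linarith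
    have h2 : (N : ℤ) < b i + 1 := by exact_mod_cast h1
    omega
  have hbm : StrictMono b := by
    intro i j hij
    have h : (r i : ℚ) < r j := hmono hij
    rw [hb i, hb j] at h
    have h1 : (b i : ℚ) < b j := by linarith
    exact_mod_cast h1
  refine ⟨fun i => (b i).toNat, fun i j hij => ?_, fun i => ?_, ?_⟩
  · have := hbm hij
    have := hbN i
    have := hbN j
    change (b i).toNat < (b j).toNat
    omega
  · have := hbN i
    change N ≤ (b i).toNat
    omega
  · funext i
    have := hbN i
    refine Subtype.ext ?_
    rw [coe_halfInt, Int.toNat_of_nonneg (by omega)]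
    exact hb i

theorem add_le_of_strictMono {N m : ℕ} {a : Fin m → ℕ} (ha : StrictMono a) (hN : ∀ i, N ≤ a i)
    (i : Fin m) : N + i ≤ a i := by
  obtain ⟨i, hi⟩ := i
  induction i with
  | zero => exact hN _
  | succ i ih =>
    have h1 := ih (by omega)
    have h2 : a ⟨i, by omega⟩ < a ⟨i + 1, hi⟩ := ha (by simp)
    simp only at h1 ⊢
    omega

/-- The minimum is attained at the lowest levels `N, N + 1, …, N + m - 1`. -/
theorem le_sum_of_strictMono {N m : ℕ} {a : Fin m → ℕ} (ha : StrictMono a) (hN : ∀ i, N ≤ a i) :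
    m * N + m * (m + 1) / 2 ≤ ∑ i, (a i + 1) := by
  have h1 : ∑ i : Fin m, (N + i + 1) ≤ ∑ i, (a i + 1) :=
    Finset.sum_le_sum fun i _ => Nat.add_le_add_right (add_le_of_strictMono ha hN i) 1
  refine le_trans (le_of_eq ?_) h1
  have h2 : ∑ i : Fin m, (N + (i : ℕ) + 1) = ∑ i ∈ Finset.range m, (N + i + 1) :=
    (Finset.sum_range fun i => N + i + 1).symm
  have h3 : ∑ i ∈ Finset.range m, (i + 1) = m * (m + 1) / 2 := by
    have := Finset.sum_range_id (m + 1)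
    rw [Finset.sum_range_succ'] at this
    simpa [mul_comm] using this
  rw [h2, ← h3]
  simp only [add_assoc, Finset.sum_add_distrib, Finset.sum_const, Finset.card_range, smul_eq_mul]

theorem level_lt_of_coeff_K_ne_zero {m : ℕ} {a : Fin m → ℕ} {n : ℕ+ →₀ ℕ}
    (h : coeff n (K fun i => halfInt (a i)) ≠ 0) (i : Fin m) : a i < gDeg n := by
  have h1 := (le_weightedOrder_K a).trans (weightedOrder_le (fun k : ℕ+ => (k : ℕ)) h)
  rw [Nat.cast_le] at h1
  have h2 := Finset.single_le_sum (f := fun i => a i + 1) (fun _ _ => Nat.zero_le _)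
    (Finset.mem_univ i)
  exact lt_of_lt_of_le (Nat.lt_succ_self _) (h2.trans h1)

/-- A contributing tuple has every level below the degree of the monomial, hence inside the window
from `N` to `N + L`. -/
theorem exists_levelTuple_eq {N L m : ℕ} {n : ℕ+ →₀ ℕ} (hn : gDeg n ≤ N + L) (r : Levels N m)
    (hr : coeff n (K r.1) ≠ 0) : ∃ φ, levelTuple N L m φ = r := by
  obtain ⟨a, ha, hN, hra⟩ := exists_levels_eq r
  rw [hra] at hr
  have hlt (i : Fin m) : a i - N < L := by
    have := level_lt_of_coeff_K_ne_zero hr i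
    have := hN i
    omega
  refine ⟨OrderEmbedding.ofStrictMono (fun i => ⟨a i - N, hlt i⟩) fun i j hij => ?_, ?_⟩
  · have := ha hij
    have := hN i
    change a i - N < a j - N
    omega
  · refine Subtype.ext ?_
    rw [hra]
    funext i
    change halfInt ((N + (a i - N) : ℕ) : ℤ) = _
    rw [Nat.add_sub_cancel' (hN i)]

theorem levelTuple_injective (N L m : ℕ) : Function.Injective (levelTuple N L m) := by
  intro φ ψ h
  ext i
  have h1 : (halfInt ((N + φ i : ℕ) : ℤ) : ℚ) = halfInt ((N + ψ i : ℕ) : ℤ) :=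
    congrArg (fun r : Levels N m => (r.1 i : ℚ)) h
  rw [coe_halfInt, coe_halfInt, add_left_inj] at h1
  have h2 : N + (φ i : ℕ) = N + ψ i := by exact_mod_cast h1
  omega

theorem locallyFinite_K (N m : ℕ) : LocallyFinite fun r : Levels N m => K r.1 := by
  intro n
  refine (Set.finite_range (levelTuple N (gDeg n) m)).subset fun r hr => ?_
  exact exists_levelTuple_eq (by omega) r hr

theorem coeff_formalSum_K {N L m : ℕ} {n : ℕ+ →₀ ℕ} (hn : gDeg n ≤ N + L) :
    coeff n (formalSum fun r : Levels N m => K r.1) =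
      ∑ φ : Fin m ↪o Fin L, coeff n (K (levelTuple N L m φ).1) := by
  rw [coeff_formalSum, finsum_eq_finsetSum_of_support_subset
    (s := Finset.univ.map ⟨levelTuple N L m, levelTuple_injective N L m⟩), Finset.sum_map]
  · rfl
  · intro r hr
    obtain ⟨φ, rfl⟩ := exists_levelTuple_eq hn r hr
    simp

theorem coeff_neg_one_pow_mul (m : ℕ) (f : MvPowerSeries ℕ+ ℂ) (n : ℕ+ →₀ ℕ) :
    coeff n ((-1) ^ m * f) = (-1) ^ m * coeff n f := by
  rw [← coeff_C_mul, map_pow, map_neg, map_one]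

theorem coeff_G {N L m : ℕ} {n : ℕ+ →₀ ℕ} (hn : gDeg n ≤ N + L) :
    coeff n (G N m) = (-1) ^ m * ∑ φ : Fin m ↪o Fin L, coeff n (K (levelTuple N L m φ).1) := by
  rw [G]
  split_ifs with hm
  · subst hm
    have : Unique (Fin 0 ↪o Fin L) :=
      ⟨⟨OrderEmbedding.ofStrictMono Fin.elim0 fun i => i.elim0⟩, fun _ => by ext i; exact i.elim0⟩
    rw [pow_zero, one_mul, Fintype.sum_unique, K_fin_zero]
  · rw [coeff_neg_one_pow_mul, coeff_formalSum_K hn]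

theorem le_weightedOrder_G (N m : ℕ) : ((m * N + m * (m + 1) / 2 : ℕ) : ℕ∞) ≤
    weightedOrder (fun k : ℕ+ => (k : ℕ)) (G N m) := by
  refine nat_le_weightedOrder _ fun n hn => ?_
  rw [coeff_G (L := gDeg n) (by omega), Finset.sum_eq_zero, mul_zero]
  intro φ _
  obtain ⟨a, ha, hN, hra⟩ := exists_levels_eq (levelTuple N (gDeg n) m φ)
  rw [hra]
  refine coeff_eq_zero_of_lt_weightedOrder _ (lt_of_lt_of_le (Nat.cast_lt.2 ?_)
    (le_weightedOrder_K a))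
  exact hn.trans_le (le_sum_of_strictMono ha hN)

/-- Already `m ≤ m(m+1)/2` bounds the number of levels by the degree, also for `N = 0`; this makes
the sum over `m` finite. -/
theorem le_of_coeff_G_ne_zero {N m : ℕ} {n : ℕ+ →₀ ℕ} (h : coeff n (G N m) ≠ 0) : m ≤ gDeg n := by
  have h1 := (le_weightedOrder_G N m).trans (weightedOrder_le (fun k : ℕ+ => (k : ℕ)) h)
  rw [Nat.cast_le] at h1
  refine le_trans ?_ h1
  refine le_trans ?_ (Nat.le_add_left _ _)
  rw [Nat.le_div_iff_mul_le (by norm_num)]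
  rcases Nat.eq_zero_or_pos m with rfl | hm
  · simp
  · exact Nat.mul_le_mul_left _ (by omega)

theorem locallyFinite_G (N : ℕ) : LocallyFinite (G N) := fun n =>
  (Set.finite_Iic (gDeg n)).subset fun _ hm => le_of_coeff_G_ne_zero hm

theorem Z_mul_inv_eq (N : ℕ) : Z N * Zinf⁻¹ = formalSum (G N) := by
  ext n
  -- With this window size the range of `m` in the minor expansion coincides with the one allowed by
  -- the degree bound.
  rw [coeff_Z_mul_inv (L := gDeg n) (by omega), coeff_formalSum,
    finsum_eq_finsetSum_of_support_subset (s := Finset.range (gDeg n + 1))]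
  · exact Finset.sum_congr rfl fun m _ => (coeff_G (by omega)).symm
  · intro m hm
    have := le_of_coeff_G_ne_zero hm
    rw [Finset.coe_range, Set.mem_Iio]
    omega

end GiantGraviton

end

theorem mainTheorem2 (N : ℕ) :
    GiantGraviton.LocallyFinite (GiantGraviton.G N) ∧
    GiantGraviton.Z N * GiantGraviton.Zinf⁻¹ =
      GiantGraviton.formalSum (GiantGraviton.G N) ∧
    (∀ m : ℕ, 1 ≤ m → GiantGraviton.LocallyFinite
      fun r : GiantGraviton.Levels N m => GiantGraviton.K r.1) ∧
    ∀ m : ℕ, ((m * N + m * (m + 1) / 2 : ℕ) : ℕ∞) ≤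
      MvPowerSeries.weightedOrder (fun k : ℕ+ => (k : ℕ)) (GiantGraviton.G N m) :=
  ⟨GiantGraviton.locallyFinite_G N, GiantGraviton.Z_mul_inv_eq N,
    fun m _ => GiantGraviton.locallyFinite_K N m, GiantGraviton.le_weightedOrder_G N⟩
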